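/- **Concurrent Fixed Point Logic (CFP) over the reals.** Terms denote real numbers and are built from variables and rational constants by $+$, $-$, $\cdot$ and $|\cdot|$. Formulas are built from $s=t$, $s\le t$, $s<t$ and $X(\vec t)$ ($X$ a predicate variable) by $\wedge,\vee,\to,\forall,\exists$; by least and greatest fixed points $\mu(\Phi)(\vec t)$ and $\nu(\Phi)(\vec t)$ of operators $\Phi=\lambda X\,\lambda\vec x\,A$ in which $X$ occurs only strictly positively in $A$ (i.e. not in the premise of an implication and not to the right of $\|$); by *restriction* $A\,\|\,B$; and by the *concurrency modality* $\downdownarrows A$. In $A\,\|\,B$ and $\downdownarrows A$ the formula $A$ has to be *productive*: every implication and every restriction in it is part of a Harrop formula or of a disjunction. A formula is *Harrop* if it has no $\vee$, $\|$, $\downdownarrows$ and no free predicate variable at a strictly positive position. Put $\bot:=\mu(\lambda X.X)$, $\neg A:=A\to\bot$, $P\subseteq Q:=\forall x\,(P(x)\to Q(x))$, and define the *iterated concurrency modality* $$\downdownarrows^{*}A:=\mu(\lambda Z.\ \downdownarrows(A\vee Z)).$$ The axioms are all formulas without $\vee,\|,\downdownarrows$ that are true in $\mathbb R$. The rules are those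 of intuitionistic first-order logic with equality; the fixed point rules - $\Phi(\mu\Phi)\subseteq\mu\Phi$; from $\Phi(P)\subseteq P$ infer $\mu\Phi\subseteq P$; - $\nu\Phi\subseteq\Phi(\nu\Phi)$; from $P\subseteq\Phi(P)$ infer $P\subseteq\nu\Phi$; and the following rules, where $A_0,A_1$ and, in the rules (a), $B$ are Harrop: - (a) from $B\to C$ and $\neg B\to A_0\wedge A_1$ infer $C\,\|\,B$, where $C$ is one of $A_0\vee A_1$, $\downdownarrows(A_0\vee A_1)$, $\downdownarrows^{*}(A_0\vee A_1)$; - $\dfrac{A}{A\|B}$, $\quad\dfrac{A\|B\quad A\to(A'\|B)}{A'\|B}$, $\quad\dfrac{A\|B\quad B'\to B}{A\|B'}$, $\quad\dfrac{A\|B\quad B}{A}$, $\quad\dfrac{}{A\|\bot}$, $\quad\dfrac{A\|B}{A\|\neg\neg B}$, $\quad\dfrac{(A\|B)\|C}{A\|(B\wedge C)}$, $\quad\dfrac{A\|B\quad C\|B}{(A\wedge C)\|B}$; - $\dfrac{A\|C\quad A\|\neg C}{\downdownarrows A}$, $\quad\dfrac{A}{\downdownarrows A}$, $\quad\dfrac{\downdownarrows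 A\quad A\to B}{\downdownarrows B}$, $\quad\dfrac{\downdownarrows A}{A}$ for Harrop $A$, $\quad\dfrac{\downdownarrows(A\|B)}{\downdownarrows A}$, $\quad\dfrac{A\|B\quad C\|D}{\downdownarrows(A\vee C)\,\|\,(B\vee D)}$; - $\dfrac{\downdownarrows^{*}A\quad\downdownarrows^{*}B}{\downdownarrows^{*}(A\wedge B)}$, and *iterated concurrent Archimedean induction*, for non-Harrop predicates $B,P$: $$\frac{\forall x\,\bigl(B(x)\wedge x\ne0\to\downdownarrows^{*}\bigl(P(x)\vee(|x|\le\tfrac12\wedge B(2x)\wedge(P(2x)\to P(x)))\bigr)\bigr)}{\forall x\,\bigl(B(x)\wedge x\neq0\to\downdownarrows^{*}P(x)\bigr)}.$$ Only well-formed formulas without free predicate variables are admitted in derivations. **Realisability.** Let $D$ be the Scott domain that is the canonical solution of $D=(\mathbf{Nil}+\mathbf{Left}(D)+\mathbf{Right}(D)+\mathbf{Pair}(D\times D)+\mathbf{Amb}(D\times D)+\mathbf{Fun}(D\to D))_{\bot}$. A subdomain is a subset of $D$ that is downward closed and closed under existing suprema. Closed programs are closed terms built from variables, the constructors, $\lambda$-abstraction,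 application, recursion $\mathbf{rec}$, $\bot$, and case analysis whose clauses (with constructor patterns, possibly nested or overlapping, or the pattern for functions) are pairwise compatible, i.e. a term that matches two clauses is given the same result by both; they denote elements of $D$. The type $\tau(A)$ of a formula is a subset of $D$: it is $\mathbf 1=\{\bot,\mathbf{Nil}\}$ if $A$ is Harrop. For non-Harrop $A$: predicate variables are assigned type variables; $\tau(B\vee C)=\tau(B)+\tau(C)$; $\tau(B\wedge C)=\tau(B)\times\tau(C)$ and $\tau(B\to C)=\tau(B)\Rightarrow\tau(C)$, where the type of a Harrop $B$ or $C$ is dropped; quantifiers are ignored; $\tau(B\|C)=\tau(B)$; $\tau(\downdownarrows B)=\{\bot\}\cup\{\mathbf{Amb}(a,b)\mid a,b\in\tau(B)\}$; and both fixed points have as type the least subdomain closed under the type operator of the body. *Realisers* are defined by recursion on formulas. A Harrop formula can only be realised by $\mathbf{Nil}$; atomic formulas are realised by $\mathbf{Nil}$ if true. Further - $\mathbf{Left}(a)$ realises $A\vee B$ if $a$ realises $A$; $\mathbf{Right}(b)$ realises it if $b$ realises $B$; - $\mathbf{Pair}(a,b)$ realises $A\wedge B$ if $a$ realises $A$ and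 $b$ realises $B$ (the component of a Harrop conjunct is dropped); - $c$ realises $A\to B$, for $A,B$ non-Harrop, if $c\in\tau(A\to B)$ and $c\,a$ realises $B$ whenever $a$ realises $A$; for $A$ Harrop and $B$ non-Harrop, if $c\in\tau(B)$ and $c$ realises $B$ provided that $A$ is realised; for $B$ Harrop, if $c=\mathbf{Nil}$ and $B$ is realised provided that $A$ is; - $a$ realises $\forall x\,A$ ($\exists x\,A$) if $a$ realises $A(r)$ for all (some) $r\in\mathbb R$; - $\mu$ and $\nu$ are realised by the least and the greatest fixed point, respectively, of the corresponding operator on realisability predicates; - $a$ realises $A\,\|\,B$ if $a\in\tau(A)$, $a\neq\bot$ whenever $B$ has a realiser, and $a$ realises $A$ whenever $a\ne\bot$; - $c$ realises $\downdownarrows A$ if $c=\mathbf{Amb}(a,b)$ with $a,b\in\tau(A)$, at least one of $a,b$ is $\neq\bot$, and each of $a,b$ that is $\ne\bot$ realises $A$. **The two predicates.** The *concurrent signed-digit predicate* $S^{*}$ and the *concurrent Gray-code predicate* $G^{*}$ are the greatest predicates with $$S^{*}(x)=\downdownarrows^{*}\bigl(\exists d\,\bigl(((d=-1\vee d=1)\vee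 d=0)\wedge|2x-d|\le1\wedge S^{*}(2x-d)\bigr)\bigr),$$ $$G^{*}(x)=-1\le x\le 1\ \wedge\ \bigl(x\neq0\to\downdownarrows^{*}(x\le0\vee x\ge0)\bigr)\ \wedge\ G^{*}(1-2|x|),$$ that is, they are defined in CFP by the operator $\nu$. **Theorem.** In CFP one has $S^{*}=G^{*}$: both $\forall x\,(S^{*}(x)\to G^{*}(x))$ and $\forall x\,(G^{*}(x)\to S^{*}(x))$ are provable. Moreover, each of these two formulas is realised by a closed program; that is, there are programs that translate in both directions between the realisers of $S^{*}(x)$ (concurrent signed-digit representations) and the realisers of $G^{*}(x)$ (concurrent Gray codes), uniformly in $x$. -/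

import Mathlib

noncomputable section

namespace CFP

/-! ### Environments and fixed points -/

/-- Extend an environment (indexed by de Bruijn indices) by one entry. -/
def push {α : Type*} (a : α) (f : ℕ → α) : ℕ → α
  | 0 => a
  | i + 1 => f i

/-- Extend an environment by a list of entries; entry `i` of the list gets index `i`. -/
def pushL {α : Type*} (as : List α) (f : ℕ → α) : ℕ → α :=
  fun i => as.getD i (f (i - as.length))

/-- The least fixed point (least closed predicate) of a monotone operator on predicates. -/
def lfpP {α : Type*} (T : (α → Prop) → α → Prop) (x : α) : Prop :=
  ∀ Q : α → Prop, (∀ y, T Q y → Q y) → Q x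

/-- The greatest fixed point (largest co-closed predicate) of a monotone operator on predicates. -/
def gfpP {α : Type*} (T : (α → Prop) → α → Prop) (x : α) : Prop :=
  ∃ Q : α → Prop, (∀ y, Q y → T Q y) ∧ Q x

/-! ### Terms and formulas -/

/-- Terms of the sort of real numbers; variables are de Bruijn indices. -/
inductive Tm : Type
  | var (i : ℕ)
  | const (q : ℚ)
  | add (s t : Tm)
  | neg (t : Tm)
  | mul (s t : Tm)
  | abs (t : Tm)

namespace Tm

def subst (σ : ℕ → Tm) : Tm → Tm
  | var i => σ i
  | const q => const q
  | add s t => add (s.subst σ) (t.subst σ)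
  | neg t => neg (t.subst σ)
  | mul s t => mul (s.subst σ) (t.subst σ)
  | abs t => abs (t.subst σ)

/-- The value of a term in the real numbers. -/
def eval (η : ℕ → ℝ) : Tm → ℝ
  | var i => η i
  | const q => (q : ℝ)
  | add s t => s.eval η + t.eval η
  | neg t => -t.eval η
  | mul s t => s.eval η * t.eval η
  | abs t => |t.eval η|

def sub (s t : Tm) : Tm := add s (neg t)

/-- The term `2 t`. -/
def two (t : Tm) : Tm := mul (const 2) t

/-- The tent function `1 - 2 |t|`. -/
def tent (t : Tm) : Tm := sub (const 1) (two (abs t))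

end Tm

/-- The renaming that shifts all object variables by `k`. -/
def shiftS (k : ℕ) : ℕ → Tm := fun i => .var (i + k)

/-- A substitution pushed under `k` bound object variables. -/
def upS (k : ℕ) (σ : ℕ → Tm) : ℕ → Tm :=
  fun i => if i < k then .var i else (σ (i - k)).subst (shiftS k)

/-- The substitution of `ts` for the first object variables. -/
def instS (ts : List Tm) : ℕ → Tm := pushL ts Tm.var

/-- The list of the variables `0, …, k - 1`. -/
def vars (k : ℕ) : List Tm := (List.range k).map Tm.var

/-- Formulas of concurrent fixed point logic over the sort of real numbers.
Object variables and predicate variables are two separate families of de Bruijn indices.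
`mu k A ts` is `(μ (λ X. λ x₀ … xₖ₋₁. A)) (ts)`: in `A` the predicate variable `0` is `X` and the
object variables `0, …, k - 1` are `x₀, …, xₖ₋₁`. `nu` is the same for the greatest fixed point.
`rst A B` is the restriction `A ‖ B`, `conc A` is the concurrency modality `⇊ A`.
A predicate of arity `k` given by abstraction is represented by its body, in which the object
variables `0, …, k - 1` are the abstracted ones. -/
inductive Fm : Type
  | eq (s t : Tm)
  | le (s t : Tm)
  | lt (s t : Tm)
  | pvar (X : ℕ) (ts : List Tm)
  | and (A B : Fm)
  | or (A B : Fm)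
  | imp (A B : Fm)
  | all (A : Fm)
  | ex (A : Fm)
  | rst (A B : Fm)
  | conc (A : Fm)
  | mu (k : ℕ) (A : Fm) (ts : List Tm)
  | nu (k : ℕ) (A : Fm) (ts : List Tm)

namespace Fm

/-- Substitution for object variables. -/
def subst : Fm → (ℕ → Tm) → Fm
  | eq s t, σ => eq (s.subst σ) (t.subst σ)
  | le s t, σ => le (s.subst σ) (t.subst σ)
  | lt s t, σ => lt (s.subst σ) (t.subst σ)
  | pvar X ts, σ => pvar X (ts.map (Tm.subst σ))
  | and A B, σ => and (A.subst σ) (B.subst σ)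
  | or A B, σ => or (A.subst σ) (B.subst σ)
  | imp A B, σ => imp (A.subst σ) (B.subst σ)
  | all A, σ => all (A.subst (upS 1 σ))
  | ex A, σ => ex (A.subst (upS 1 σ))
  | rst A B, σ => rst (A.subst σ) (B.subst σ)
  | conc A, σ => conc (A.subst σ)
  | mu k A ts, σ => mu k (A.subst (upS k σ)) (ts.map (Tm.subst σ))
  | nu k A ts, σ => nu k (A.subst (upS k σ)) (ts.map (Tm.subst σ))

/-- Shift the object variables by `k`. -/
def shift (k : ℕ) (A : Fm) : Fm := A.subst (shiftS k)

/-- Substitute the terms `ts` for the first object variables. -/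
def inst (A : Fm) (ts : List Tm) : Fm := A.subst (instS ts)

/-- Shift the predicate variables with index at least `c` by one. -/
def pshift : Fm → ℕ → Fm
  | eq s t, _ => eq s t
  | le s t, _ => le s t
  | lt s t, _ => lt s t
  | pvar X ts, c => pvar (if X < c then X else X + 1) ts
  | and A B, c => and (A.pshift c) (B.pshift c)
  | or A B, c => or (A.pshift c) (B.pshift c)
  | imp A B, c => imp (A.pshift c) (B.pshift c)
  | all A, c => all (A.pshift c)
  | ex A, c => ex (A.pshift c)
  | rst A B, c => rst (A.pshift c) (B.pshift c)
  | conc A, c => conc (A.pshift c)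
  | mu k A ts, c => mu k (A.pshift (c + 1)) ts
  | nu k A ts, c => nu k (A.pshift (c + 1)) ts

/-- `A.psubst k j P`: replace in `A` the predicate variable `j` of arity `k` by the abstraction
with body `P`. -/
def psubst (k : ℕ) : Fm → ℕ → Fm → Fm
  | eq s t, _, _ => eq s t
  | le s t, _, _ => le s t
  | lt s t, _, _ => lt s t
  | pvar X ts, j, P => if X = j then P.inst ts else pvar (if X < j then X else X - 1) ts
  | and A B, j, P => and (psubst k A j P) (psubst k B j P)
  | or A B, j, P => or (psubst k A j P) (psubst k B j P)
  | imp A B, j, P => imp (psubst k A j P) (psubst k B j P)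
  | all A, j, P => all (psubst k A j (P.subst (upS k (shiftS 1))))
  | ex A, j, P => ex (psubst k A j (P.subst (upS k (shiftS 1))))
  | rst A B, j, P => rst (psubst k A j P) (psubst k B j P)
  | conc A, j, P => conc (psubst k A j P)
  | mu l A ts, j, P => mu l (psubst k A (j + 1) ((P.subst (upS k (shiftS l))).pshift 0)) ts
  | nu l A ts, j, P => nu l (psubst k A (j + 1) ((P.subst (upS k (shiftS l))).pshift 0)) ts

/-- Does the predicate variable `j` occur in the formula? -/
def occurs : Fm → ℕ → Bool
  | eq _ _, _ => false
  | le _ _, _ => false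
  | lt _ _, _ => false
  | pvar X _, j => X == j
  | and A B, j => A.occurs j || B.occurs j
  | or A B, j => A.occurs j || B.occurs j
  | imp A B, j => A.occurs j || B.occurs j
  | all A, j => A.occurs j
  | ex A, j => A.occurs j
  | rst A B, j => A.occurs j || B.occurs j
  | conc A, j => A.occurs j
  | mu _ A _, j => A.occurs (j + 1)
  | nu _ A _, j => A.occurs (j + 1)

/-- All occurrences of the predicate variable `j` are strictly positive. -/
def sp : Fm → ℕ → Bool
  | eq _ _, _ => true
  | le _ _, _ => true
  | lt _ _, _ => true
  | pvar _ _, _ => true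
  | and A B, j => A.sp j && B.sp j
  | or A B, j => A.sp j && B.sp j
  | imp A B, j => !A.occurs j && B.sp j
  | all A, j => A.sp j
  | ex A, j => A.sp j
  | rst A B, j => A.sp j && !B.occurs j
  | conc A, j => A.sp j
  | mu _ A _, j => A.sp (j + 1)
  | nu _ A _, j => A.sp (j + 1)

/-- The Harrop property: no disjunction, restriction, concurrency modality and no free predicate
variable at a strictly positive position. The predicate variables `X` with `κ X = true` are
regarded as (non-computational) predicate constants; `harrop A (push true κ)` thus says that the
abstraction with body `A` is `X`-Harrop for the predicate variable `X` with index `0`. -/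
def harrop : Fm → (ℕ → Bool) → Bool
  | eq _ _, _ => true
  | le _ _, _ => true
  | lt _ _, _ => true
  | pvar X _, κ => κ X
  | and A B, κ => A.harrop κ && B.harrop κ
  | or _ _, _ => false
  | imp _ B, κ => B.harrop κ
  | all A, κ => A.harrop κ
  | ex A, κ => A.harrop κ
  | rst _ _, _ => false
  | conc _, _ => false
  | mu _ A _, κ => A.harrop (push true κ)
  | nu _ A _, κ => A.harrop (push true κ)

/-- Harrop formulas, no predicate variable being regarded as a constant. -/
def isHarrop (A : Fm) : Bool := A.harrop fun _ => false

/-- No disjunction, restriction or concurrency modality at all. -/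
def nc : Fm → Bool
  | eq _ _ => true
  | le _ _ => true
  | lt _ _ => true
  | pvar _ _ => true
  | and A B => A.nc && B.nc
  | or _ _ => false
  | imp A B => A.nc && B.nc
  | all A => A.nc
  | ex A => A.nc
  | rst _ _ => false
  | conc _ => false
  | mu _ A _ => A.nc
  | nu _ A _ => A.nc

/-- Productivity: every implication and every restriction is part of a Harrop formula or of a
disjunction. -/
def productive : Fm → Bool
  | eq _ _ => true
  | le _ _ => true
  | lt _ _ => true
  | pvar _ _ => true
  | and A B => A.productive && B.productive
  | or _ _ => true
  | imp _ B => B.isHarrop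
  | all A => A.productive
  | ex A => A.productive
  | rst _ _ => false
  | conc A => A.productive
  | mu k A ts => (mu k A ts).isHarrop || A.productive
  | nu k A ts => (nu k A ts).isHarrop || A.productive

/-- Well-formedness in a context of predicate variables with given arities: arities are
respected, fixed points are taken of strictly positive operators only, and restriction and
concurrency are applied to productive formulas only. -/
def wf : Fm → List ℕ → Bool
  | eq _ _, _ => true
  | le _ _, _ => true
  | lt _ _, _ => true
  | pvar X ts, Γ => Γ[X]? == some ts.length
  | and A B, Γ => A.wf Γ && B.wf Γ
  | or A B, Γ => A.wf Γ && B.wf Γ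
  | imp A B, Γ => A.wf Γ && B.wf Γ
  | all A, Γ => A.wf Γ
  | ex A, Γ => A.wf Γ
  | rst A B, Γ => A.wf Γ && B.wf Γ && A.productive
  | conc A, Γ => A.wf Γ && A.productive
  | mu k A ts, Γ => ts.length == k && A.wf (k :: Γ) && A.sp 0
  | nu k A ts, Γ => ts.length == k && A.wf (k :: Γ) && A.sp 0

/-- Truth in the real numbers (classically, `A ‖ B` means `B → A`, and `⇊ A` means `A`). -/
def holds : Fm → (ℕ → List ℝ → Prop) → (ℕ → ℝ) → Prop
  | eq s t, _, η => s.eval η = t.eval η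
  | le s t, _, η => s.eval η ≤ t.eval η
  | lt s t, _, η => s.eval η < t.eval η
  | pvar X ts, ρ, η => ρ X (ts.map (Tm.eval η))
  | and A B, ρ, η => A.holds ρ η ∧ B.holds ρ η
  | or A B, ρ, η => A.holds ρ η ∨ B.holds ρ η
  | imp A B, ρ, η => A.holds ρ η → B.holds ρ η
  | all A, ρ, η => ∀ x : ℝ, A.holds ρ (push x η)
  | ex A, ρ, η => ∃ x : ℝ, A.holds ρ (push x η)
  | rst A B, ρ, η => B.holds ρ η → A.holds ρ η
  | conc A, ρ, η => A.holds ρ η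
  | mu _ A ts, ρ, η =>
      lfpP (fun Q xs => A.holds (push Q ρ) (pushL xs η)) (ts.map (Tm.eval η))
  | nu _ A ts, ρ, η =>
      gfpP (fun Q xs => A.holds (push Q ρ) (pushL xs η)) (ts.map (Tm.eval η))

/-- Falsity is the least fixed point of the identity operator of arity zero. -/
def bot : Fm := mu 0 (pvar 0 []) []

def neg (A : Fm) : Fm := imp A bot

/-- `k` universal quantifiers. -/
def alls : ℕ → Fm → Fm
  | 0, A => A
  | k + 1, A => all (alls k A)

/-- Inclusion of the `k`-ary abstractions with bodies `P` and `Q`. -/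
def incl (k : ℕ) (P Q : Fm) : Fm := alls k (imp P Q)

/-- The least fixed point of the operator with body `A`, as a `k`-ary abstraction. -/
def muP (k : ℕ) (A : Fm) : Fm := mu k (A.subst (upS k (shiftS k))) (vars k)

/-- The greatest fixed point of the operator with body `A`, as a `k`-ary abstraction. -/
def nuP (k : ℕ) (A : Fm) : Fm := nu k (A.subst (upS k (shiftS k))) (vars k)

/-- The operator with body `A`, applied to the `k`-ary abstraction with body `P`. -/
def opApp (k : ℕ) (A P : Fm) : Fm := psubst k A 0 (P.subst (upS k (shiftS k)))

/-- The iterated concurrency modality, the least `Z` with `Z = ⇊ (A ∨ Z)`. -/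
def concStar (A : Fm) : Fm := mu 0 (conc (or (A.pshift 0) (pvar 0 []))) []

/-- For a unary abstraction with body `P` and argument variable `x`: the formula `P(2x)`. -/
def atTwice (P : Fm) : Fm := P.subst (push (Tm.two (.var 0)) fun i => .var (i + 1))

/-- `(∀ x ∈ B \ {0}) C(x)` for unary abstractions with bodies `B` and `C`. -/
def allNonzero (B C : Fm) : Fm := all (imp (and B (neg (eq (.var 0) (.const 0)))) C)

end Fm

/-! ### The calculus -/

/-- Sequents: finitely many assumptions and a conclusion. -/
structure Sequent : Type where
  hyps : List Fm
  concl : Fm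

/-- All formulas of the sequent are well formed and without free predicate variables. -/
def Sequent.WF (s : Sequent) : Prop :=
  (∀ A ∈ s.hyps, A.wf [] = true) ∧ s.concl.wf [] = true

/-- The instances of the inference rules: a list of premises and a conclusion. -/
inductive Rule : List Sequent → Sequent → Prop
  -- axioms: the non-computational formulas that are true in the real numbers
  | ax {Γ} {A : Fm} : A.nc = true → (∀ ρ η, A.holds ρ η) → Rule [] ⟨Γ, A⟩
  -- intuitionistic first-order logic with equality
  | hyp {Γ} {A : Fm} : A ∈ Γ → Rule [] ⟨Γ, A⟩
  | andI {Γ} {A B : Fm} : Rule [⟨Γ, A⟩, ⟨Γ, B⟩] ⟨Γ, .and A B⟩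
  | andE₁ {Γ} {A B : Fm} : Rule [⟨Γ, .and A B⟩] ⟨Γ, A⟩
  | andE₂ {Γ} {A B : Fm} : Rule [⟨Γ, .and A B⟩] ⟨Γ, B⟩
  | orI₁ {Γ} {A B : Fm} : Rule [⟨Γ, A⟩] ⟨Γ, .or A B⟩
  | orI₂ {Γ} {A B : Fm} : Rule [⟨Γ, B⟩] ⟨Γ, .or A B⟩
  | orE {Γ} {A B C : Fm} : Rule [⟨Γ, .or A B⟩, ⟨A :: Γ, C⟩, ⟨B :: Γ, C⟩] ⟨Γ, C⟩
  | impI {Γ} {A B : Fm} : Rule [⟨A :: Γ, B⟩] ⟨Γ, .imp A B⟩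
  | impE {Γ} {A B : Fm} : Rule [⟨Γ, .imp A B⟩, ⟨Γ, A⟩] ⟨Γ, B⟩
  | allI {Γ} {A : Fm} : Rule [⟨Γ.map (Fm.shift 1), A⟩] ⟨Γ, .all A⟩
  | allE {Γ} {A : Fm} (t : Tm) : Rule [⟨Γ, .all A⟩] ⟨Γ, A.inst [t]⟩
  | exI {Γ} {A : Fm} (t : Tm) : Rule [⟨Γ, A.inst [t]⟩] ⟨Γ, .ex A⟩
  | exE {Γ} {A C : Fm} : Rule [⟨Γ, .ex A⟩, ⟨A :: Γ.map (Fm.shift 1), C.shift 1⟩] ⟨Γ, C⟩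
  | eqRefl {Γ} (t : Tm) : Rule [] ⟨Γ, .eq t t⟩
  | eqSubst {Γ} {A : Fm} (s t : Tm) : Rule [⟨Γ, .eq s t⟩, ⟨Γ, A.inst [s]⟩] ⟨Γ, A.inst [t]⟩
  -- closure, induction, co-closure and co-induction
  | closure {Γ} (k : ℕ) (A : Fm) : Rule [] ⟨Γ, .incl k (.opApp k A (.muP k A)) (.muP k A)⟩
  | induction {Γ} (k : ℕ) (A P : Fm) :
      Rule [⟨Γ, .incl k (.opApp k A P) P⟩] ⟨Γ, .incl k (.muP k A) P⟩
  | coclosure {Γ} (k : ℕ) (A : Fm) : Rule [] ⟨Γ, .incl k (.nuP k A) (.opApp k A (.nuP k A))⟩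
  | coinduction {Γ} (k : ℕ) (A P : Fm) :
      Rule [⟨Γ, .incl k P (.opApp k A P)⟩] ⟨Γ, .incl k P (.nuP k A)⟩
  -- restriction
  | rstIntro {Γ} {A₀ A₁ B : Fm} : A₀.isHarrop = true → A₁.isHarrop = true → B.isHarrop = true →
      Rule [⟨Γ, .imp B (.or A₀ A₁)⟩, ⟨Γ, .imp (.neg B) (.and A₀ A₁)⟩] ⟨Γ, .rst (.or A₀ A₁) B⟩
  | rstReturn {Γ} {A B : Fm} : Rule [⟨Γ, A⟩] ⟨Γ, .rst A B⟩
  | rstBind {Γ} {A A' B : Fm} : Rule [⟨Γ, .rst A B⟩, ⟨Γ, .imp A (.rst A' B)⟩] ⟨Γ, .rst A' B⟩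
  | rstAntimon {Γ} {A B B' : Fm} : Rule [⟨Γ, .rst A B⟩, ⟨Γ, .imp B' B⟩] ⟨Γ, .rst A B'⟩
  | rstMp {Γ} {A B : Fm} : Rule [⟨Γ, .rst A B⟩, ⟨Γ, B⟩] ⟨Γ, A⟩
  | rstEfq {Γ} {A : Fm} : Rule [] ⟨Γ, .rst A .bot⟩
  | rstStab {Γ} {A B : Fm} : Rule [⟨Γ, .rst A B⟩] ⟨Γ, .rst A (.neg (.neg B))⟩
  | rstAbsorb {Γ} {A B C : Fm} : Rule [⟨Γ, .rst (.rst A B) C⟩] ⟨Γ, .rst A (.and B C)⟩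
  | rstAnd {Γ} {A B C : Fm} : Rule [⟨Γ, .rst A B⟩, ⟨Γ, .rst C B⟩] ⟨Γ, .rst (.and A C) B⟩
  -- the concurrency modality
  | concLem {Γ} {A C : Fm} : Rule [⟨Γ, .rst A C⟩, ⟨Γ, .rst A (.neg C)⟩] ⟨Γ, .conc A⟩
  | concReturn {Γ} {A : Fm} : Rule [⟨Γ, A⟩] ⟨Γ, .conc A⟩
  | concMon {Γ} {A B : Fm} : Rule [⟨Γ, .conc A⟩, ⟨Γ, .imp A B⟩] ⟨Γ, .conc B⟩
  | concHarrop {Γ} {A : Fm} : A.isHarrop = true → Rule [⟨Γ, .conc A⟩] ⟨Γ, A⟩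
  | concRstAbsorb {Γ} {A B : Fm} : Rule [⟨Γ, .conc (.rst A B)⟩] ⟨Γ, .conc A⟩
  | concRstOr {Γ} {A B C D : Fm} :
      Rule [⟨Γ, .rst A B⟩, ⟨Γ, .rst C D⟩] ⟨Γ, .rst (.conc (.or A C)) (.or B D)⟩
  | concRstIntro {Γ} {A₀ A₁ B : Fm} : A₀.isHarrop = true → A₁.isHarrop = true → B.isHarrop = true →
      Rule [⟨Γ, .imp B (.conc (.or A₀ A₁))⟩, ⟨Γ, .imp (.neg B) (.and A₀ A₁)⟩]
        ⟨Γ, .rst (.conc (.or A₀ A₁)) B⟩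
  -- the iterated concurrency modality
  | concStarRstIntro {Γ} {A₀ A₁ B : Fm} :
      A₀.isHarrop = true → A₁.isHarrop = true → B.isHarrop = true →
      Rule [⟨Γ, .imp B (.concStar (.or A₀ A₁))⟩, ⟨Γ, .imp (.neg B) (.and A₀ A₁)⟩]
        ⟨Γ, .rst (.concStar (.or A₀ A₁)) B⟩
  | concStarAnd {Γ} {A B : Fm} : Rule [⟨Γ, .concStar A⟩, ⟨Γ, .concStar B⟩] ⟨Γ, .concStar (.and A B)⟩
  -- iterated concurrent Archimedean induction
  | concStarArch {Γ} {B P : Fm} : B.isHarrop = false → P.isHarrop = false →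
      Rule [⟨Γ, .allNonzero B (.concStar (.or P
          (.and (.le (.abs (.var 0)) (.const (1 / 2)))
            (.and B.atTwice (.imp P.atTwice P)))))⟩]
        ⟨Γ, .allNonzero B (.concStar P)⟩

/-- Derivability: every sequent in a derivation has to be well formed. -/
inductive Derivable : Sequent → Prop
  | infer {ps : List Sequent} {s : Sequent} :
      Rule ps s → s.WF → (∀ p ∈ ps, Derivable p) → Derivable s

/-- The formula is provable without assumptions. -/
def Provable (A : Fm) : Prop := Derivable ⟨[], A⟩

/-! ### The domain of realisers -/

/-- One unfolding of the domain equation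
`D = (Nil + Left(D) + Right(D) + Pair(D × D) + Amb(D × D) + Fun(D → D))_⊥`
(on the finite approximations used below, monotone maps and continuous maps are the same). -/
inductive Shape (X : Type) [PartialOrder X] : Type
  | bot
  | nil
  | left (x : X)
  | right (x : X)
  | pair (x y : X)
  | amb (x y : X)
  | fn (f : X →o X)

namespace Shape

variable {X Y : Type} [PartialOrder X] [PartialOrder Y]

/-- The order of the lifted disjoint sum. -/
def le : Shape X → Shape X → Prop
  | bot, _ => True
  | nil, nil => True
  | left x, left y => x ≤ y
  | right x, right y => x ≤ y
  | pair x x', pair y y' => x ≤ y ∧ x' ≤ y'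
  | amb x x', amb y y' => x ≤ y ∧ x' ≤ y'
  | fn f, fn g => f ≤ g
  | _, _ => False

instance : PartialOrder (Shape X) where
  le := le
  le_refl a := by cases a <;> simp [le]
  le_trans a b c hab hbc := by
    cases a <;> cases b <;> simp only [le] at hab <;> cases c <;> simp only [le] at hbc ⊢
    · exact hab.trans hbc
    · exact hab.trans hbc
    · exact ⟨hab.1.trans hbc.1, hab.2.trans hbc.2⟩
    · exact ⟨hab.1.trans hbc.1, hab.2.trans hbc.2⟩
    · exact hab.trans hbc
  le_antisymm a b hab hba := by
    cases a <;> cases b <;> simp only [le] at hab hba <;> try rfl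
    · rw [le_antisymm hab hba]
    · rw [le_antisymm hab hba]
    · rw [le_antisymm hab.1 hba.1, le_antisymm hab.2 hba.2]
    · rw [le_antisymm hab.1 hba.1, le_antisymm hab.2 hba.2]
    · rw [le_antisymm hab hba]

/-- The action of the functor on a pair of maps in opposite directions. -/
def map (e : X →o Y) (p : Y →o X) : Shape X →o Shape Y where
  toFun
    | bot => bot
    | nil => nil
    | left x => left (e x)
    | right x => right (e x)
    | pair x y => pair (e x) (e y)
    | amb x y => amb (e x) (e y)
    | fn f => fn ((e.comp f).comp p)
  monotone' a b hab := by
    change le a b at hab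
    change le _ _
    cases a <;> cases b <;> simp only [le] at hab ⊢
    · exact e.monotone hab
    · exact e.monotone hab
    · exact ⟨e.monotone hab.1, e.monotone hab.2⟩
    · exact ⟨e.monotone hab.1, e.monotone hab.2⟩
    · exact fun y => e.monotone (hab (p y))

end Shape

/-- The finite approximations of the domain: the iterates of the functor on a one-point order. -/
def Lvl : ℕ → PartOrd.{0}
  | 0 => PartOrd.of PUnit
  | n + 1 => PartOrd.of (Shape (Lvl n))

/-- The least element of each approximation. -/
def Lvl.bot : (n : ℕ) → Lvl n
  | 0 => PUnit.unit
  | _ + 1 => Shape.bot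

/-- The canonical maps between the approximations: embeddings for `n ≤ m` and projections
for `m ≤ n`. -/
def Lvl.trans : (n m : ℕ) → (Lvl n →o Lvl m)
  | 0, m => ⟨fun _ => Lvl.bot m, fun _ _ _ => le_rfl⟩
  | n + 1, 0 => ⟨fun _ => Lvl.bot 0, fun _ _ _ => le_rfl⟩
  | n + 1, m + 1 => Shape.map (Lvl.trans n m) (Lvl.trans m n)
termination_by n m => n + m
decreasing_by all_goals omega

theorem Lvl.trans_trans : ∀ (n k m : ℕ), n ≤ k ∨ m ≤ k → ∀ a : Lvl n,
    Lvl.trans k m (Lvl.trans n k a) = Lvl.trans n m a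
  | 0, k, m, _, a => by
    have h : ∀ k m, Lvl.trans k m (Lvl.bot k) = Lvl.bot m := by
      intro k m
      cases k <;> cases m <;> simp only [Lvl.trans] <;> rfl
    cases k <;> cases m <;> simp only [Lvl.trans] <;> rfl
  | _ + 1, k, 0, _, _ => by cases k <;> simp only [Lvl.trans] <;> rfl
  | n + 1, 0, m + 1, h, _ => by omega
  | n + 1, k + 1, m + 1, h, a => by
    have h' : n ≤ k ∨ m ≤ k := by omega
    have ih := Lvl.trans_trans n k m h'
    have ih' := Lvl.trans_trans m k n h'.symm
    simp only [Lvl.trans]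
    cases a
    · rfl
    · rfl
    · exact congrArg Shape.left (ih _)
    · exact congrArg Shape.right (ih _)
    · exact congrArg₂ Shape.pair (ih _) (ih _)
    · exact congrArg₂ Shape.amb (ih _) (ih _)
    · rename_i f
      refine congrArg Shape.fn (OrderHom.ext _ _ (funext fun y => ?_))
      exact (ih _).trans (congrArg (fun z => Lvl.trans n m (f z)) (ih' y))
termination_by n k m => n + m

/-- The domain: the inverse limit of the finite approximations, which is the (canonical) solution
of the domain equation. -/
@[ext]
structure Dom : Type where
  val : ∀ n, Lvl n
  compat : ∀ n, Lvl.trans (n + 1) n (val (n + 1)) = val n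

namespace Dom

/-- The componentwise order. -/
instance : PartialOrder Dom where
  le x y := ∀ n, x.val n ≤ y.val n
  le_refl _ _ := le_rfl
  le_trans _ _ _ h h' n := (h n).trans (h' n)
  le_antisymm _ _ h h' := Dom.ext (funext fun n => (h n).antisymm (h' n))

/-- The canonical embedding of an approximation into the domain. -/
def emb (n : ℕ) (a : Lvl n) : Dom :=
  ⟨fun m => Lvl.trans n m a, fun m => Lvl.trans_trans n (m + 1) m (by omega) a⟩

/-- Build an element of the domain from its components at the successor levels. -/
def ofShapes (s : ∀ n, Shape (Lvl n))
    (h : ∀ n, Shape.map (Lvl.trans (n + 1) n) (Lvl.trans n (n + 1)) (s (n + 1)) = s n) : Dom :=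
  ⟨fun | 0 => PUnit.unit | n + 1 => s n, fun
    | 0 => rfl
    | n + 1 => by simp only [Lvl.trans]; exact h n⟩

def bot : Dom := ofShapes (fun _ => .bot) fun _ => rfl

instance : Nonempty Dom := ⟨bot⟩

def nil : Dom := ofShapes (fun _ => .nil) fun _ => rfl

def left (a : Dom) : Dom :=
  ofShapes (fun n => .left (a.val n)) fun n => congrArg Shape.left (a.compat n)

def right (a : Dom) : Dom :=
  ofShapes (fun n => .right (a.val n)) fun n => congrArg Shape.right (a.compat n)

def pair (a b : Dom) : Dom :=
  ofShapes (fun n => .pair (a.val n) (b.val n)) fun n => congrArg₂ Shape.pair (a.compat n) (b.compat n)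

def amb (a b : Dom) : Dom :=
  ofShapes (fun n => .amb (a.val n) (b.val n)) fun n => congrArg₂ Shape.amb (a.compat n) (b.compat n)

theorem emb_mono (n : ℕ) : Monotone (emb n) := fun _ _ h m => (Lvl.trans n m).monotone h

theorem emb_trans (n : ℕ) (a : Lvl n) : emb (n + 1) (Lvl.trans n (n + 1) a) = emb n a :=
  Dom.ext (funext fun m => Lvl.trans_trans n (n + 1) m (by omega) a)

open Classical in
/-- The element `Fun(f)` for a continuous map `f` (and `⊥` for other maps). -/
def fn (f : Dom → Dom) : Dom :=
  if hf : ScottContinuous f then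
    ofShapes (fun n => .fn ⟨fun a => (f (emb n a)).val n, fun _ _ h => hf.monotone (emb_mono n h) n⟩)
      fun n => congrArg Shape.fn <| OrderHom.ext _ _ <| funext fun a => by
        change Lvl.trans (n + 1) n ((f (emb (n + 1) (Lvl.trans n (n + 1) a))).val (n + 1)) = _
        rw [emb_trans]
        exact (f (emb n a)).compat n
  else bot

open Classical in
/-- Application: `app a b = f b` if `a = Fun(f)` with `f` continuous, and `⊥` otherwise. -/
def app (a b : Dom) : Dom :=
  if h : ∃ f : Dom → Dom, ScottContinuous f ∧ a = fn f then h.choose b else bot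

/-- The least fixed point `⨆ₙ fⁿ(⊥)` of a continuous map. -/
def fix (f : Dom → Dom) : Dom :=
  Classical.epsilon fun x => IsLUB (Set.range fun n : ℕ => f^[n] bot) x

end Dom

/-! ### Programs -/

/-- Constructor patterns. The variables of a pattern are numbered from left to right. -/
inductive CPat : Type
  | var
  | nil
  | left (P : CPat)
  | right (P : CPat)
  | pair (P Q : CPat)
  | amb (P Q : CPat)

/-- Patterns: constructor patterns and the function pattern `fun(a)`. -/
inductive Pat : Type
  | con (P : CPat)
  | fn

/-- The number of variables of a constructor pattern. -/
def CPat.arity : CPat → ℕ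
  | var => 1
  | nil => 0
  | left P => P.arity
  | right P => P.arity
  | pair P Q => P.arity + Q.arity
  | amb P Q => P.arity + Q.arity

/-- The number of variables of a pattern. -/
def Pat.arity : Pat → ℕ
  | con P => P.arity
  | fn => 1

mutual
/-- Programs, with de Bruijn indices. -/
inductive Prog : Type
  | var (i : ℕ)
  | nil
  | left (M : Prog)
  | right (M : Prog)
  | pair (M N : Prog)
  | amb (M N : Prog)
  | case (M : Prog) (C : Clauses)
  | lam (M : Prog)
  | app (M N : Prog)
  | recur (M : Prog)
  | bot
/-- Lists of clauses `P → N`. In `N` the variables of `P` are the indices below `P.arity`. -/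
inductive Clauses : Type
  | nil
  | cons (P : Pat) (N : Prog) (C : Clauses)
end

/-- A renaming pushed under `k` binders. -/
def upR (k : ℕ) (r : ℕ → ℕ) : ℕ → ℕ := fun i => if i < k then i else r (i - k) + k

mutual
def Prog.rename : Prog → (ℕ → ℕ) → Prog
  | .var i, r => .var (r i)
  | .nil, _ => .nil
  | .left M, r => .left (M.rename r)
  | .right M, r => .right (M.rename r)
  | .pair M N, r => .pair (M.rename r) (N.rename r)
  | .amb M N, r => .amb (M.rename r) (N.rename r)
  | .case M C, r => .case (M.rename r) (C.rename r)
  | .lam M, r => .lam (M.rename (upR 1 r))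
  | .app M N, r => .app (M.rename r) (N.rename r)
  | .recur M, r => .recur (M.rename r)
  | .bot, _ => .bot
def Clauses.rename : Clauses → (ℕ → ℕ) → Clauses
  | .nil, _ => .nil
  | .cons P N C, r => .cons P (N.rename (upR P.arity r)) (C.rename r)
end

/-- A substitution pushed under `k` binders. -/
def upP (k : ℕ) (σ : ℕ → Prog) : ℕ → Prog :=
  fun i => if i < k then .var i else (σ (i - k)).rename fun j => j + k

mutual
def Prog.subst : Prog → (ℕ → Prog) → Prog
  | .var i, σ => σ i
  | .nil, _ => .nil
  | .left M, σ => .left (M.subst σ)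
  | .right M, σ => .right (M.subst σ)
  | .pair M N, σ => .pair (M.subst σ) (N.subst σ)
  | .amb M N, σ => .amb (M.subst σ) (N.subst σ)
  | .case M C, σ => .case (M.subst σ) (C.subst σ)
  | .lam M, σ => .lam (M.subst (upP 1 σ))
  | .app M N, σ => .app (M.subst σ) (N.subst σ)
  | .recur M, σ => .recur (M.subst σ)
  | .bot, _ => .bot
def Clauses.subst : Clauses → (ℕ → Prog) → Clauses
  | .nil, _ => .nil
  | .cons P N C, σ => .cons P (N.subst (upP P.arity σ)) (C.subst σ)
end

/-- `P.Inst θ M`: the program `M` arises from the pattern `P` by replacing its variables by the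
programs `θ`. -/
inductive CPat.Inst : CPat → List Prog → Prog → Prop
  | var (M) : Inst .var [M] M
  | nil : Inst .nil [] .nil
  | left {P θ M} : Inst P θ M → Inst (.left P) θ (.left M)
  | right {P θ M} : Inst P θ M → Inst (.right P) θ (.right M)
  | pair {P Q θ θ' M N} : Inst P θ M → Inst Q θ' N → Inst (.pair P Q) (θ ++ θ') (.pair M N)
  | amb {P Q θ θ' M N} : Inst P θ M → Inst Q θ' N → Inst (.amb P Q) (θ ++ θ') (.amb M N)

/-- `P.Inst θ M`: the program `M` matches the pattern `P` with matching substitution `θ`. -/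
inductive Pat.Inst : Pat → List Prog → Prog → Prop
  | con {P θ M} : P.Inst θ M → Inst (.con P) θ M
  | fn (M) : Inst .fn [.lam M] (.lam M)

/-- Compatibility of the clauses `P → N` and `P' → N'`. -/
def Compatible (P : Pat) (N : Prog) (P' : Pat) (N' : Prog) : Prop :=
  ∀ θ θ' M, P.Inst θ M → P'.Inst θ' M →
    N.subst (pushL θ Prog.var) = N'.subst (pushL θ' Prog.var)

/-- The clause `P → N` is compatible with all clauses of a list. -/
def Clauses.CompatibleWith (P : Pat) (N : Prog) : Clauses → Prop
  | .nil => True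
  | .cons P' N' C => Compatible P N P' N' ∧ C.CompatibleWith P N

mutual
/-- Well-formed programs with free variables below `n`: the clauses of every case construct are
pairwise compatible. -/
def Prog.WF : Prog → ℕ → Prop
  | .var i, n => i < n
  | .nil, _ => True
  | .left M, n => M.WF n
  | .right M, n => M.WF n
  | .pair M N, n => M.WF n ∧ N.WF n
  | .amb M N, n => M.WF n ∧ N.WF n
  | .case M C, n => M.WF n ∧ C.WF n
  | .lam M, n => M.WF (n + 1)
  | .app M N, n => M.WF n ∧ N.WF n
  | .recur M, n => M.WF n
  | .bot, _ => True
def Clauses.WF : Clauses → ℕ → Prop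
  | .nil, _ => True
  | .cons P N C, n => N.WF (n + P.arity) ∧ C.CompatibleWith P N ∧ C.WF n
end

/-- Matching of a constructor pattern with a domain element; the list is the matching
environment. -/
inductive CPat.Matches : CPat → List Dom → Dom → Prop
  | var (d) : Matches .var [d] d
  | nil : Matches .nil [] Dom.nil
  | left {P e d} : Matches P e d → Matches (.left P) e d.left
  | right {P e d} : Matches P e d → Matches (.right P) e d.right
  | pair {P Q e e' d d'} : Matches P e d → Matches Q e' d' →
      Matches (.pair P Q) (e ++ e') (d.pair d')
  | amb {P Q e e' d d'} : Matches P e d → Matches Q e' d' →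
      Matches (.amb P Q) (e ++ e') (d.amb d')

/-- Matching of a pattern with a domain element. -/
inductive Pat.Matches : Pat → List Dom → Dom → Prop
  | con {P e d} : P.Matches e d → Matches (.con P) e d
  | fn {f} : ScottContinuous f → Matches .fn [Dom.fn f] (Dom.fn f)

open Classical in
mutual
/-- The denotation of a program in an environment. -/
def Prog.den : Prog → (ℕ → Dom) → Dom
  | .var i, η => η i
  | .nil, _ => Dom.nil
  | .left M, η => (M.den η).left
  | .right M, η => (M.den η).right
  | .pair M N, η => (M.den η).pair (N.den η)
  | .amb M N, η => (M.den η).amb (N.den η)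
  | .case M C, η => C.den η (M.den η)
  | .lam M, η => Dom.fn fun d => M.den (push d η)
  | .app M N, η => (M.den η).app (N.den η)
  | .recur M, η => Dom.fix (M.den η).app
  | .bot, _ => Dom.bot
/-- The denotation of a list of clauses for a given value of the scrutinee. For pairwise
compatible clauses it does not matter which of the matching clauses is taken. -/
def Clauses.den : Clauses → (ℕ → Dom) → Dom → Dom
  | .nil, _, _ => Dom.bot
  | .cons P N C, η, d =>
      if h : ∃ e, P.Matches e d then N.den (pushL h.choose η) else C.den η d
end

/-! ### Types -/

/-- Subdomains: subsets that are closed downwards and under all existing suprema (in particular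
they contain `⊥`, the supremum of the empty set). -/
def IsSubdomain (S : Set Dom) : Prop :=
  IsLowerSet S ∧ ∀ T ⊆ S, ∀ x, IsLUB T x → x ∈ S

/-- The type `1`. -/
def oneT : Set Dom := {Dom.bot, Dom.nil}

def prodT (S T : Set Dom) : Set Dom := {c | c = Dom.bot ∨ ∃ a ∈ S, ∃ b ∈ T, c = a.pair b}

def sumT (S T : Set Dom) : Set Dom :=
  {c | c = Dom.bot ∨ (∃ a ∈ S, c = a.left) ∨ ∃ b ∈ T, c = b.right}

def funT (S T : Set Dom) : Set Dom :=
  {c | c = Dom.bot ∨ ∃ f, ScottContinuous f ∧ (∀ a ∈ S, f a ∈ T) ∧ c = Dom.fn f}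

/-- The type of concurrent computations of elements of `S`. -/
def ambT (S : Set Dom) : Set Dom := {c | c = Dom.bot ∨ ∃ a ∈ S, ∃ b ∈ S, c = a.amb b}

/-- The type `fix α. φ(α)`. -/
def fixT (φ : Set Dom → Set Dom) : Set Dom := ⋂₀ {S | IsSubdomain S ∧ φ S ⊆ S}

namespace Fm

/-- The type of a formula, as a subset of the domain; `ζ` assigns types to the predicate
variables. -/
def typ : Fm → (ℕ → Bool) → (ℕ → Set Dom) → Set Dom
  | eq _ _, _, _ => oneT
  | le _ _, _, _ => oneT
  | lt _ _, _, _ => oneT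
  | pvar X _, κ, ζ => if κ X then oneT else ζ X
  | and A B, κ, ζ =>
      if B.harrop κ then A.typ κ ζ
      else if A.harrop κ then B.typ κ ζ
      else prodT (A.typ κ ζ) (B.typ κ ζ)
  | or A B, κ, ζ => sumT (A.typ κ ζ) (B.typ κ ζ)
  | imp A B, κ, ζ =>
      if B.harrop κ then oneT
      else if A.harrop κ then B.typ κ ζ
      else funT (A.typ κ ζ) (B.typ κ ζ)
  | all A, κ, ζ => A.typ κ ζ
  | ex A, κ, ζ => A.typ κ ζ
  | rst A _, κ, ζ => A.typ κ ζ
  | conc A, κ, ζ => ambT (A.typ κ ζ)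
  | mu _ A _, κ, ζ =>
      if A.harrop (push true κ) then oneT
      else fixT fun S => A.typ (push false κ) (push S ζ)
  | nu _ A _, κ, ζ =>
      if A.harrop (push true κ) then oneT
      else fixT fun S => A.typ (push false κ) (push S ζ)

/-- Realisability: `A.real κ ζ ρ η a` says that `a` realises `A`. Here `η` assigns values to the
object variables, `ζ` assigns types and `ρ` assigns the sets of realisers of the instances to the
predicate variables. For a Harrop formula `A`, the formula `H(A)` is `A.real κ ζ ρ η Dom.nil`;
accordingly, a predicate variable that is regarded as a constant is assigned a relation that holds
for the realiser `Nil` only. -/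
def real : Fm → (ℕ → Bool) → (ℕ → Set Dom) → (ℕ → List ℝ → Dom → Prop) → (ℕ → ℝ) → Dom → Prop
  | eq s t, _, _, _, η, a => a = Dom.nil ∧ s.eval η = t.eval η
  | le s t, _, _, _, η, a => a = Dom.nil ∧ s.eval η ≤ t.eval η
  | lt s t, _, _, _, η, a => a = Dom.nil ∧ s.eval η < t.eval η
  | pvar X ts, _, _, ρ, η, a => ρ X (ts.map (Tm.eval η)) a
  | and A B, κ, ζ, ρ, η, c =>
      if B.harrop κ then A.real κ ζ ρ η c ∧ B.real κ ζ ρ η Dom.nil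
      else if A.harrop κ then A.real κ ζ ρ η Dom.nil ∧ B.real κ ζ ρ η c
      else ∃ a b, c = Dom.pair a b ∧ A.real κ ζ ρ η a ∧ B.real κ ζ ρ η b
  | or A B, κ, ζ, ρ, η, c =>
      (∃ a, c = Dom.left a ∧ A.real κ ζ ρ η a) ∨ ∃ b, c = Dom.right b ∧ B.real κ ζ ρ η b
  | imp A B, κ, ζ, ρ, η, c =>
      if B.harrop κ then
        c = Dom.nil ∧ ((∃ a, A.real κ ζ ρ η a) → B.real κ ζ ρ η Dom.nil)
      else if A.harrop κ then
        c ∈ B.typ κ ζ ∧ (A.real κ ζ ρ η Dom.nil → B.real κ ζ ρ η c)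
      else
        c ∈ funT (A.typ κ ζ) (B.typ κ ζ) ∧
          ∀ a, A.real κ ζ ρ η a → B.real κ ζ ρ η (c.app a)
  | all A, κ, ζ, ρ, η, a => ∀ x : ℝ, A.real κ ζ ρ (push x η) a
  | ex A, κ, ζ, ρ, η, a => ∃ x : ℝ, A.real κ ζ ρ (push x η) a
  | rst A B, κ, ζ, ρ, η, a =>
      a ∈ A.typ κ ζ ∧ ((∃ b, B.real κ ζ ρ η b) → a ≠ Dom.bot) ∧
        (a ≠ Dom.bot → A.real κ ζ ρ η a)
  | conc A, κ, ζ, ρ, η, c =>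
      ∃ a b, c = Dom.amb a b ∧ a ∈ A.typ κ ζ ∧ b ∈ A.typ κ ζ ∧ (a ≠ Dom.bot ∨ b ≠ Dom.bot) ∧
        (a ≠ Dom.bot → A.real κ ζ ρ η a) ∧ (b ≠ Dom.bot → A.real κ ζ ρ η b)
  | mu k A ts, κ, ζ, ρ, η, a =>
      if A.harrop (push true κ) then
        a = Dom.nil ∧ lfpP (fun Q xs =>
          A.real (push true κ) (push oneT ζ) (push (fun ys b => b = Dom.nil ∧ Q ys) ρ)
            (pushL xs η) Dom.nil) (ts.map (Tm.eval η))
      else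
        lfpP (fun (Q : List ℝ × Dom → Prop) p =>
          A.real (push false κ) (push ((mu k A ts).typ κ ζ) ζ) (push (fun ys b => Q (ys, b)) ρ)
            (pushL p.1 η) p.2) (ts.map (Tm.eval η), a)
  | nu k A ts, κ, ζ, ρ, η, a =>
      if A.harrop (push true κ) then
        a = Dom.nil ∧ gfpP (fun Q xs =>
          A.real (push true κ) (push oneT ζ) (push (fun ys b => b = Dom.nil ∧ Q ys) ρ)
            (pushL xs η) Dom.nil) (ts.map (Tm.eval η))
      else
        gfpP (fun (Q : List ℝ × Dom → Prop) p =>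
          A.real (push false κ) (push ((nu k A ts).typ κ ζ) ζ) (push (fun ys b => Q (ys, b)) ρ)
            (pushL p.1 η) p.2) (ts.map (Tm.eval η), a)

end Fm

/-- The element `a` realises the closed formula `A`. -/
def Realises (a : Dom) (A : Fm) : Prop :=
  A.real (fun _ => false) (fun _ => oneT) (fun _ _ _ => False) (fun _ => 0) a

/-- The closed program `M` realises the closed formula `A`. -/
def Prog.Realises (M : Prog) (A : Fm) : Prop :=
  M.WF 0 ∧ CFP.Realises (M.den fun _ => Dom.bot) A

/-! ### Signed digits and Gray code -/

/-- `SD(d)`: `d` is a signed digit. -/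
def SD (d : Tm) : Fm := .or (.or (.eq d (.const (-1))) (.eq d (.const 1))) (.eq d (.const 0))

/-- `|2x - d| ≤ 1`. -/
def II (d x : Tm) : Fm := .le (.abs (.sub (.two x) d)) (.const 1)

/-- The concurrent signed digit predicate, the largest `S` with
`S(x) = ⇊*((∃ d ∈ SD) (II(d, x) ∧ S(2x - d)))`. -/
def SStar (t : Tm) : Fm :=
  .nu 1 (.concStar (.ex (.and (SD (.var 0))
    (.and (II (.var 0) (.var 1)) (.pvar 0 [.sub (.two (.var 1)) (.var 0)]))))) [t]

/-- `D*(x)`, i.e. `x ≠ 0 → ⇊*(x ≤ 0 ∨ x ≥ 0)`. -/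
def DStar (x : Tm) : Fm :=
  .imp (.neg (.eq x (.const 0))) (.concStar (.or (.le x (.const 0)) (.le (.const 0) x)))

/-- The concurrent Gray code predicate, the largest `G` with
`G(x) = (-1 ≤ x ≤ 1) ∧ D*(x) ∧ G(1 - 2|x|)`. -/
def GStar (t : Tm) : Fm :=
  .nu 1 (.and (.and (.le (.const (-1)) (.var 0)) (.le (.var 0) (.const 1)))
    (.and (DStar (.var 0)) (.pvar 0 [.tent (.var 0)]))) [t]

end CFP

end

namespace CFP

/-! ### Order theory of the domain -/

-- Write t(x) = 1 - 2|x|. Both inclusions are coinductions that rest on a few identities for t.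
--
-- From digits to Gray code, one needs the bounds, the sign condition and closure of S* under t. The
-- bounds follow from |2x - d| ≤ 1 and are Harrop, so they leave ⇊*. A digit ±1 decides the sign of
-- x; the digit 0 gives |x| ≤ 1/2 and reduces the question to 2x, which is Archimedean induction
-- (`Der.sStar_sign`). For the tent function, digit -1 gives t(x) = 2x + 1, digit 1 gives t(x) =
-- -(2x - 1), and digit 0 makes t(x) ≥ 0, so that t(x) has digit 1 with remainder 2t(x) - 1 = t(2x)
-- (`Der.sStar_of_tentF`). Closure under negation is needed for digit 1.
--
-- From Gray code to digits, x ≤ 0 allows digit -1 with remainder t(x), x ≥ 0 allows digit 1 with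
-- remainder -t(x), and t(x) ≥ 0 allows digit 0 with remainder 2x. For the last remainder, t(2x) =
-- -t(t(x)) shows that 2x is again in G* (`Der.gStar_two`). The sign information for x or for t(x)
-- may be missing at 0, but x and t(x) are never both 0, so the two searches can be run concurrently
-- (`Der.sStar_of_gStar`).
--
-- Realisability is proved independently of the derivations: explicit programs are checked against
-- their denotations (`digitsToGray_realises`, `grayToDigits_realises`). Realisers of ⇊* are binary
-- trees that may have undefined branches; their leaves are searched by parallel disjunction or
-- rewritten by a recursive program. Least fixed points are handled by induction over such trees,
-- greatest ones by coinduction.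
--
-- The denotations are meaningful only if all maps involved are Scott continuous. Constructors embed
-- the domain onto Scott open sets, so a case distinction that is continuous on each branch and ⊥
-- elsewhere is continuous (`Dom.scottContinuous_of_branches`). This covers patterns, application
-- and, through a decidable check, all the programs used.

instance Shape.instFinite {X : Type} [PartialOrder X] [Finite X] : Finite (Shape X) := by
  let f : Unit ⊕ Unit ⊕ X ⊕ X ⊕ (X × X) ⊕ (X × X) ⊕ (X →o X) → Shape X := fun
    | .inl _ => .bot
    | .inr (.inl _) => .nil
    | .inr (.inr (.inl x)) => .left x
    | .inr (.inr (.inr (.inl x))) => .right x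
    | .inr (.inr (.inr (.inr (.inl x)))) => .pair x.1 x.2
    | .inr (.inr (.inr (.inr (.inr (.inl x))))) => .amb x.1 x.2
    | .inr (.inr (.inr (.inr (.inr (.inr g))))) => .fn g
  have : Finite (X →o X) := DFunLike.finite _
  refine Finite.of_surjective f fun s => ?_
  cases s
  · exact ⟨.inl (), rfl⟩
  · exact ⟨.inr (.inl ()), rfl⟩
  · exact ⟨.inr (.inr (.inl _)), rfl⟩
  · exact ⟨.inr (.inr (.inr (.inl _))), rfl⟩
  · exact ⟨.inr (.inr (.inr (.inr (.inl (_, _))))), rfl⟩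
  · exact ⟨.inr (.inr (.inr (.inr (.inr (.inl (_, _)))))), rfl⟩
  · exact ⟨.inr (.inr (.inr (.inr (.inr (.inr _))))), rfl⟩

namespace Lvl

instance instFinite : ∀ n, Finite (Lvl n)
  | 0 => inferInstanceAs (Finite PUnit)
  | n + 1 => by
    have := instFinite n
    exact inferInstanceAs (Finite (Shape (Lvl n)))

theorem trans_self : ∀ (n : ℕ) (a : Lvl n), trans n n a = a
  | 0, _ => rfl
  | n + 1, a => by
    have ih := trans_self n
    simp only [trans]
    cases a
    · rfl
    · rfl
    · exact congrArg Shape.left (ih _)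
    · exact congrArg Shape.right (ih _)
    · exact congrArg₂ Shape.pair (ih _) (ih _)
    · exact congrArg₂ Shape.amb (ih _) (ih _)
    · rename_i f
      refine congrArg Shape.fn (OrderHom.ext _ _ (funext fun y => ?_))
      exact (ih _).trans (congrArg f (ih y))

theorem bot_le : ∀ (n : ℕ) (a : Lvl n), bot n ≤ a
  | 0, _ => le_rfl
  | _ + 1, _ => trivial

theorem trans_trans_le : ∀ (n m : ℕ) (a : Lvl m), trans n m (trans m n a) ≤ a
  | 0, m, a => by
    have : trans 0 m (trans m 0 a) = bot m := by
      cases m <;> simp only [trans] <;> rfl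
    rw [this]; exact bot_le m a
  | _ + 1, 0, _ => le_rfl
  | n + 1, m + 1, a => by
    have ih := trans_trans_le n m
    simp only [trans]
    cases a
    · exact trivial
    · exact trivial
    · exact ih _
    · exact ih _
    · exact ⟨ih _, ih _⟩
    · exact ⟨ih _, ih _⟩
    · rename_i f
      exact fun y => (ih _).trans (f.monotone (ih y))

end Lvl

namespace Dom

theorem bot_le (x : Dom) : bot ≤ x := fun n => by
  cases n
  · exact le_rfl
  · exact trivial

theorem trans_val (x : Dom) {m n : ℕ} (h : m ≤ n) : Lvl.trans n m (x.val n) = x.val m := by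
  induction n, h using Nat.le_induction with
  | base => exact Lvl.trans_self _ _
  | succ n h ih => rw [← ih, ← x.compat n, Lvl.trans_trans _ _ _ (Or.inr h)]

@[simp] theorem emb_val_self (n : ℕ) (a : Lvl n) : (emb n a).val n = a := Lvl.trans_self n a

theorem emb_val_le (x : Dom) (n : ℕ) : emb n (x.val n) ≤ x := fun m => by
  change Lvl.trans n m (x.val n) ≤ x.val m
  rcases le_total m n with h | h
  · exact (trans_val x h).le
  · rw [← trans_val x h]; exact Lvl.trans_trans_le _ _ _

/-- Embedding and truncation at level n form a Galois connection. -/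
theorem emb_le_iff {n : ℕ} {a : Lvl n} {x : Dom} : emb n a ≤ x ↔ a ≤ x.val n :=
  ⟨fun h => by simpa using h n, fun h => (emb_mono n h).trans (emb_val_le x n)⟩

theorem isLUB_of_val {D : Set Dom} {x : Dom} (hx : x ∈ upperBounds D)
    (h : ∀ n, ∃ d ∈ D, x.val n ≤ d.val n) : IsLUB D x :=
  ⟨hx, fun u hu n => by
    obtain ⟨d, hd, hn⟩ := h n
    exact hn.trans (hu hd n)⟩

/-- On a finite level a directed set attains a greatest value; these values are compatible and form
the supremum. Attainment at each level replaces any appeal to compact elements in the continuity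
proofs. -/
theorem exists_isLUB_val {D : Set Dom} (hne : D.Nonempty) (hD : DirectedOn (· ≤ ·) D) :
    ∃ x, IsLUB D x ∧ ∀ n, ∃ d ∈ D, x.val n = d.val n := by
  have key : ∀ n, ∃ d ∈ D, ∀ e ∈ D, e.val n ≤ d.val n := by
    intro n
    obtain ⟨d, hd⟩ := (Set.toFinite ((fun d : Dom => d.val n) '' D)).exists_maximal (hne.image _)
    obtain ⟨⟨d, hd, rfl⟩, hm⟩ := hd
    refine ⟨d, hd, fun e he => ?_⟩
    obtain ⟨f, hf, hdf, hef⟩ := hD d hd e he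
    exact (hef n).trans (hm ⟨f, hf, rfl⟩ (hdf n))
  choose g hg hmax using key
  let x : Dom := ⟨fun n => (g n).val n, fun n => le_antisymm
    (by rw [(g (n + 1)).compat n]; exact hmax n _ (hg _))
    (by rw [← (g n).compat n]; exact (Lvl.trans _ _).monotone (hmax (n + 1) _ (hg _)))⟩
  exact ⟨x, isLUB_of_val (fun d hd n => hmax n d hd) fun n => ⟨g n, hg n, le_rfl⟩,
    fun n => ⟨g n, hg n, rfl⟩⟩

theorem exists_val_eq {D : Set Dom} (hne : D.Nonempty) (hD : DirectedOn (· ≤ ·) D) {x : Dom}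
    (hx : IsLUB D x) (n : ℕ) : ∃ d ∈ D, x.val n = d.val n := by
  obtain ⟨y, hy, h⟩ := exists_isLUB_val hne hD
  rw [hx.unique hy]
  exact h n

/-- Constructors: order embeddings onto upwards closed, Scott open sets. -/
structure IsCtor {X : Type*} [Preorder X] (c : X → Dom) : Prop where
  le_iff : ∀ {x y}, c x ≤ c y ↔ x ≤ y
  up : ∀ {x u}, c x ≤ u → ∃ y, u = c y
  inacc : ∀ {D : Set Dom}, D.Nonempty → DirectedOn (· ≤ ·) D → ∀ {x}, IsLUB D (c x) →
    ∃ y, c y ∈ D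

/-- The inaccessibility condition for ranges that are determined by the first level. -/
theorem IsCtor.of_head {X : Type*} [Preorder X] {c : X → Dom} (S : Set (Lvl 1))
    (h₁ : ∀ {x y}, c x ≤ c y ↔ x ≤ y) (h₂ : ∀ {u : Dom}, u.val 1 ∈ S → ∃ y, u = c y)
    (h₃ : ∀ x, (c x).val 1 ∈ S) (h₄ : ∀ s ∈ S, ∀ t, s ≤ t → t ∈ S) : IsCtor c where
  le_iff := h₁
  up h := h₂ (h₄ _ (h₃ _) _ (h 1))
  inacc hne hD x hx := by
    obtain ⟨d, hd, h⟩ := exists_val_eq hne hD hx 1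
    obtain ⟨y, rfl⟩ := h₂ (h ▸ h₃ x)
    exact ⟨y, hd⟩

namespace IsCtor

variable {X Y : Type*} [Preorder X] [Preorder Y] {c : X → Dom} {c' : Y → Dom}

/-- An upper bound of a nonempty image lies in the range, since the range is upward closed, and can
then be compared inside `X`. -/
theorem scottContinuous (hc : IsCtor c) : ScottContinuous c := by
  rintro D ⟨d, hd⟩ hD x hx
  refine ⟨?_, fun u hu => ?_⟩
  · rintro _ ⟨y, hy, rfl⟩
    exact hc.le_iff.2 (hx.1 hy)
  · obtain ⟨y, rfl⟩ := hc.up (hu ⟨d, hd, rfl⟩)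
    exact hc.le_iff.2 (hx.2 fun z hz => hc.le_iff.1 (hu ⟨z, hz, rfl⟩))

theorem id : IsCtor fun x : Dom => x where
  le_iff := Iff.rfl
  up _ := ⟨_, rfl⟩
  inacc hne _ _ _ := hne

/-- The preimage of a directed set under a constructor. -/
theorem isLUB_preimage (hc : IsCtor c) {E : Type*} [Preorder E] {H : E → Dom}
    (hH : ScottContinuous H) {D : Set E} (hne : D.Nonempty) (hD : DirectedOn (· ≤ ·) D) {e : E}
    (he : IsLUB D e) {x : X} (hx : H e = c x) :
    {p : E × X | p.1 ∈ D ∧ H p.1 = c p.2}.Nonempty ∧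
      DirectedOn (· ≤ ·) {p : E × X | p.1 ∈ D ∧ H p.1 = c p.2} ∧
      IsLUB {p : E × X | p.1 ∈ D ∧ H p.1 = c p.2} (e, x) := by
  have hL := hH hne hD he
  rw [hx] at hL
  obtain ⟨y₀, d₀, hd₀, h₀⟩ := hc.inacc (hne.image H) (hD.mono_comp (fun _ _ h => hH.monotone h)) hL
  -- Everything in `D` above `d₀` has the shape of the constructor, so such elements are cofinal and
  -- have the same supremum.
  have cof : ∀ d ∈ D, ∃ d' ∈ D, d ≤ d' ∧ ∃ y, H d' = c y := by
    intro d hd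
    obtain ⟨d', hd', h₁, h₂⟩ := hD d hd d₀ hd₀
    exact ⟨d', hd', h₁, hc.up (h₀ ▸ hH.monotone h₂)⟩
  refine ⟨⟨(d₀, y₀), hd₀, h₀⟩, ?_, ?_, ?_⟩
  · rintro ⟨d, y⟩ ⟨hd, hy⟩ ⟨d', y'⟩ ⟨hd', hy'⟩
    obtain ⟨d'', hd'', h₁, h₂⟩ := hD d hd d' hd'
    obtain ⟨y'', hy''⟩ := hc.up (hy ▸ hH.monotone h₁)
    refine ⟨(d'', y''), ⟨hd'', hy''⟩, ⟨h₁, ?_⟩, ⟨h₂, ?_⟩⟩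
    · exact hc.le_iff.1 (hy ▸ hy'' ▸ hH.monotone h₁)
    · exact hc.le_iff.1 (hy' ▸ hy'' ▸ hH.monotone h₂)
  · rintro ⟨d, y⟩ ⟨hd, hy⟩
    exact ⟨he.1 hd, hc.le_iff.1 (hy ▸ hL.1 ⟨d, hd, rfl⟩)⟩
  · rintro ⟨v, w⟩ hvw
    refine ⟨he.2 fun d hd => ?_, hc.le_iff.1 (hL.2 ?_)⟩
    · obtain ⟨d', hd', h, y, hy⟩ := cof d hd
      exact h.trans (hvw (show (d', y) ∈ _ from ⟨hd', hy⟩)).1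
    · rintro _ ⟨d, hd, rfl⟩
      obtain ⟨d', hd', h, y, hy⟩ := cof d hd
      exact (hH.monotone h).trans (hy ▸ hc.le_iff.2 (hvw (show (d', y) ∈ _ from ⟨hd', hy⟩)).2)

theorem comp_left {l : Dom → Dom} (hl : IsCtor l) (hc : IsCtor c) : IsCtor fun x => l (c x) where
  le_iff := hl.le_iff.trans hc.le_iff
  up h := by
    obtain ⟨y, rfl⟩ := hl.up h
    obtain ⟨z, rfl⟩ := hc.up (hl.le_iff.1 h)
    exact ⟨z, rfl⟩
  inacc hne hD x hx := by
    obtain ⟨h₁, h₂, h₃⟩ := hl.isLUB_preimage ScottContinuous.id hne hD hx (x := c x) rfl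
    have h₄ := ScottContinuous.snd h₁ h₂ h₃
    obtain ⟨y, ⟨d, _⟩, ⟨hd, h⟩, rfl⟩ := hc.inacc (h₁.image Prod.snd)
      (h₂.mono_comp fun _ _ h => h.2) h₄
    exact ⟨y, by simpa [← h] using hd⟩

theorem comp_pair {l : Dom × Dom → Dom} (hl : IsCtor l) (hc : IsCtor c) (hc' : IsCtor c') :
    IsCtor fun p : X × Y => l (c p.1, c' p.2) where
  le_iff := hl.le_iff.trans (and_congr hc.le_iff hc'.le_iff)
  up h := by
    obtain ⟨⟨y, y'⟩, rfl⟩ := hl.up h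
    obtain ⟨h₁, h₂⟩ := hl.le_iff.1 h
    obtain ⟨z, rfl⟩ := hc.up h₁
    obtain ⟨z', rfl⟩ := hc'.up h₂
    exact ⟨(z, z'), rfl⟩
  inacc hne hD x hx := by
    obtain ⟨h₁, h₂, h₃⟩ := hl.isLUB_preimage ScottContinuous.id hne hD hx (x := (c x.1, c' x.2)) rfl
    have h₄ := ScottContinuous.snd h₁ h₂ h₃
    have h₅ := isLUB_prod.1 h₄
    rw [Set.image_image, Set.image_image] at h₅
    obtain ⟨y, ⟨d, a, b⟩, ⟨hd, h⟩, rfl⟩ := hc.inacc (h₁.image _)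
      (h₂.mono_comp fun _ _ h => h.2.1) h₅.1
    obtain ⟨y', ⟨d', a', b'⟩, ⟨hd', h'⟩, rfl⟩ := hc'.inacc (h₁.image _)
      (h₂.mono_comp fun _ _ h => h.2.2) h₅.2
    -- The two components get their shapes at possibly different members; a common upper bound has
    -- both.
    obtain ⟨⟨d'', a'', b''⟩, ⟨hd'', h''⟩, k, k'⟩ := h₂ _ ⟨hd, h⟩ _ ⟨hd', h'⟩
    obtain ⟨z, rfl⟩ := hc.up k.2.1
    obtain ⟨z', rfl⟩ := hc'.up k'.2.2
    exact ⟨(z, z'), by simpa [← h''] using hd''⟩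

end IsCtor
end Dom
end CFP

namespace CFP
namespace Dom

-- Constructors are recognised at the first level

theorem map_val_succ (u : Dom) (n : ℕ) :
    Shape.map (Lvl.trans n 0) (Lvl.trans 0 n) (u.val (n + 1)) = u.val 1 := by
  have := trans_val u (Nat.le_add_left 1 n)
  rw [Lvl.trans] at this
  exact this

theorem map_compat (u : Dom) (n : ℕ) :
    Shape.map (Lvl.trans (n + 1) n) (Lvl.trans n (n + 1)) (u.val (n + 2)) = u.val (n + 1) := by
  have := u.compat (n + 1)
  rw [Lvl.trans] at this
  exact this

theorem ext_succ {u v : Dom} (h : ∀ n, u.val (n + 1) = v.val (n + 1)) : u = v :=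
  Dom.ext (funext fun | 0 => rfl | n + 1 => h n)

/-- Projections preserve the head constructor, so the one seen at level 1 occurs at every level. Its
arguments are compatible because `Shape.map` acts on them separately. -/
theorem exists_left {u : Dom} {a : Lvl 0} (hu : u.val 1 = Shape.left a) : ∃ y, u = left y := by
  have : ∀ n, ∃ a, u.val (n + 1) = Shape.left a := fun n => by
    have h := map_val_succ u n
    rw [hu] at h
    generalize u.val (n + 1) = s at h
    cases s <;> first | exact ⟨_, rfl⟩ | cases h
  choose g hg using this
  refine ⟨⟨g, fun n => ?_⟩, ext_succ hg⟩
  have h := map_compat u n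
  rw [hg, hg] at h
  exact Shape.left.inj h

theorem exists_right {u : Dom} {a : Lvl 0} (hu : u.val 1 = Shape.right a) :
    ∃ y, u = right y := by
  have : ∀ n, ∃ a, u.val (n + 1) = Shape.right a := fun n => by
    have h := map_val_succ u n
    rw [hu] at h
    generalize u.val (n + 1) = s at h
    cases s <;> first | exact ⟨_, rfl⟩ | cases h
  choose g hg using this
  refine ⟨⟨g, fun n => ?_⟩, ext_succ hg⟩
  have h := map_compat u n
  rw [hg, hg] at h
  exact Shape.right.inj h

theorem exists_nil {u : Dom} (hu : u.val 1 = Shape.nil) : u = nil := by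
  refine ext_succ fun n => ?_
  have h := map_val_succ u n
  rw [hu] at h
  change _ = Shape.nil
  generalize u.val (n + 1) = s at h
  cases s <;> first | rfl | cases h

theorem exists_pair {u : Dom} {a b : Lvl 0} (hu : u.val 1 = Shape.pair a b) :
    ∃ y z, u = pair y z := by
  have : ∀ n, ∃ a b, u.val (n + 1) = Shape.pair a b := fun n => by
    have h := map_val_succ u n
    rw [hu] at h
    generalize u.val (n + 1) = s at h
    cases s <;> first | exact ⟨_, _, rfl⟩ | cases h
  choose g g' hg using this
  have key : ∀ n, Lvl.trans (n + 1) n (g (n + 1)) = g n ∧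
      Lvl.trans (n + 1) n (g' (n + 1)) = g' n := fun n => by
    have h := map_compat u n
    rw [hg, hg] at h
    exact Shape.pair.inj h
  exact ⟨⟨g, fun n => (key n).1⟩, ⟨g', fun n => (key n).2⟩, ext_succ hg⟩

theorem exists_amb {u : Dom} {a b : Lvl 0} (hu : u.val 1 = Shape.amb a b) :
    ∃ y z, u = amb y z := by
  have : ∀ n, ∃ a b, u.val (n + 1) = Shape.amb a b := fun n => by
    have h := map_val_succ u n
    rw [hu] at h
    generalize u.val (n + 1) = s at h
    cases s <;> first | exact ⟨_, _, rfl⟩ | cases h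
  choose g g' hg using this
  have key : ∀ n, Lvl.trans (n + 1) n (g (n + 1)) = g n ∧
      Lvl.trans (n + 1) n (g' (n + 1)) = g' n := fun n => by
    have h := map_compat u n
    rw [hg, hg] at h
    exact Shape.amb.inj h
  exact ⟨⟨g, fun n => (key n).1⟩, ⟨g', fun n => (key n).2⟩, ext_succ hg⟩

theorem isCtor_left : IsCtor left := by
  refine .of_head {s | ∃ a, s = Shape.left a} ⟨fun h n => h (n + 1), fun h n => ?_⟩
    (fun ⟨_, h⟩ => exists_left h) (fun x => ⟨_, rfl⟩) ?_
  · cases n; exacts [le_rfl, h _]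
  · rintro _ ⟨a, rfl⟩ (t : Shape _) (h : Shape.le _ t)
    cases t <;> first | exact ⟨_, rfl⟩ | cases h

theorem isCtor_right : IsCtor right := by
  refine .of_head {s | ∃ a, s = Shape.right a} ⟨fun h n => h (n + 1), fun h n => ?_⟩
    (fun ⟨_, h⟩ => exists_right h) (fun x => ⟨_, rfl⟩) ?_
  · cases n; exacts [le_rfl, h _]
  · rintro _ ⟨a, rfl⟩ (t : Shape _) (h : Shape.le _ t)
    cases t <;> first | exact ⟨_, rfl⟩ | cases h

theorem isCtor_nil : IsCtor fun _ : PUnit => nil := by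
  refine .of_head {Shape.nil} ⟨fun _ => le_rfl, fun _ => le_rfl⟩
    (fun h => ⟨⟨⟩, exists_nil h⟩) (fun x => rfl) ?_
  rintro _ rfl (t : Shape _) (h : Shape.le _ t)
  cases t <;> first | rfl | cases h

theorem isCtor_pair : IsCtor fun p : Dom × Dom => pair p.1 p.2 := by
  refine .of_head {s | ∃ a b, s = Shape.pair a b}
    ⟨fun h => ⟨fun n => (h (n + 1)).1, fun n => (h (n + 1)).2⟩, fun h n => ?_⟩
    (fun ⟨_, _, h⟩ => ?_) (fun x => ⟨_, _, rfl⟩) ?_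
  · cases n; exacts [le_rfl, ⟨h.1 _, h.2 _⟩]
  · obtain ⟨y, z, h⟩ := exists_pair h
    exact ⟨(y, z), h⟩
  · rintro _ ⟨a, b, rfl⟩ (t : Shape _) (h : Shape.le _ t)
    cases t <;> first | exact ⟨_, _, rfl⟩ | cases h

theorem isCtor_amb : IsCtor fun p : Dom × Dom => amb p.1 p.2 := by
  refine .of_head {s | ∃ a b, s = Shape.amb a b}
    ⟨fun h => ⟨fun n => (h (n + 1)).1, fun n => (h (n + 1)).2⟩, fun h n => ?_⟩
    (fun ⟨_, _, h⟩ => ?_) (fun x => ⟨_, _, rfl⟩) ?_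
  · cases n; exacts [le_rfl, ⟨h.1 _, h.2 _⟩]
  · obtain ⟨y, z, h⟩ := exists_amb h
    exact ⟨(y, z), h⟩
  · rintro _ ⟨a, b, rfl⟩ (t : Shape _) (h : Shape.le _ t)
    cases t <;> first | exact ⟨_, _, rfl⟩ | cases h

@[simp] theorem left_inj {a b : Dom} : left a = left b ↔ a = b :=
  ⟨fun h => le_antisymm (isCtor_left.le_iff.1 h.le) (isCtor_left.le_iff.1 h.ge), fun h => h ▸ rfl⟩

@[simp] theorem right_inj {a b : Dom} : right a = right b ↔ a = b :=
  ⟨fun h => le_antisymm (isCtor_right.le_iff.1 h.le) (isCtor_right.le_iff.1 h.ge),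
    fun h => h ▸ rfl⟩

@[simp] theorem pair_inj {a b a' b' : Dom} : pair a b = pair a' b' ↔ a = a' ∧ b = b' := by
  refine ⟨fun h => ?_, fun ⟨h, h'⟩ => h ▸ h' ▸ rfl⟩
  have h₁ : (a, b) ≤ (a', b') := isCtor_pair.le_iff.1 h.le
  have h₂ : (a', b') ≤ (a, b) := isCtor_pair.le_iff.1 h.ge
  exact Prod.mk.inj (le_antisymm h₁ h₂)

@[simp] theorem amb_inj {a b a' b' : Dom} : amb a b = amb a' b' ↔ a = a' ∧ b = b' := by
  refine ⟨fun h => ?_, fun ⟨h, h'⟩ => h ▸ h' ▸ rfl⟩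
  have h₁ : (a, b) ≤ (a', b') := isCtor_amb.le_iff.1 h.le
  have h₂ : (a', b') ≤ (a, b) := isCtor_amb.le_iff.1 h.ge
  exact Prod.mk.inj (le_antisymm h₁ h₂)

theorem ne_of_val {u v : Dom} (h : u.val 1 ≠ v.val 1) : u ≠ v := fun h' => h (h' ▸ rfl)

variable (a b c d : Dom)
@[simp] theorem left_ne_bot : left a ≠ bot := ne_of_val nofun
@[simp] theorem right_ne_bot : right a ≠ bot := ne_of_val nofun
@[simp] theorem bot_ne_nil : bot ≠ nil := ne_of_val nofun
@[simp] theorem bot_ne_left : bot ≠ left a := ne_of_val nofun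
@[simp] theorem bot_ne_right : bot ≠ right a := ne_of_val nofun
@[simp] theorem nil_ne_left : nil ≠ left a := ne_of_val nofun
@[simp] theorem nil_ne_right : nil ≠ right a := ne_of_val nofun
@[simp] theorem nil_ne_pair : nil ≠ pair a b := ne_of_val nofun
@[simp] theorem nil_ne_amb : nil ≠ amb a b := ne_of_val nofun
@[simp] theorem left_ne_nil : left a ≠ nil := ne_of_val nofun
@[simp] theorem left_ne_right : left a ≠ right b := ne_of_val nofun
@[simp] theorem left_ne_pair : left a ≠ pair b c := ne_of_val nofun
@[simp] theorem left_ne_amb : left a ≠ amb b c := ne_of_val nofun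
@[simp] theorem right_ne_nil : right a ≠ nil := ne_of_val nofun
@[simp] theorem right_ne_left : right a ≠ left b := ne_of_val nofun
@[simp] theorem right_ne_pair : right a ≠ pair b c := ne_of_val nofun
@[simp] theorem right_ne_amb : right a ≠ amb b c := ne_of_val nofun
@[simp] theorem pair_ne_nil : pair a b ≠ nil := ne_of_val nofun
@[simp] theorem pair_ne_left : pair a b ≠ left c := ne_of_val nofun
@[simp] theorem pair_ne_right : pair a b ≠ right c := ne_of_val nofun
@[simp] theorem pair_ne_amb : pair a b ≠ amb c d := ne_of_val nofun
@[simp] theorem amb_ne_nil : amb a b ≠ nil := ne_of_val nofun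
@[simp] theorem amb_ne_left : amb a b ≠ left c := ne_of_val nofun
@[simp] theorem amb_ne_right : amb a b ≠ right c := ne_of_val nofun
@[simp] theorem amb_ne_pair : amb a b ≠ pair c d := ne_of_val nofun

/-! ### Functions -/

theorem isLUB_emb (x : Dom) : IsLUB (Set.range fun n => emb n (x.val n)) x :=
  isLUB_of_val (by rintro _ ⟨n, rfl⟩; exact emb_val_le x n) fun n =>
    ⟨_, ⟨n, rfl⟩, by simp⟩

theorem monotone_emb_val (x : Dom) : Monotone fun n => emb n (x.val n) := fun m n h =>
  emb_le_iff.2 (by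
    change _ ≤ Lvl.trans n m (x.val n)
    exact (trans_val x h).ge)

theorem fn_val {f : Dom → Dom} (hf : ScottContinuous f) (n : ℕ) :
    (fn f).val (n + 1) =
      Shape.fn ⟨fun a => (f (emb n a)).val n, fun _ _ h => hf.monotone (emb_mono n h) n⟩ := by
  rw [fn, dif_pos hf]; rfl

/-- The components of `fn f` record only truncated values at finite elements; continuity recovers `f
x` as the supremum of the values at the truncations of `x`. -/
theorem fn_le_fn {f g : Dom → Dom} (hf : ScottContinuous f) (hg : ScottContinuous g) :
    fn f ≤ fn g ↔ f ≤ g := by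
  constructor
  · intro h x
    have hL := hf (Set.range_nonempty _) (directedOn_range.2 (monotone_emb_val x).directed_le)
      (isLUB_emb x)
    refine hL.2 ?_
    rintro _ ⟨_, ⟨n, rfl⟩, rfl⟩
    refine le_trans (fun m => ?_) (hg.monotone (emb_val_le x n))
    have h₁ : ∀ k (a : Lvl k), (f (emb k a)).val k ≤ (g (emb k a)).val k := fun k a => by
      have := h (k + 1)
      rw [fn_val hf, fn_val hg] at this
      exact this a
    -- A comparison at level k is available only for arguments embedded from level k. For n ≤ m the
    -- argument is lifted to level m; otherwise the comparison at level n is projected down.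
    rcases le_total n m with hnm | hnm
    · have := h₁ m (Lvl.trans n m (x.val n))
      rwa [show emb m (Lvl.trans n m (x.val n)) = emb n (x.val n) from
        Dom.ext (funext fun k => Lvl.trans_trans n m k (Or.inl hnm) _)] at this
    · rw [← trans_val _ hnm, ← trans_val (g _) hnm]
      exact (Lvl.trans n m).monotone (h₁ n _)
  · intro h n
    cases n
    · exact le_rfl
    · rw [fn_val hf, fn_val hg]
      exact fun a => h _ _

/-- The map is the pointwise supremum of the finite maps `g n` applied to truncations. It is
continuous because every level of a value is reached at a finite stage, and compatibility (`key'`,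
`mono`) shows that truncating it gives back `g n`. -/
theorem exists_fn {u : Dom} {φ : Lvl 0 →o Lvl 0} (hu : u.val 1 = Shape.fn φ) :
    ∃ f, ScottContinuous f ∧ u = fn f := by
  have : ∀ n, ∃ φ, u.val (n + 1) = Shape.fn φ := fun n => by
    have h := map_val_succ u n
    rw [hu] at h
    generalize u.val (n + 1) = s at h
    cases s <;> first | exact ⟨_, rfl⟩ | cases h
  choose g hg using this
  have key : ∀ n (a : Lvl n), Lvl.trans (n + 1) n (g (n + 1) (Lvl.trans n (n + 1) a)) = g n a :=
    fun n a => by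
    have h := map_compat u n
    rw [hg, hg] at h
    exact DFunLike.congr_fun (Shape.fn.inj h) a
  have key' : ∀ n k, n ≤ k → ∀ a : Lvl n, Lvl.trans k n (g k (Lvl.trans n k a)) = g n a := by
    intro n k h
    induction k, h using Nat.le_induction with
    | base => intro a; simp only [Lvl.trans_self]
    | succ k h ih =>
      intro a
      rw [← ih, ← key k, Lvl.trans_trans _ _ _ (Or.inr h), Lvl.trans_trans _ _ _ (Or.inl h)]
  have mono : ∀ x : Dom, Monotone fun n => emb n (g n (x.val n)) := fun x => by
    refine monotone_nat_of_le_succ fun n => emb_le_iff.2 ?_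
    change _ ≤ Lvl.trans (n + 1) n (g (n + 1) (x.val (n + 1)))
    rw [← key n]
    refine (Lvl.trans _ _).monotone ((g _).monotone ?_)
    rw [← x.compat n]
    exact Lvl.trans_trans_le _ _ _
  have hL : ∀ x : Dom, ∃ y, IsLUB (Set.range fun n => emb n (g n (x.val n))) y ∧ ∀ m, ∃ n,
      y.val m = (emb n (g n (x.val n))).val m := fun x => by
    obtain ⟨y, hy, h⟩ := exists_isLUB_val (Set.range_nonempty _)
      (directedOn_range.2 (mono x).directed_le)
    refine ⟨y, hy, fun m => ?_⟩
    obtain ⟨_, ⟨n, rfl⟩, h⟩ := h m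
    exact ⟨n, h⟩
  choose f hf hfv using hL
  have hfm : Monotone f := fun x y h => (hf x).2 (by
    rintro _ ⟨n, rfl⟩
    exact (emb_mono n ((g n).monotone (h n))).trans ((hf y).1 ⟨n, rfl⟩))
  have hfc : ScottContinuous f := by
    intro D hne hD x hx
    refine isLUB_of_val ?_ fun m => ?_
    · rintro _ ⟨d, hd, rfl⟩; exact hfm (hx.1 hd)
    · obtain ⟨n, hn⟩ := hfv x m
      obtain ⟨d, hd, h⟩ := exists_val_eq hne hD hx n
      refine ⟨_, ⟨d, hd, rfl⟩, ?_⟩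
      rw [hn, h]
      exact (hf d).1 ⟨n, rfl⟩ m
  refine ⟨f, hfc, ext_succ fun n => ?_⟩
  rw [hg, fn_val hfc]
  refine congrArg Shape.fn (OrderHom.ext _ _ (funext fun a => ?_))
  change g n a = (f (emb n a)).val n
  refine le_antisymm ?_ ?_
  · have := (hf (emb n a)).1 ⟨n, rfl⟩ n
    simpa using this
  · obtain ⟨k, hk⟩ := hfv (emb n a) n
    rw [hk]
    change Lvl.trans k n (g k (Lvl.trans n k a)) ≤ _
    rcases le_total n k with h | h
    · exact (key' n k h a).le
    · have := mono (emb n a) h n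
      simp only [emb_val_self] at this
      exact this

theorem fn_inj {f g : Dom → Dom} (hf : ScottContinuous f) (hg : ScottContinuous g)
    (h : fn f = fn g) : f = g :=
  le_antisymm ((fn_le_fn hf hg).1 h.le) ((fn_le_fn hg hf).1 h.ge)

theorem app_fn {f : Dom → Dom} (hf : ScottContinuous f) (x : Dom) : app (fn f) x = f x := by
  have h : ∃ g : Dom → Dom, ScottContinuous g ∧ fn f = fn g := ⟨f, hf, rfl⟩
  rw [app, dif_pos h, ← fn_inj hf h.choose_spec.1 h.choose_spec.2]

theorem isCtor_fn : IsCtor fun f : {f : Dom → Dom // ScottContinuous f} => fn f.1 := by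
  refine .of_head {s | ∃ φ, s = Shape.fn φ} (fn_le_fn (Subtype.prop _) (Subtype.prop _))
    (fun ⟨_, h⟩ => ?_) (fun x => ⟨_, fn_val x.2 0⟩) ?_
  · obtain ⟨f, hf, h⟩ := exists_fn h
    exact ⟨⟨f, hf⟩, h⟩
  · rintro _ ⟨a, rfl⟩ (t : Shape _) (h : Shape.le _ t)
    cases t <;> first | exact ⟨_, rfl⟩ | cases h

theorem fn_ne_bot {f : Dom → Dom} (hf : ScottContinuous f) : fn f ≠ bot :=
  ne_of_val (by rw [fn_val hf]; nofun)

theorem app_of_ne_fn {x : Dom} (h : ∀ f, ScottContinuous f → x ≠ fn f) (y : Dom) :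
    app x y = bot := by
  rw [app, dif_neg]
  rintro ⟨f, hf, rfl⟩
  exact h f hf rfl

@[simp] theorem app_bot (x : Dom) : app bot x = bot :=
  app_of_ne_fn (fun _ hf h => fn_ne_bot hf h.symm) x

/-- Continuity of functions defined by case distinction over constructors. -/
theorem scottContinuous_of_branches {E ι : Type*} [Preorder E] {X : ι → Type*}
    [∀ i, Preorder (X i)] {c : ∀ i, X i → Dom} (hc : ∀ i, IsCtor (c i)) {H R : E → Dom}
    (hH : ScottContinuous H) {G : ∀ i, E × X i → Dom} (hG : ∀ i, ScottContinuous (G i))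
    (h₁ : ∀ i e x, H e = c i x → R e = G i (e, x))
    (h₂ : ∀ e, (∀ i x, H e ≠ c i x) → R e = bot) : ScottContinuous R := by
  have mono : Monotone R := fun e e' h => by
    by_cases hb : ∃ i x, H e = c i x
    · obtain ⟨i, x, hx⟩ := hb
      obtain ⟨y, hy⟩ := (hc i).up (hx ▸ hH.monotone h)
      rw [h₁ i e x hx, h₁ i e' y hy]
      refine (hG i).monotone ⟨h, (hc i).le_iff.1 ?_⟩
      rw [← hx, ← hy]
      exact hH.monotone h
    · push Not at hb
      rw [h₂ e hb]
      exact bot_le _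
  intro D hne hD e he
  refine ⟨?_, fun u hu => ?_⟩
  · rintro _ ⟨d, hd, rfl⟩
    exact mono (he.1 hd)
  · by_cases hb : ∃ i x, H e = c i x
    · obtain ⟨i, x, hx⟩ := hb
      obtain ⟨k₁, k₂, k₃⟩ := (hc i).isLUB_preimage hH hne hD he hx
      rw [h₁ i e x hx]
      refine (hG i k₁ k₂ k₃).2 ?_
      rintro _ ⟨⟨d, y⟩, ⟨hd, hy⟩, rfl⟩
      rw [← h₁ i d y hy]
      exact hu ⟨d, hd, rfl⟩
    · push Not at hb
      rw [h₂ e hb]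
      exact bot_le _

/-- A map of two arguments is continuous if it is so in each of them. -/
theorem scottContinuous_uncurry {E F : Type*} [Preorder E] [Preorder F] {g : E → F → Dom}
    (h₁ : ∀ y, ScottContinuous fun x => g x y) (h₂ : ∀ x, ScottContinuous (g x)) :
    ScottContinuous fun p : E × F => g p.1 p.2 := by
  rintro D ⟨d₀, hd₀⟩ hD ⟨x, y⟩ hxy
  have hx : IsLUB (Prod.fst '' D) x := (isLUB_prod.1 hxy).1
  have hy : IsLUB (Prod.snd '' D) y := (isLUB_prod.1 hxy).2
  have mono : ∀ {x x' y y'}, x ≤ x' → y ≤ y' → g x y ≤ g x' y' := fun h h' =>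
    ((h₁ _).monotone h).trans ((h₂ _).monotone h')
  refine ⟨?_, fun u hu => ?_⟩
  · rintro _ ⟨d, hd, rfl⟩
    exact mono (hxy.1 hd).1 (hxy.1 hd).2
  · have hne : D.Nonempty := ⟨d₀, hd₀⟩
    refine (h₁ y (hne.image _) (hD.mono_comp fun _ _ h => h.1) hx).2 ?_
    rintro _ ⟨_, ⟨p, hp, rfl⟩, rfl⟩
    refine (h₂ p.1 (hne.image _) (hD.mono_comp fun _ _ h => h.2) hy).2 ?_
    rintro _ ⟨_, ⟨q, hq, rfl⟩, rfl⟩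
    obtain ⟨r, hr, h, h'⟩ := hD p hp q hq
    exact (mono h.1 h'.2).trans (hu ⟨r, hr, rfl⟩)

/-- Continuity in the function argument means that suprema of continuous maps are pointwise. The
pointwise supremum `F` exists by directedness and is itself continuous, hence it bounds the supremum
taken among continuous maps. -/
theorem scottContinuous_eval :
    ScottContinuous fun p : Dom × {f : Dom → Dom // ScottContinuous f} => p.2.1 p.1 := by
  refine scottContinuous_uncurry (g := fun x (f : {f : Dom → Dom // ScottContinuous f}) => f.1 x) (fun f => f.2) fun x => ?_
  rintro D ⟨f₀, hf₀⟩ hD f hf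
  refine ⟨?_, fun u hu => ?_⟩
  · rintro _ ⟨g, hg, rfl⟩
    exact hf.1 hg x
  · have hL : ∀ y, ∃ z, IsLUB ((fun g : {f : Dom → Dom // ScottContinuous f} => g.1 y) '' D) z :=
      fun y => by
      obtain ⟨z, hz, -⟩ := exists_isLUB_val (Set.Nonempty.image _ ⟨f₀, hf₀⟩)
        (hD.mono_comp (rb := (· ≤ ·))
          (g := fun g : {f : Dom → Dom // ScottContinuous f} => g.1 y) fun _ _ h => h y)
      exact ⟨z, hz⟩
    choose F hF using hL
    have hFc : ScottContinuous F := by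
      intro S hne hS y hy
      refine ⟨?_, fun v hv => (hF y).2 ?_⟩
      · rintro _ ⟨s, hs, rfl⟩
        refine (hF s).2 ?_
        rintro _ ⟨g, hg, rfl⟩
        exact (g.2.monotone (hy.1 hs)).trans ((hF y).1 ⟨g, hg, rfl⟩)
      · rintro _ ⟨g, hg, rfl⟩
        refine (g.2 hne hS hy).2 ?_
        rintro _ ⟨s, hs, rfl⟩
        exact ((hF s).1 ⟨g, hg, rfl⟩).trans (hv ⟨s, hs, rfl⟩)
    have : f ≤ ⟨F, hFc⟩ := hf.2 fun g hg y => (hF y).1 ⟨g, hg, rfl⟩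
    exact (this x).trans ((hF x).2 hu)

/-- Application is a case distinction with the single constructor `fn`, whose branch is evaluation.
-/
theorem scottContinuous_app {E : Type*} [Preorder E] {f g : E → Dom} (hf : ScottContinuous f)
    (hg : ScottContinuous g) : ScottContinuous fun e => app (f e) (g e) := by
  refine scottContinuous_of_branches (ι := Unit) (fun _ => isCtor_fn) hf
    (G := fun _ p => p.2.1 (g p.1)) (fun _ => ?_) ?_ ?_
  · exact ((ScottContinuous.fst.comp hg).prodMk .snd).comp scottContinuous_eval
  · rintro _ e ⟨φ, hφ⟩ h
    rw [h, app_fn hφ]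
  · intro e h
    exact app_of_ne_fn (fun φ hφ => h () ⟨φ, hφ⟩) _

theorem scottContinuous_fn {E : Type*} [Preorder E] {g : E → Dom → Dom}
    (hg : ScottContinuous fun p : E × Dom => g p.1 p.2) : ScottContinuous fun e => fn (g e) := by
  have h₁ : ∀ e, ScottContinuous (g e) := fun e => (ScottContinuous.prodMk (.const e) .id).comp hg
  have h₂ : ∀ x, ScottContinuous fun e => g e x := fun x => (ScottContinuous.prodMk .id (.const x)).comp hg
  have : ScottContinuous fun e => (⟨g e, h₁ e⟩ : {f : Dom → Dom // ScottContinuous f}) := by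
    intro D hne hD e he
    refine ⟨?_, fun u hu x => ?_⟩
    · rintro _ ⟨d, hd, rfl⟩ x
      exact (h₂ x).monotone (he.1 hd)
    · refine (h₂ x hne hD he).2 ?_
      rintro _ ⟨d, hd, rfl⟩
      exact hu ⟨d, hd, rfl⟩ x
  exact this.comp isCtor_fn.scottContinuous

/-! ### Least fixed points -/

theorem isLUB_fix {f : Dom → Dom} (hf : Monotone f) :
    IsLUB (Set.range fun n : ℕ => f^[n] bot) (fix f) := by
  have h := hf.monotone_iterate_of_le_map (bot_le _)
  obtain ⟨y, hy, -⟩ := exists_isLUB_val (Set.range_nonempty _)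
    (directedOn_range.2 h.directed_le)
  exact Classical.epsilon_spec (p := fun x => IsLUB (Set.range fun n : ℕ => f^[n] bot) x) ⟨y, hy⟩

theorem fix_eq {f : Dom → Dom} (hf : ScottContinuous f) : f (fix f) = fix f := by
  have h := hf.monotone.monotone_iterate_of_le_map (bot_le _)
  have hL := isLUB_fix hf.monotone
  have h₂ := hf (Set.range_nonempty _) (directedOn_range.2 h.directed_le) hL
  refine le_antisymm (h₂.2 ?_) (hL.2 ?_)
  · rintro _ ⟨_, ⟨n, rfl⟩, rfl⟩
    exact hL.1 ⟨n + 1, Function.iterate_succ_apply' f n bot⟩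
  · rintro _ ⟨n, rfl⟩
    cases n with
    | zero => exact bot_le _
    | succ n =>
      exact (Function.iterate_succ_apply' f n bot).le.trans (h₂.1 ⟨_, ⟨n, rfl⟩, rfl⟩)

/-- Induction for values of functions that are least fixed points. -/
theorem app_fix_induction {f : Dom → Dom} (hf : Monotone f) {ι : Type*} (x : ι → Dom)
    (S : ι → Set Dom) (hS : ∀ i, IsSubdomain (S i))
    (step : ∀ φ, (∀ i, app φ (x i) ∈ S i) → ∀ i, app (f φ) (x i) ∈ S i) (i : ι) :
    app (fix f) (x i) ∈ S i := by
  have h := hf.monotone_iterate_of_le_map (bot_le _)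
  have key : ∀ n i, app (f^[n] bot) (x i) ∈ S i := by
    intro n
    induction n with
    | zero =>
      intro i
      rw [Function.iterate_zero, id, app_bot]
      exact (hS i).2 ∅ (Set.empty_subset _) _ ⟨fun _ h => h.elim, fun _ _ => bot_le _⟩
    | succ n ih =>
      rw [Function.iterate_succ_apply']
      exact step _ ih
  have hL := scottContinuous_app (E := Dom) ScottContinuous.id (ScottContinuous.const (x i))
    (Set.range_nonempty _) (directedOn_range.2 h.directed_le) (isLUB_fix hf)
  refine (hS i).2 _ ?_ _ hL
  rintro _ ⟨_, ⟨n, rfl⟩, rfl⟩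
  exact key n i

theorem scottContinuous_fix {E : Type*} [Preorder E] {f : E → Dom} (hf : ScottContinuous f) :
    ScottContinuous fun e => fix (f e).app := by
  have hm : ∀ a : Dom, Monotone a.app := fun a =>
    (scottContinuous_app (ScottContinuous.const a) ScottContinuous.id).monotone
  have hn : ∀ n : ℕ, ScottContinuous fun e => (f e).app^[n] bot := fun n => by
    induction n with
    | zero => exact .const _
    | succ n ih =>
      simp only [Function.iterate_succ_apply']
      exact scottContinuous_app hf ih
  intro D hne hD e he
  refine ⟨?_, fun u hu => (isLUB_fix (hm _)).2 ?_⟩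
  · rintro _ ⟨d, hd, rfl⟩
    refine (isLUB_fix (hm _)).2 ?_
    rintro _ ⟨n, rfl⟩
    exact ((hn n).monotone (he.1 hd)).trans ((isLUB_fix (hm _)).1 ⟨n, rfl⟩)
  · rintro _ ⟨n, rfl⟩
    refine (hn n hne hD he).2 ?_
    rintro _ ⟨d, hd, rfl⟩
    exact ((isLUB_fix (hm _)).1 ⟨n, rfl⟩).trans (hu ⟨d, hd, rfl⟩)

end Dom
end CFP

namespace CFP

/-! ### Continuity of the denotation of programs -/

theorem pushL_append {α : Type*} (as bs : List α) (f : ℕ → α) :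
    pushL (as ++ bs) f = pushL as (pushL bs f) := by
  funext i
  simp only [pushL, List.getD_eq_getElem?_getD, List.getElem?_append, List.length_append]
  split_ifs with h
  · rw [List.getElem?_eq_getElem h]; rfl
  · rw [List.getElem?_eq_none (l := as) (by omega), Nat.sub_sub]; rfl

@[simp] theorem pushL_nil {α : Type*} (f : ℕ → α) : pushL [] f = f := rfl

@[simp] theorem pushL_cons {α : Type*} (a : α) (as : List α) (f : ℕ → α) :
    pushL (a :: as) f = push a (pushL as f) := by
  funext i
  cases i with
  | zero => rfl
  | succ i => simp [pushL, push]

@[simp] theorem push_zero {α : Type*} (a : α) (f : ℕ → α) : push a f 0 = a := rfl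
@[simp] theorem push_succ {α : Type*} (a : α) (f : ℕ → α) (i : ℕ) : push a f (i + 1) = f i := rfl
@[simp] theorem push_one {α : Type*} (a : α) (f : ℕ → α) : push a f 1 = f 0 := rfl

open Dom

theorem scottContinuous_pi {E : Type*} [Preorder E] {f : E → ℕ → Dom}
    (h : ∀ i, ScottContinuous fun e => f e i) : ScottContinuous f := by
  intro D hne hD e he
  refine isLUB_pi.2 fun i => ?_
  have := h i hne hD he
  rwa [← Set.image_comp]

theorem scottContinuous_proj {E : Type*} [Preorder E] {f : E → ℕ → Dom} (h : ScottContinuous f)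
    (i : ℕ) : ScottContinuous fun e => f e i := by
  intro D hne hD e he
  have := isLUB_pi.1 (h hne hD he) i
  rwa [← Set.image_comp] at this

theorem scottContinuous_push {E : Type*} [Preorder E] {f : E → ℕ → Dom} {g : E → Dom}
    (hf : ScottContinuous f) (hg : ScottContinuous g) :
    ScottContinuous fun e => push (g e) (f e) :=
  scottContinuous_pi fun
    | 0 => hg
    | i + 1 => scottContinuous_proj hf i

-- Constructor patterns

namespace CPat

/-- The values of the variables of a pattern. -/
def Args : CPat → Type
  | var => Dom
  | nil => PUnit
  | left P => P.Args
  | right P => P.Args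
  | pair P Q => P.Args × Q.Args
  | amb P Q => P.Args × Q.Args

instance instPreorderArgs : ∀ P : CPat, Preorder P.Args
  | var => inferInstanceAs (Preorder Dom)
  | nil => inferInstanceAs (Preorder PUnit)
  | left P => instPreorderArgs P
  | right P => instPreorderArgs P
  | pair P Q =>
    let _ := instPreorderArgs P
    let _ := instPreorderArgs Q
    inferInstanceAs (Preorder (P.Args × Q.Args))
  | amb P Q =>
    let _ := instPreorderArgs P
    let _ := instPreorderArgs Q
    inferInstanceAs (Preorder (P.Args × Q.Args))

/-- The instance of a pattern for given values of its variables. -/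
def build : (P : CPat) → P.Args → Dom
  | var, x => x
  | nil, _ => Dom.nil
  | left P, x => (P.build x).left
  | right P, x => (P.build x).right
  | pair P Q, x => (P.build x.1).pair (Q.build x.2)
  | amb P Q, x => (P.build x.1).amb (Q.build x.2)

def toList : (P : CPat) → P.Args → List Dom
  | var, x => [x]
  | nil, _ => []
  | left P, x => P.toList x
  | right P, x => P.toList x
  | pair P Q, x => P.toList x.1 ++ Q.toList x.2
  | amb P Q, x => P.toList x.1 ++ Q.toList x.2

/-- A pattern is an iterated constructor; case analysis on patterns therefore falls under
`scottContinuous_of_branches`. -/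
theorem isCtor_build : ∀ P : CPat, IsCtor P.build
  | var => IsCtor.id
  | nil => isCtor_nil
  | left P => isCtor_left.comp_left P.isCtor_build
  | right P => isCtor_right.comp_left P.isCtor_build
  | pair P Q => isCtor_pair.comp_pair P.isCtor_build Q.isCtor_build
  | amb P Q => isCtor_amb.comp_pair P.isCtor_build Q.isCtor_build

variable {P Q : CPat} {e e' : List Dom} {d : Dom}

@[simp] theorem matches_var : Matches .var e d ↔ e = [d] :=
  ⟨fun h => by cases h; rfl, fun h => h ▸ .var d⟩

@[simp] theorem matches_nil : Matches .nil e d ↔ e = [] ∧ d = Dom.nil :=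
  ⟨fun h => by cases h; exact ⟨rfl, rfl⟩, fun ⟨h, h'⟩ => h ▸ h' ▸ .nil⟩

@[simp] theorem matches_left : Matches (.left P) e d ↔ ∃ a, d = a.left ∧ P.Matches e a :=
  ⟨fun h => by cases h with | left h => exact ⟨_, rfl, h⟩, fun ⟨_, h, h'⟩ => h ▸ .left h'⟩

@[simp] theorem matches_right : Matches (.right P) e d ↔ ∃ a, d = a.right ∧ P.Matches e a :=
  ⟨fun h => by cases h with | right h => exact ⟨_, rfl, h⟩, fun ⟨_, h, h'⟩ => h ▸ .right h'⟩

@[simp] theorem matches_pair : Matches (.pair P Q) e d ↔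
    ∃ a b u v, d = a.pair b ∧ e = u ++ v ∧ P.Matches u a ∧ Q.Matches v b :=
  ⟨fun h => by cases h with | pair h h' => exact ⟨_, _, _, _, rfl, rfl, h, h'⟩,
    fun ⟨_, _, _, _, h, h', k, k'⟩ => h ▸ h' ▸ .pair k k'⟩

@[simp] theorem matches_amb : Matches (.amb P Q) e d ↔
    ∃ a b u v, d = a.amb b ∧ e = u ++ v ∧ P.Matches u a ∧ Q.Matches v b :=
  ⟨fun h => by cases h with | amb h h' => exact ⟨_, _, _, _, rfl, rfl, h, h'⟩,
    fun ⟨_, _, _, _, h, h', k, k'⟩ => h ▸ h' ▸ .amb k k'⟩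

theorem matches_iff : P.Matches e d ↔ ∃ x, d = P.build x ∧ e = P.toList x := by
  induction P generalizing e d with
  | var => exact ⟨fun h => ⟨d, rfl, matches_var.1 h⟩, fun ⟨x, h, h'⟩ => matches_var.2 (h ▸ h')⟩
  | nil =>
    exact ⟨fun h => ⟨⟨⟩, (matches_nil.1 h).2, (matches_nil.1 h).1⟩,
      fun ⟨x, h, h'⟩ => matches_nil.2 ⟨h', h⟩⟩
  | left P ih =>
    rw [matches_left]
    constructor
    · rintro ⟨a, rfl, h⟩
      obtain ⟨x, rfl, rfl⟩ := ih.1 h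
      exact ⟨x, rfl, rfl⟩
    · rintro ⟨x, rfl, rfl⟩
      exact ⟨_, rfl, ih.2 ⟨x, rfl, rfl⟩⟩
  | right P ih =>
    rw [matches_right]
    constructor
    · rintro ⟨a, rfl, h⟩
      obtain ⟨x, rfl, rfl⟩ := ih.1 h
      exact ⟨x, rfl, rfl⟩
    · rintro ⟨x, rfl, rfl⟩
      exact ⟨_, rfl, ih.2 ⟨x, rfl, rfl⟩⟩
  | pair P Q ih ih' =>
    rw [matches_pair]
    constructor
    · rintro ⟨a, b, u, v, rfl, rfl, h, h'⟩
      obtain ⟨x, rfl, rfl⟩ := ih.1 h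
      obtain ⟨y, rfl, rfl⟩ := ih'.1 h'
      exact ⟨(x, y), rfl, rfl⟩
    · rintro ⟨x, rfl, rfl⟩
      exact ⟨_, _, _, _, rfl, rfl, ih.2 ⟨x.1, rfl, rfl⟩, ih'.2 ⟨x.2, rfl, rfl⟩⟩
  | amb P Q ih ih' =>
    rw [matches_amb]
    constructor
    · rintro ⟨a, b, u, v, rfl, rfl, h, h'⟩
      obtain ⟨x, rfl, rfl⟩ := ih.1 h
      obtain ⟨y, rfl, rfl⟩ := ih'.1 h'
      exact ⟨(x, y), rfl, rfl⟩
    · rintro ⟨x, rfl, rfl⟩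
      exact ⟨_, _, _, _, rfl, rfl, ih.2 ⟨x.1, rfl, rfl⟩, ih'.2 ⟨x.2, rfl, rfl⟩⟩

theorem Matches.unique (h : P.Matches e d) (h' : P.Matches e' d) : e = e' := by
  induction h generalizing e' with
  | var => simp_all
  | nil => simp_all
  | left _ ih => obtain ⟨a, ha, h'⟩ := matches_left.1 h'; exact ih (left_inj.1 ha ▸ h')
  | right _ ih => obtain ⟨a, ha, h'⟩ := matches_right.1 h'; exact ih (right_inj.1 ha ▸ h')
  | pair _ _ ih ih' =>
    obtain ⟨a, b, u, v, hab, rfl, h, h'⟩ := matches_pair.1 h'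
    obtain ⟨rfl, rfl⟩ := pair_inj.1 hab
    rw [ih h, ih' h']
  | amb _ _ ih ih' =>
    obtain ⟨a, b, u, v, hab, rfl, h, h'⟩ := matches_amb.1 h'
    obtain ⟨rfl, rfl⟩ := amb_inj.1 hab
    rw [ih h, ih' h']

theorem scottContinuous_pushL {E : Type*} [Preorder E] :
    ∀ (P : CPat) {f : E → ℕ → Dom} {g : E → P.Args}, ScottContinuous f → ScottContinuous g →
      ScottContinuous fun e => pushL (P.toList (g e)) (f e)
  | var, f, g, hf, hg => by
    have h : (fun e => pushL (var.toList (g e)) (f e)) = fun e => push (g e) (f e) :=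
      funext fun e => pushL_cons (α := Dom) _ _ _
    rw [h]
    exact scottContinuous_push hf hg
  | nil, f, g, hf, hg => hf
  | left P, f, g, hf, hg => P.scottContinuous_pushL hf hg
  | right P, f, g, hf, hg => P.scottContinuous_pushL hf hg
  | pair P Q, f, g, hf, hg => by
    simp only [toList, pushL_append]
    exact P.scottContinuous_pushL (Q.scottContinuous_pushL hf (hg.comp .snd)) (hg.comp .fst)
  | amb P Q, f, g, hf, hg => by
    simp only [toList, pushL_append]
    exact P.scottContinuous_pushL (Q.scottContinuous_pushL hf (hg.comp .snd)) (hg.comp .fst)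

/-- A sufficient condition for two patterns to have no common instance. -/
def disjoint : CPat → CPat → Bool
  | var, _ => false
  | _, var => false
  | nil, nil => false
  | left P, left Q => P.disjoint Q
  | right P, right Q => P.disjoint Q
  | pair P P', pair Q Q' => P.disjoint Q || P'.disjoint Q'
  | amb P P', amb Q Q' => P.disjoint Q || P'.disjoint Q'
  | _, _ => true

theorem not_matches_of_disjoint : ∀ {P Q : CPat} {e e' : List Dom} {d : Dom},
    P.disjoint Q = true → P.Matches e d → Q.Matches e' d → False := by
  intro P Q e e' d hd h h'
  induction h generalizing Q e' with
  | var => simp [disjoint] at hd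
  | nil => cases Q <;> simp [disjoint] at hd h'
  | left _ ih =>
    cases Q <;> simp [disjoint] at hd h'
    exact ih hd h'
  | right _ ih =>
    cases Q <;> simp [disjoint] at hd h'
    exact ih hd h'
  | pair _ _ ih ih' =>
    cases Q <;> simp only [disjoint, Bool.or_eq_true, Bool.false_eq_true] at hd <;>
      try (simp at h'; done)
    obtain ⟨a, b, u, v, hab, -, h, h'⟩ := matches_pair.1 h'
    obtain ⟨rfl, rfl⟩ := pair_inj.1 hab
    exact hd.elim (fun hd => ih hd h) fun hd => ih' hd h'
  | amb _ _ ih ih' =>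
    cases Q <;> simp only [disjoint, Bool.or_eq_true, Bool.false_eq_true] at hd <;>
      try (simp at h'; done)
    obtain ⟨a, b, u, v, hab, -, h, h'⟩ := matches_amb.1 h'
    obtain ⟨rfl, rfl⟩ := amb_inj.1 hab
    exact hd.elim (fun hd => ih hd h) fun hd => ih' hd h'

/-- The syntactic counterpart of `not_matches_of_disjoint`: `Compatible` speaks of programs that
match, the denotation of domain elements that match. -/
theorem not_inst_of_disjoint {P Q : CPat} {θ θ' : List Prog} {M : Prog}
    (hd : P.disjoint Q = true) (h : P.Inst θ M) (h' : Q.Inst θ' M) : False := by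
  induction h generalizing Q θ' with
  | var => simp [disjoint] at hd
  | nil => cases h' <;> simp [disjoint] at hd
  | left _ ih =>
    cases h' with
    | var => simp [disjoint] at hd
    | left h => exact ih hd h
  | right _ ih =>
    cases h' with
    | var => simp [disjoint] at hd
    | right h => exact ih hd h
  | pair _ _ ih ih' =>
    cases h' with
    | var => simp [disjoint] at hd
    | pair h h' =>
      simp only [disjoint, Bool.or_eq_true] at hd
      exact hd.elim (fun hd => ih hd h) fun hd => ih' hd h'
  | amb _ _ ih ih' =>
    cases h' with
    | var => simp [disjoint] at hd
    | amb h h' =>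
      simp only [disjoint, Bool.or_eq_true] at hd
      exact hd.elim (fun hd => ih hd h) fun hd => ih' hd h'

end CPat

@[simp] theorem Pat.matches_con {P : CPat} {e : List Dom} {d : Dom} :
    (Pat.con P).Matches e d ↔ P.Matches e d :=
  ⟨fun h => by cases h; assumption, .con⟩

-- A decidable check for well-formedness and continuity

def Prog.isNil : Prog → Bool
  | .nil => true
  | _ => false

theorem Prog.eq_nil_of_isNil {M : Prog} (h : M.isNil = true) : M = .nil := by
  cases M <;> first | rfl | cases h

/-- The clauses of the list have constructor patterns that are disjoint from `P`, except for
clauses with result `Nil` in case `N` is `Nil`. -/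
def Clauses.okWith (P : CPat) (N : Prog) : Clauses → Bool
  | .nil => true
  | .cons (.con P') N' C => (P.disjoint P' || (N.isNil && N'.isNil)) && C.okWith P N
  | .cons .fn _ _ => false

mutual
/-- A decidable sufficient condition for well-formedness and continuity. -/
def Prog.ok : Prog → ℕ → Bool
  | .var i, n => decide (i < n)
  | .nil, _ => true
  | .left M, n => M.ok n
  | .right M, n => M.ok n
  | .pair M N, n => M.ok n && N.ok n
  | .amb M N, n => M.ok n && N.ok n
  | .case M C, n => M.ok n && C.ok n
  | .lam M, n => M.ok (n + 1)
  | .app M N, n => M.ok n && N.ok n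
  | .recur M, n => M.ok n
  | .bot, _ => true
def Clauses.ok : Clauses → ℕ → Bool
  | .nil, _ => true
  | .cons (.con P) N C, n => N.ok (n + P.arity) && C.okWith P N && C.ok n
  | .cons .fn _ _, _ => false
end

theorem Clauses.compatibleWith_of_okWith {P : CPat} {N : Prog} :
    ∀ {C : Clauses}, C.okWith P N = true → C.CompatibleWith (.con P) N
  | .nil, _ => trivial
  | .cons (.con P') N' C, h => by
    simp only [okWith, Bool.and_eq_true, Bool.or_eq_true] at h
    refine ⟨?_, compatibleWith_of_okWith h.2⟩
    rintro θ θ' M ⟨h₁⟩ ⟨h₂⟩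
    rcases h.1 with h | h
    · exact (CPat.not_inst_of_disjoint h h₁ h₂).elim
    · rw [Prog.eq_nil_of_isNil h.1, Prog.eq_nil_of_isNil h.2]
      rfl
  | .cons .fn _ _, h => by simp [okWith] at h

mutual
theorem Prog.wf_of_ok : ∀ {M : Prog} {n : ℕ}, M.ok n = true → M.WF n
  | .var i, n, h => by simpa [Prog.ok, Prog.WF] using h
  | .nil, _, _ => by simp [Prog.WF]
  | .left M, n, h => by
    rw [Prog.ok] at h; rw [Prog.WF]; exact M.wf_of_ok h
  | .right M, n, h => by
    rw [Prog.ok] at h; rw [Prog.WF]; exact M.wf_of_ok h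
  | .pair M N, n, h => by
    rw [Prog.ok, Bool.and_eq_true] at h; rw [Prog.WF]; exact ⟨M.wf_of_ok h.1, N.wf_of_ok h.2⟩
  | .amb M N, n, h => by
    rw [Prog.ok, Bool.and_eq_true] at h; rw [Prog.WF]; exact ⟨M.wf_of_ok h.1, N.wf_of_ok h.2⟩
  | .case M C, n, h => by
    rw [Prog.ok, Bool.and_eq_true] at h; rw [Prog.WF]; exact ⟨M.wf_of_ok h.1, C.wf_of_ok h.2⟩
  | .lam M, n, h => by
    rw [Prog.ok] at h; rw [Prog.WF]; exact M.wf_of_ok h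
  | .app M N, n, h => by
    rw [Prog.ok, Bool.and_eq_true] at h; rw [Prog.WF]; exact ⟨M.wf_of_ok h.1, N.wf_of_ok h.2⟩
  | .recur M, n, h => by
    rw [Prog.ok] at h; rw [Prog.WF]; exact M.wf_of_ok h
  | .bot, _, _ => by simp [Prog.WF]
theorem Clauses.wf_of_ok : ∀ {C : Clauses} {n : ℕ}, C.ok n = true → C.WF n
  | .nil, _, _ => by simp [Clauses.WF]
  | .cons (.con P) N C, n, h => by
    simp only [Clauses.ok, Bool.and_eq_true] at h
    rw [Clauses.WF]
    exact ⟨N.wf_of_ok h.1.1, Clauses.compatibleWith_of_okWith h.1.2, C.wf_of_ok h.2⟩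
  | .cons .fn _ _, _, h => by simp [Clauses.ok] at h
end

namespace Clauses

theorem den_nil (η : ℕ → Dom) (d : Dom) : Clauses.nil.den η d = Dom.bot := by
  simp only [Clauses.den]

theorem den_cons_of_matches {P : CPat} {N : Prog} {C : Clauses} {η : ℕ → Dom} {d : Dom}
    {e : List Dom} (h : P.Matches e d) :
    (cons (.con P) N C).den η d = N.den (pushL e η) := by
  have h' : ∃ e, (Pat.con P).Matches e d := ⟨e, .con h⟩
  rw [Clauses.den, dif_pos h', (Pat.matches_con.1 h'.choose_spec).unique h]

theorem den_cons_of_not_matches {P : CPat} {N : Prog} {C : Clauses} {η : ℕ → Dom} {d : Dom}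
    (h : ∀ e, ¬P.Matches e d) : (cons (.con P) N C).den η d = C.den η d := by
  rw [Clauses.den, dif_neg]
  rintro ⟨e, he⟩
  exact h e (Pat.matches_con.1 he)

theorem den_cons_mem {P : CPat} {N : Prog} {C : Clauses} {η : ℕ → Dom} {d : Dom} {S : Set Dom}
    (h : ∀ e, P.Matches e d → N.den (pushL e η) ∈ S) (h' : C.den η d ∈ S) :
    (cons (.con P) N C).den η d ∈ S := by
  by_cases hm : ∃ e, P.Matches e d
  · obtain ⟨e, he⟩ := hm
    rw [den_cons_of_matches he]
    exact h e he
  · push Not at hm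
    rwa [den_cons_of_not_matches hm]

/-- The clauses with constructor patterns of a list. -/
def toSet : Clauses → Set (CPat × Prog)
  | nil => ∅
  | cons (.con P) N C => insert (P, N) C.toSet
  | cons .fn _ C => C.toSet

theorem okWith_mem {P P' : CPat} {N N' : Prog} : ∀ {C : Clauses}, C.okWith P N = true →
    (P', N') ∈ C.toSet → P.disjoint P' = true ∨ N = .nil ∧ N' = .nil
  | .cons (.con Q) M C, h, hm => by
    simp only [okWith, Bool.and_eq_true, Bool.or_eq_true] at h
    rcases hm with hm | hm
    · obtain ⟨rfl, rfl⟩ := Prod.mk.inj hm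
      exact h.1.imp id fun h => ⟨Prog.eq_nil_of_isNil h.1, Prog.eq_nil_of_isNil h.2⟩
    · exact okWith_mem h.2 hm
  | .cons .fn _ _, h, _ => by simp [okWith] at h

/-- The denotation takes the first matching clause, but any matching clause gives the same value: an
earlier one is either disjoint from it, which is impossible, or both results are `Nil`. -/
theorem den_of_mem {η : ℕ → Dom} {d : Dom} {P : CPat} {N : Prog} {e : List Dom}
    (he : P.Matches e d) : ∀ {C : Clauses} {n : ℕ}, C.ok n = true → (P, N) ∈ C.toSet →
    C.den η d = N.den (pushL e η)
  | .cons (.con Q) M C, n, h, hm => by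
    simp only [ok, Bool.and_eq_true] at h
    rcases hm with hm | hm
    · obtain ⟨rfl, rfl⟩ := Prod.mk.inj hm
      exact den_cons_of_matches he
    · by_cases hQ : ∃ e', Q.Matches e' d
      · obtain ⟨e', he'⟩ := hQ
        rw [den_cons_of_matches he']
        rcases okWith_mem h.1.2 hm with h | ⟨rfl, rfl⟩
        · exact (CPat.not_matches_of_disjoint h he' he).elim
        · simp only [Prog.den]
      · push Not at hQ
        rw [den_cons_of_not_matches hQ]
        exact den_of_mem he h.2 hm
  | .cons .fn _ _, _, h, _ => by simp [ok] at h

theorem den_of_forall_not_matches {η : ℕ → Dom} {d : Dom} : ∀ {C : Clauses} {n : ℕ},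
    C.ok n = true → (∀ P N, (P, N) ∈ C.toSet → ∀ e, ¬P.Matches e d) → C.den η d = Dom.bot
  | .nil, _, _, _ => den_nil η d
  | .cons (.con Q) M C, n, h, hm => by
    simp only [ok, Bool.and_eq_true] at h
    rw [den_cons_of_not_matches (hm Q M (Or.inl rfl))]
    exact den_of_forall_not_matches h.2 fun P N hPN => hm P N (Or.inr hPN)
  | .cons .fn _ _, _, h, _ => by simp [ok] at h

/-- The branches are indexed by the clauses themselves. They may overlap, since `den_of_mem` gives
the right value on every branch that applies. -/
theorem scottContinuous_den {C : Clauses} {n : ℕ} (hok : C.ok n = true)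
    (hC : ∀ P N, (P, N) ∈ C.toSet → ScottContinuous N.den) {E : Type*} [Preorder E]
    {f : E → ℕ → Dom} {g : E → Dom} (hf : ScottContinuous f) (hg : ScottContinuous g) :
    ScottContinuous fun e => C.den (f e) (g e) := by
  refine scottContinuous_of_branches (ι := C.toSet) (fun i => i.1.1.isCtor_build) hg
    (G := fun i p => i.1.2.den (pushL (i.1.1.toList p.2) (f p.1))) (fun i => ?_) ?_ ?_
  · exact (i.1.1.scottContinuous_pushL (ScottContinuous.fst.comp hf) .snd).comp (hC _ _ i.2)
  · intro i e x h
    exact den_of_mem (CPat.matches_iff.2 ⟨x, h, rfl⟩) hok i.2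
  · intro e h
    refine den_of_forall_not_matches hok fun P N hPN l hl => ?_
    obtain ⟨x, hx, -⟩ := CPat.matches_iff.1 hl
    exact h ⟨(P, N), hPN⟩ x hx

end Clauses

mutual
theorem Prog.scottContinuous_den : ∀ {M : Prog} {n : ℕ}, M.ok n = true → ScottContinuous M.den
  | .var i, _, _ => by
    simp only [funext fun η => Prog.den.eq_1 η i]
    exact scottContinuous_proj ScottContinuous.id i
  | .nil, _, _ => by
    rw [show Prog.nil.den = _ from funext fun η => Prog.den.eq_2 η]; exact .const _
  | .left M, n, h => by
    rw [Prog.ok] at h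
    rw [show (Prog.left M).den = _ from funext fun η => Prog.den.eq_3 η M]
    exact (M.scottContinuous_den h).comp isCtor_left.scottContinuous
  | .right M, n, h => by
    rw [Prog.ok] at h
    rw [show (Prog.right M).den = _ from funext fun η => Prog.den.eq_4 η M]
    exact (M.scottContinuous_den h).comp isCtor_right.scottContinuous
  | .pair M N, n, h => by
    rw [Prog.ok, Bool.and_eq_true] at h
    rw [show (Prog.pair M N).den = _ from funext fun η => Prog.den.eq_5 η M N]
    exact ((M.scottContinuous_den h.1).prodMk (N.scottContinuous_den h.2)).comp
      isCtor_pair.scottContinuous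
  | .amb M N, n, h => by
    rw [Prog.ok, Bool.and_eq_true] at h
    rw [show (Prog.amb M N).den = _ from funext fun η => Prog.den.eq_6 η M N]
    exact ((M.scottContinuous_den h.1).prodMk (N.scottContinuous_den h.2)).comp
      isCtor_amb.scottContinuous
  | .case M C, n, h => by
    rw [Prog.ok, Bool.and_eq_true] at h
    rw [show (Prog.case M C).den = _ from funext fun η => Prog.den.eq_7 η M C]
    exact Clauses.scottContinuous_den h.2 (C.scottContinuous_den_of_mem h.2) ScottContinuous.id
      (M.scottContinuous_den h.1)
  | .lam M, n, h => by
    rw [Prog.ok] at h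
    rw [show (Prog.lam M).den = _ from funext fun η => Prog.den.eq_8 η M]
    exact scottContinuous_fn
      ((scottContinuous_push ScottContinuous.fst ScottContinuous.snd).comp (M.scottContinuous_den h))
  | .app M N, n, h => by
    rw [Prog.ok, Bool.and_eq_true] at h
    rw [show (Prog.app M N).den = _ from funext fun η => Prog.den.eq_9 η M N]
    exact scottContinuous_app (M.scottContinuous_den h.1) (N.scottContinuous_den h.2)
  | .recur M, n, h => by
    rw [Prog.ok] at h
    rw [show (Prog.recur M).den = _ from funext fun η => Prog.den.eq_10 η M]
    exact scottContinuous_fix (M.scottContinuous_den h)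
  | .bot, _, _ => by
    rw [show Prog.bot.den = _ from funext fun η => Prog.den.eq_11 η]; exact .const _
theorem Clauses.scottContinuous_den_of_mem : ∀ {C : Clauses} {n : ℕ}, C.ok n = true →
    ∀ P N, (P, N) ∈ C.toSet → ScottContinuous N.den
  | .cons (.con Q) M C, n, h, P, N, hm => by
    simp only [Clauses.ok, Bool.and_eq_true] at h
    rcases hm with hm | hm
    · obtain ⟨rfl, rfl⟩ := Prod.mk.inj hm
      exact N.scottContinuous_den h.1.1
    · exact C.scottContinuous_den_of_mem h.2 P N hm
  | .cons .fn _ _, _, h, _, _, _ => by simp [Clauses.ok] at h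
end

end CFP

namespace CFP
open Dom

/-! ### Types and realisers of the two predicates -/

def sgnT : Set Dom := sumT oneT oneT

def digT : Set Dom := sumT sgnT oneT

/-- The type of iterated concurrent computations of elements of `T`. -/
def starT (T : Set Dom) : Set Dom := fixT fun Z => ambT (sumT T Z)

def sdT : Set Dom := fixT fun S => starT (prodT digT S)

def gcT : Set Dom := fixT fun S => prodT (starT sgnT) S

/-- The realisers of a concurrent computation: `R` describes the realisers of the results. -/
def AmbR (T : Set Dom) (R : Dom → Prop) (c : Dom) : Prop :=
  ∃ a b, c = amb a b ∧ a ∈ T ∧ b ∈ T ∧ (a ≠ Dom.bot ∨ b ≠ Dom.bot) ∧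
    (a ≠ Dom.bot → R a) ∧ (b ≠ Dom.bot → R b)

def SumR (R Z : Dom → Prop) (c : Dom) : Prop :=
  (∃ a, c = left a ∧ R a) ∨ ∃ b, c = right b ∧ Z b

/-- The realisers of an iterated concurrent computation. -/
def StarR (T : Set Dom) (R : Dom → Prop) (c : Dom) : Prop :=
  lfpP (fun Z => AmbR (sumT T (starT T)) (SumR R Z)) c

/-- The realisers of `x ≤ 0 ∨ x ≥ 0`. -/
def SgnR (x : ℝ) (a : Dom) : Prop :=
  a = left Dom.nil ∧ x ≤ 0 ∨ a = right Dom.nil ∧ 0 ≤ x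

/-- The realisers of `SD(d)`. -/
def DigR (d : ℝ) (a : Dom) : Prop :=
  (a = left (left Dom.nil) ∧ d = -1 ∨ a = left (right Dom.nil) ∧ d = 1) ∨
    a = right Dom.nil ∧ d = 0

def SBody (Q : ℝ → Dom → Prop) (x : ℝ) (p : Dom) : Prop :=
  ∃ d a b, p = pair a b ∧ DigR d a ∧ |2 * x - d| ≤ 1 ∧ Q (2 * x - d) b

def SReal (x : ℝ) (a : Dom) : Prop :=
  gfpP (fun (Q : ℝ × Dom → Prop) p =>
    StarR (prodT digT sdT) (SBody (fun y b => Q (y, b)) p.1) p.2) (x, a)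

def GReal (x : ℝ) (a : Dom) : Prop :=
  gfpP (fun (Q : ℝ × Dom → Prop) p => (-1 ≤ p.1 ∧ p.1 ≤ 1) ∧ ∃ d g, p.2 = pair d g ∧
    (d ∈ starT sgnT ∧ (p.1 ≠ 0 → StarR sgnT (SgnR p.1) d)) ∧ Q (1 - 2 * |p.1|, g)) (x, a)

/-- Fixed points of formulas range over argument lists, while the predicates of interest have one
real argument. -/
theorem gfpP_singleton {T : (List ℝ × Dom → Prop) → List ℝ × Dom → Prop}
    {T' : (ℝ × Dom → Prop) → ℝ × Dom → Prop}
    (h : ∀ Q x b, T Q ([x], b) ↔ T' (fun p => Q ([p.1], p.2)) (x, b)) (x : ℝ) (a : Dom) :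
    gfpP T ([x], a) ↔ gfpP T' (x, a) := by
  constructor
  · rintro ⟨Q, hQ, hx⟩
    exact ⟨fun p => Q ([p.1], p.2), fun p hp => (h Q p.1 p.2).1 (hQ _ hp), hx⟩
  · rintro ⟨Q, hQ, hx⟩
    -- A post-fixed predicate is extended by falsity to lists of other lengths.
    refine ⟨fun p => ∃ y, p.1 = [y] ∧ Q (y, p.2), ?_, x, rfl, hx⟩
    rintro ⟨_, b⟩ ⟨y, rfl, hy⟩
    refine (h _ y b).2 ?_
    have : (fun p : ℝ × Dom => ∃ z, [p.1] = [z] ∧ Q (z, p.2)) = Q := by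
      funext p
      simp
    rw [this]
    exact hQ _ hy

theorem lfpP_empty {T : (List ℝ × Dom → Prop) → List ℝ × Dom → Prop}
    {T' : (Dom → Prop) → Dom → Prop}
    (h : ∀ Q b, T Q ([], b) ↔ T' (fun c => Q ([], c)) b) (a : Dom) :
    lfpP T ([], a) ↔ lfpP T' a := by
  constructor
  · intro H Q hQ
    -- Dually, a closed predicate is extended by truth to the nonempty lists.
    refine H (fun p => p.1 = [] → Q p.2) ?_ rfl
    rintro ⟨_, b⟩ hb rfl
    have := (h _ b).1 hb
    simp only [forall_const] at this
    exact hQ b this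
  · intro H Q hQ
    exact H (fun c => Q ([], c)) fun b hb => hQ _ ((h Q b).2 hb)

theorem typ_SStar (t : Tm) (ζ : ℕ → Set Dom) : (SStar t).typ (fun _ => false) ζ = sdT := by
  simp [SStar, Fm.concStar, Fm.typ, Fm.harrop, Fm.pshift, SD, II, push, sdT, starT, digT, sgnT]

theorem typ_GStar (t : Tm) (ζ : ℕ → Set Dom) : (GStar t).typ (fun _ => false) ζ = gcT := by
  simp [GStar, DStar, Fm.neg, Fm.bot, Fm.concStar, Fm.typ, Fm.harrop, Fm.pshift, push, gcT, starT, sgnT]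

theorem exists_left_or {a : Dom} {p q : Prop} :
    (∃ b, a = left b ∧ (b = left Dom.nil ∧ p ∨ b = right Dom.nil ∧ q)) ↔
      a = left (left Dom.nil) ∧ p ∨ a = left (right Dom.nil) ∧ q := by
  constructor
  · rintro ⟨b, rfl, ⟨rfl, h⟩ | ⟨rfl, h⟩⟩
    exacts [Or.inl ⟨rfl, h⟩, Or.inr ⟨rfl, h⟩]
  · rintro (⟨rfl, h⟩ | ⟨rfl, h⟩)
    exacts [⟨_, rfl, Or.inl ⟨rfl, h⟩⟩, ⟨_, rfl, Or.inr ⟨rfl, h⟩⟩]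

theorem real_SStar (t : Tm) (ζ ρ η a) :
    (SStar t).real (fun _ => false) ζ ρ η a ↔ SReal (t.eval η) a := by
  have ht := typ_SStar t ζ
  rw [SStar] at ht ⊢
  rw [Fm.real, if_neg (by simp [Fm.concStar, Fm.harrop]), ht]
  refine gfpP_singleton (fun Q x b => ?_) _ _
  rw [Fm.concStar, Fm.real, if_neg (by simp [Fm.harrop])]
  refine lfpP_empty (fun Z c => ?_) _
  simp [AmbR, SumR, Fm.real, Fm.typ, Fm.harrop, Fm.pshift, SD, II, push, SBody, DigR, starT, digT,
    sgnT, Tm.eval, Tm.sub, Tm.two, exists_left_or, ← sub_eq_add_neg]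

theorem real_concStar_sgn (κ ζ ρ) (η : ℕ → ℝ) (a) :
    (Fm.concStar (.or (.le (.var 0) (.const 0)) (.le (.const 0) (.var 0)))).real κ ζ ρ η a ↔
      StarR sgnT (SgnR (η 0)) a := by
  rw [Fm.concStar, Fm.real, if_neg (by simp [Fm.harrop])]
  refine lfpP_empty (fun Z c => ?_) _
  simp [AmbR, SumR, Fm.real, Fm.typ, Fm.harrop, Fm.pshift, push, SgnR, starT, sgnT, Tm.eval]

theorem real_DStar (ζ ρ) (η : ℕ → ℝ) (κ) (a) :
    (DStar (.var 0)).real κ ζ ρ η a ↔ a ∈ starT sgnT ∧ (η 0 ≠ 0 → StarR sgnT (SgnR (η 0)) a) := by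
  -- This is the unfolding of falsity: the empty predicate is closed under the identity operator.
  have hl : lfpP (fun (Q : List ℝ → Prop) _ => Q []) [] ↔ False :=
    ⟨fun h => h (fun _ => False) fun _ h => h, False.elim⟩
  rw [DStar, Fm.real, if_neg (by simp [Fm.concStar, Fm.harrop]),
    if_pos (by simp [Fm.neg, Fm.bot, Fm.harrop, push]), real_concStar_sgn]
  simp [Fm.neg, Fm.bot, Fm.harrop, push, Fm.real, Fm.concStar, Fm.typ, Fm.pshift, starT, sgnT,
    Tm.eval, hl]

theorem real_GStar (t : Tm) (ζ ρ η a) :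
    (GStar t).real (fun _ => false) ζ ρ η a ↔ GReal (t.eval η) a := by
  have ht := typ_GStar t ζ
  have hD : ∀ κ, (DStar (.var 0)).harrop κ = false := fun κ => by
    simp [DStar, Fm.concStar, Fm.harrop]
  rw [GStar] at ht ⊢
  rw [Fm.real, if_neg (by simp [hD, Fm.harrop]), ht]
  refine gfpP_singleton (fun Q x b => ?_) _ _
  simp [hD, Fm.harrop, Fm.real, real_DStar, push, Tm.eval, Tm.sub, Tm.two, Tm.tent,
    ← sub_eq_add_neg]

/-- The realisers of the inclusion of unary predicates with non-Harrop bodies. -/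
theorem realises_incl_one {P Q : Fm} {S T : Set Dom} {R R' : ℝ → Dom → Prop} {a : Dom}
    (hP : P.harrop (fun _ => false) = false) (hQ : Q.harrop (fun _ => false) = false)
    (hS : ∀ ζ, P.typ (fun _ => false) ζ = S) (hT : ∀ ζ, Q.typ (fun _ => false) ζ = T)
    (hR : ∀ ζ ρ η b, P.real (fun _ => false) ζ ρ η b ↔ R (η 0) b)
    (hR' : ∀ ζ ρ η b, Q.real (fun _ => false) ζ ρ η b ↔ R' (η 0) b) :
    Realises a (.incl 1 P Q) ↔ a ∈ funT S T ∧ ∀ x b, R x b → R' x (a.app b) := by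
  simp only [Realises, Fm.incl, Fm.alls, Fm.real, hP, hQ, hS, hT, hR, hR', push_zero,
    Bool.false_eq_true, if_false]
  exact ⟨fun h => ⟨(h 0).1, fun x => (h x).2⟩, fun h x => ⟨h.1, h.2 x⟩⟩

theorem harrop_SStar (t : Tm) : (SStar t).harrop (fun _ => false) = false := by
  simp [SStar, Fm.concStar, Fm.harrop]

theorem harrop_GStar (t : Tm) : (GStar t).harrop (fun _ => false) = false := by
  simp [GStar, DStar, Fm.concStar, Fm.harrop]

/-! ### Types -/

theorem isSubdomain_fixT (φ : Set Dom → Set Dom) : IsSubdomain (fixT φ) :=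
  ⟨fun _ _ hba ha S hS => hS.1.1 hba (ha S hS),
    fun U hU x hx S hS => hS.1.2 U (fun _ hu => hU hu S hS) x hx⟩

theorem fixT_closed {φ : Set Dom → Set Dom} (hφ : Monotone φ) : φ (fixT φ) ⊆ fixT φ :=
  fun _ ha _ hS => hS.2 (hφ (Set.sInter_subset_of_mem hS) ha)

theorem fixT_mono {φ ψ : Set Dom → Set Dom} (h : ∀ S, φ S ⊆ ψ S) : fixT φ ⊆ fixT ψ :=
  fun _ ha S hS => ha S ⟨hS.1, (h S).trans hS.2⟩

theorem bot_mem_fixT (φ : Set Dom → Set Dom) : Dom.bot ∈ fixT φ :=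
  (isSubdomain_fixT φ).2 ∅ (Set.empty_subset _) _ ⟨fun _ h => h.elim, fun _ _ => Dom.bot_le _⟩

theorem ambT_mono : Monotone ambT := by
  rintro S S' h _ (rfl | ⟨a, ha, b, hb, rfl⟩)
  exacts [Or.inl rfl, Or.inr ⟨a, h ha, b, h hb, rfl⟩]

theorem sumT_mono {S S' T T' : Set Dom} (h : S ⊆ S') (h' : T ⊆ T') : sumT S T ⊆ sumT S' T' := by
  rintro _ (rfl | ⟨a, ha, rfl⟩ | ⟨a, ha, rfl⟩)
  exacts [Or.inl rfl, Or.inr (Or.inl ⟨a, h ha, rfl⟩), Or.inr (Or.inr ⟨a, h' ha, rfl⟩)]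

theorem prodT_mono {S S' T T' : Set Dom} (h : S ⊆ S') (h' : T ⊆ T') :
    prodT S T ⊆ prodT S' T' := by
  rintro _ (rfl | ⟨a, ha, b, hb, rfl⟩)
  exacts [Or.inl rfl, Or.inr ⟨a, h ha, b, h' hb, rfl⟩]

theorem starT_mono : Monotone starT := fun _ _ h =>
  fixT_mono fun _ => ambT_mono (sumT_mono h subset_rfl)

theorem amb_mem_starT {T : Set Dom} {a b : Dom} (ha : a ∈ sumT T (starT T))
    (hb : b ∈ sumT T (starT T)) : amb a b ∈ starT T :=
  fixT_closed (φ := fun Z => ambT (sumT T Z)) (fun _ _ h => ambT_mono (sumT_mono subset_rfl h))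
    (Or.inr ⟨a, ha, b, hb, rfl⟩)

theorem mem_sdT {a : Dom} (ha : a ∈ starT (prodT digT sdT)) : a ∈ sdT :=
  fixT_closed (φ := fun S => starT (prodT digT S))
    (fun _ _ h => starT_mono (prodT_mono subset_rfl h)) ha

theorem pair_mem_gcT {a b : Dom} (ha : a ∈ starT sgnT) (hb : b ∈ gcT) : pair a b ∈ gcT :=
  fixT_closed (φ := fun S => prodT (starT sgnT) S)
    (fun _ _ h => prodT_mono subset_rfl h) (Or.inr ⟨a, ha, b, hb, rfl⟩)

theorem bot_mem_sumT (S T : Set Dom) : Dom.bot ∈ sumT S T := Or.inl rfl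
theorem left_mem_sumT {S T : Set Dom} {a : Dom} (h : a ∈ S) : left a ∈ sumT S T :=
  Or.inr (Or.inl ⟨a, h, rfl⟩)
theorem right_mem_sumT {S T : Set Dom} {a : Dom} (h : a ∈ T) : right a ∈ sumT S T :=
  Or.inr (Or.inr ⟨a, h, rfl⟩)
theorem pair_mem_prodT {S T : Set Dom} {a b : Dom} (h : a ∈ S) (h' : b ∈ T) :
    pair a b ∈ prodT S T := Or.inr ⟨a, h, b, h', rfl⟩

theorem leftNil_mem_sgnT : left Dom.nil ∈ sgnT := left_mem_sumT (Or.inr rfl)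
theorem rightNil_mem_sgnT : right Dom.nil ∈ sgnT := right_mem_sumT (Or.inr rfl)

theorem DigR.mem_digT {d : ℝ} {a : Dom} (h : DigR d a) : a ∈ digT := by
  rcases h with (⟨rfl, -⟩ | ⟨rfl, -⟩) | ⟨rfl, -⟩
  exacts [left_mem_sumT leftNil_mem_sgnT, left_mem_sumT rightNil_mem_sgnT,
    right_mem_sumT (Or.inr rfl)]

/-! ### Unfolding the fixed points -/

theorem SumR.mono {R R' Z Z' : Dom → Prop} (h : ∀ a, R a → R' a) (h' : ∀ a, Z a → Z' a) {c : Dom}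
    (hc : SumR R Z c) : SumR R' Z' c := by
  rcases hc with ⟨a, rfl, ha⟩ | ⟨b, rfl, hb⟩
  exacts [Or.inl ⟨a, rfl, h a ha⟩, Or.inr ⟨b, rfl, h' b hb⟩]

theorem AmbR.mono {T : Set Dom} {R R' : Dom → Prop} (h : ∀ a, R a → R' a) {c : Dom}
    (hc : AmbR T R c) : AmbR T R' c := by
  obtain ⟨a, b, rfl, ha, hb, h₁, h₂, h₃⟩ := hc
  exact ⟨a, b, rfl, ha, hb, h₁, fun k => h a (h₂ k), fun k => h b (h₃ k)⟩

theorem StarR.fold {T : Set Dom} {R : Dom → Prop} {c : Dom}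
    (h : AmbR (sumT T (starT T)) (SumR R (StarR T R)) c) : StarR T R c :=
  fun Q hQ => hQ c (h.mono fun _ ha => ha.mono (fun _ h => h) fun _ hz => hz Q hQ)

/-- The least fixed point is tested against the conjunction with `StarR` itself, so the induction
hypothesis still knows that the subtrees are realisers. Unfolding is then a special case. -/
theorem StarR.induction {T : Set Dom} {R Q : Dom → Prop} {c : Dom} (h : StarR T R c)
    (step : ∀ c, AmbR (sumT T (starT T)) (SumR R fun z => StarR T R z ∧ Q z) c → Q c) : Q c := by
  refine (h (fun z => StarR T R z ∧ Q z) fun c hc => ⟨StarR.fold ?_, step c hc⟩).2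
  exact hc.mono fun _ ha => ha.mono (fun _ h => h) fun _ h => h.1

theorem StarR.unfold {T : Set Dom} {R : Dom → Prop} {c : Dom} (h : StarR T R c) :
    AmbR (sumT T (starT T)) (SumR R (StarR T R)) c :=
  h.induction fun _ hc => hc.mono fun _ ha => ha.mono (fun _ h => h) fun _ h => h.1

theorem StarR.mono {T : Set Dom} {R R' : Dom → Prop} (hR : ∀ a, R a → R' a) {c : Dom}
    (h : StarR T R c) : StarR T R' c :=
  h.induction fun _ hc => .fold (hc.mono fun _ ha => ha.mono hR fun _ h => h.2)

theorem StarR.mem_starT {T : Set Dom} {R : Dom → Prop} {c : Dom} (h : StarR T R c) :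
    c ∈ starT T := by
  obtain ⟨a, b, rfl, ha, hb, -⟩ := h.unfold
  exact amb_mem_starT ha hb

theorem SBody.mono {Q Q' : ℝ → Dom → Prop} (h : ∀ x a, Q x a → Q' x a) {x : ℝ} {p : Dom}
    (hp : SBody Q x p) : SBody Q' x p := by
  obtain ⟨d, a, b, rfl, hd, hx, hb⟩ := hp
  exact ⟨d, a, b, rfl, hd, hx, h _ _ hb⟩

theorem SReal.coinduction (Q : ℝ → Dom → Prop)
    (hQ : ∀ x a, Q x a → StarR (prodT digT sdT) (SBody Q x) a) {x : ℝ} {a : Dom} (h : Q x a) :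
    SReal x a :=
  ⟨fun p => Q p.1 p.2, fun p hp => hQ p.1 p.2 hp, h⟩

theorem SReal.unfold {x : ℝ} {a : Dom} (h : SReal x a) :
    StarR (prodT digT sdT) (SBody SReal x) a := by
  obtain ⟨Q, hQ, hx⟩ := h
  exact (hQ _ hx).mono fun _ hp => hp.mono fun y b hy => ⟨Q, hQ, hy⟩

theorem SReal.mem_sdT {x : ℝ} {a : Dom} (h : SReal x a) : a ∈ sdT :=
  CFP.mem_sdT h.unfold.mem_starT

theorem GReal.coinduction (Q : ℝ → Dom → Prop)
    (hQ : ∀ x a, Q x a → (-1 ≤ x ∧ x ≤ 1) ∧ ∃ d g, a = pair d g ∧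
      (d ∈ starT sgnT ∧ (x ≠ 0 → StarR sgnT (SgnR x) d)) ∧ Q (1 - 2 * |x|) g) {x : ℝ} {a : Dom}
    (h : Q x a) : GReal x a :=
  ⟨fun p => Q p.1 p.2, fun p hp => hQ p.1 p.2 hp, h⟩

theorem GReal.unfold {x : ℝ} {a : Dom} (h : GReal x a) : (-1 ≤ x ∧ x ≤ 1) ∧ ∃ d g, a = pair d g ∧
    (d ∈ starT sgnT ∧ (x ≠ 0 → StarR sgnT (SgnR x) d)) ∧ GReal (1 - 2 * |x|) g := by
  obtain ⟨Q, hQ, hx⟩ := h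
  obtain ⟨h₁, d, g, h₂, h₃, h₄⟩ := hQ _ hx
  exact ⟨h₁, d, g, h₂, h₃, Q, hQ, h₄⟩

/-- The unfolding of the greatest fixed point is itself post-fixed, hence contained in it. -/
theorem GReal.fold {x : ℝ} {d g : Dom} (h : -1 ≤ x ∧ x ≤ 1)
    (h' : d ∈ starT sgnT ∧ (x ≠ 0 → StarR sgnT (SgnR x) d)) (hg : GReal (1 - 2 * |x|) g) :
    GReal x (pair d g) := by
  refine coinduction (fun x a => (-1 ≤ x ∧ x ≤ 1) ∧ ∃ d g, a = pair d g ∧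
    (d ∈ starT sgnT ∧ (x ≠ 0 → StarR sgnT (SgnR x) d)) ∧ GReal (1 - 2 * |x|) g) ?_
    ⟨h, d, g, rfl, h', hg⟩
  rintro x a ⟨h₁, d, g, h₂, h₃, h₄⟩
  exact ⟨h₁, d, g, h₂, h₃, h₄.unfold⟩

end CFP

namespace CFP
open Dom
open Prog hiding var nil left right pair amb app bot

/-! ### Programs -/

theorem Dom.scottContinuous_app_right (a : Dom) : ScottContinuous a.app :=
  scottContinuous_app (f := fun _ : Dom => a) (g := fun x => x) (.const a) .id

/-- Continuity, guaranteed by `ok`, makes both abstractions genuine functions and the recursion a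
fixed point. In `M` the variable 0 is the argument and 1 the recursive call. -/
theorem den_recur_lam_lam {M : Prog} {n : ℕ} (h : (recur (lam (lam M))).ok n = true)
    (η : ℕ → Dom) (s : Dom) : ((recur (lam (lam M))).den η).app s =
      M.den (push s (push ((recur (lam (lam M))).den η) η)) := by
  have h₁ : (lam M).ok (n + 1) = true := by simpa only [ok] using h
  have h₂ : M.ok (n + 2) = true := by simpa only [ok] using h
  have c₁ : ScottContinuous fun d => (lam M).den (push d η) :=
    (scottContinuous_push (.const η) .id).comp (scottContinuous_den h₁)
  have c₂ : ∀ φ, ScottContinuous fun d => M.den (push d (push φ η)) := fun φ =>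
    (scottContinuous_push (.const _) .id).comp (scottContinuous_den h₂)
  have e : (recur (lam (lam M))).den η = fix (fn fun d => (lam M).den (push d η)).app := by
    rw [den.eq_10, den.eq_8]
  have e' := fix_eq (scottContinuous_app_right (fn fun d => (lam M).den (push d η)))
  rw [← e, app_fn c₁, den.eq_8] at e'
  conv_lhs => rw [← e', app_fn (c₂ _)]

/-- Typing by fixed point induction: ⊥ lies in `T`, the step is preserved, and subdomains are closed
under suprema. The argument `s` is unrestricted, so the programs below must be typed on all inputs.
-/
theorem den_recur_lam_lam_mem {M : Prog} {n : ℕ} (h : (recur (lam (lam M))).ok n = true)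
    (η : ℕ → Dom) {T : Set Dom} (hT : IsSubdomain T)
    (step : ∀ φ : Dom, (∀ s, φ.app s ∈ T) → ∀ s, M.den (push s (push φ η)) ∈ T) (s : Dom) :
    ((recur (lam (lam M))).den η).app s ∈ T := by
  have h₁ : (lam M).ok (n + 1) = true := by simpa only [ok] using h
  have h₂ : M.ok (n + 2) = true := by simpa only [ok] using h
  have c₁ : ScottContinuous fun d => (lam M).den (push d η) :=
    (scottContinuous_push (.const η) .id).comp (scottContinuous_den h₁)
  have c₂ : ∀ φ, ScottContinuous fun d => M.den (push d (push φ η)) := fun φ =>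
    (scottContinuous_push (.const _) .id).comp (scottContinuous_den h₂)
  rw [den.eq_10, den.eq_8]
  refine app_fix_induction (scottContinuous_app_right _).monotone (fun s => s)
    (fun _ => T) (fun _ => hT) (fun φ hφ s => ?_) s
  rw [app_fn c₁, den.eq_8, app_fn (c₂ φ)]
  exact step φ hφ s

theorem den_recur_lam_lam_mem_funT {M : Prog} {n : ℕ} (h : (recur (lam (lam M))).ok n = true)
    (η : ℕ → Dom) {S T : Set Dom} (hT : ∀ s ∈ S, ((recur (lam (lam M))).den η).app s ∈ T) :
    (recur (lam (lam M))).den η ∈ funT S T := by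
  have h₁ : (lam M).ok (n + 1) = true := by simpa only [ok] using h
  have h₂ : M.ok (n + 2) = true := by simpa only [ok] using h
  have c₂ : ∀ φ, ScottContinuous fun d => M.den (push d (push φ η)) := fun φ =>
    (scottContinuous_push (.const _) .id).comp (scottContinuous_den h₂)
  have c₁ : ScottContinuous fun d => (lam M).den (push d η) :=
    (scottContinuous_push (.const η) .id).comp (scottContinuous_den h₁)
  have e : (recur (lam (lam M))).den η = fix (fn fun d => (lam M).den (push d η)).app := by
    rw [den.eq_10, den.eq_8]
  have e' := fix_eq (scottContinuous_app_right (fn fun d => (lam M).den (push d η)))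
  rw [← e, app_fn c₁, den.eq_8] at e'
  refine Or.inr ⟨_, c₂ _, fun s hs => ?_, e'.symm⟩
  rw [← den_recur_lam_lam h]
  exact hT s hs

/-- `case M of {Nil → N}`. -/
def guard (M N : Prog) : Prog := .case M (.cons (.con .nil) N .nil)

/-- Parallel disjunction. -/
def por (M N : Prog) : Prog :=
  .case (.pair M N) (.cons (.con (.pair .nil .var)) .nil (.cons (.con (.pair .var .nil)) .nil .nil))

theorem den_guard_of_eq {M N : Prog} {η : ℕ → Dom} (h : M.den η = Dom.nil) :
    (guard M N).den η = N.den η := by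
  rw [guard, den.eq_7, Clauses.den_cons_of_matches (CPat.matches_nil.2 ⟨rfl, h⟩), pushL_nil]

theorem den_guard_of_ne {M N : Prog} {η : ℕ → Dom} (h : M.den η ≠ Dom.nil) :
    (guard M N).den η = Dom.bot := by
  rw [guard, den.eq_7, Clauses.den_cons_of_not_matches (by simp [h]), Clauses.den_nil]

theorem den_guard_mem {M N : Prog} {η : ℕ → Dom} {T : Set Dom} (h : Dom.bot ∈ T)
    (h' : N.den η ∈ T) : (guard M N).den η ∈ T := by
  by_cases hM : M.den η = Dom.nil
  · rwa [den_guard_of_eq hM]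
  · rwa [den_guard_of_ne hM]

/-- Each clause inspects only one component, so `Nil` on either side suffices even when the other
side is ⊥. -/
theorem den_por_eq_nil_iff {M N : Prog} {η : ℕ → Dom} :
    (por M N).den η = Dom.nil ↔ M.den η = Dom.nil ∨ N.den η = Dom.nil := by
  rw [por, den.eq_7, den.eq_5]
  by_cases hM : M.den η = Dom.nil
  · rw [Clauses.den_cons_of_matches (e := [N.den η]) (by simp [hM])]
    simp [den, hM]
  · rw [Clauses.den_cons_of_not_matches (by simp [hM])]
    by_cases hN : N.den η = Dom.nil
    · rw [Clauses.den_cons_of_matches (e := [M.den η]) (by simp [hN])]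
      simp [den, hN]
    · rw [Clauses.den_cons_of_not_matches (by simp [hN]), Clauses.den_nil]
      simp [hM, hN]

/-! #### Searching for a leaf -/

/-- Test for the leaf `P` at the variable `i`; the variable `3` is the recursive call. -/
def leafAt (P : CPat) (i : ℕ) : Prog :=
  .case (.var i) (.cons (.con (.left P)) .nil
    -- The pattern binds one variable, which moves the recursive call from index 3 to 4.
    (.cons (.con (.right .var)) (.app (.var 4) (.var 0)) .nil))

/-- The program that terminates with `Nil` if the pattern `P` matches some leaf of a tree. -/
def leaf (P : CPat) : Prog :=
  .recur (.lam (.lam (.case (.var 0)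
    (.cons (.con (.amb .var .var)) (por (leafAt P 0) (leafAt P 1)) .nil))))

/-- A leaf `Left(Nil)` testifies to x ≤ 0, a leaf `Right(Nil)` to x ≥ 0; `lo` and `hi` semi-decide
the presence of such a leaf. -/
def lo : Prog := leaf (.left .nil)

def hi : Prog := leaf (.right .nil)

theorem den_leafAt_eq_nil_iff {P : CPat} {i : ℕ} {η : ℕ → Dom} :
    (leafAt P i).den η = Dom.nil ↔ (∃ a, η i = left a ∧ ∃ e, P.Matches e a) ∨
      ∃ c, η i = right c ∧ (η 3).app c = Dom.nil := by
  rw [leafAt, den.eq_7, den.eq_1]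
  by_cases h : ∃ e, (CPat.left P).Matches e (η i)
  · obtain ⟨e, he⟩ := h
    rw [Clauses.den_cons_of_matches he]
    obtain ⟨a, ha, h⟩ := CPat.matches_left.1 he
    simp only [den, true_iff]
    exact Or.inl ⟨a, ha, e, h⟩
  · push Not at h
    rw [Clauses.den_cons_of_not_matches h]
    have h₁ : ¬∃ a, η i = left a ∧ ∃ e, P.Matches e a := by
      rintro ⟨a, ha, e, h'⟩
      exact h e (CPat.matches_left.2 ⟨a, ha, h'⟩)
    by_cases h₂ : ∃ c, η i = right c
    · obtain ⟨c, hc⟩ := h₂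
      rw [Clauses.den_cons_of_matches (e := [c]) (by simp [hc])]
      simp [den, hc]
    · rw [Clauses.den_cons_of_not_matches (fun e he => h₂ ((CPat.matches_right.1 he).imp fun _ h => h.1)), Clauses.den_nil]
      have h₃ : ¬∃ c, η i = right c ∧ (η 3).app c = Dom.nil := fun ⟨c, hc, _⟩ => h₂ ⟨c, hc⟩
      simp only [h₁, h₃, or_self, iff_false]
      exact bot_ne_nil

theorem ok_leaf (P : CPat) : (leaf P).ok 0 = true := by
  simp [leaf, leafAt, por, ok, Clauses.ok, Clauses.okWith, CPat.disjoint, isNil, CPat.arity]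

theorem leaf_amb_eq_nil_iff {P : CPat} (η : ℕ → Dom) (a b : Dom) :
    ((leaf P).den η).app (amb a b) = Dom.nil ↔ ∃ c, (c = a ∨ c = b) ∧
      ((∃ p, c = left p ∧ ∃ e, P.Matches e p) ∨
        ∃ d, c = right d ∧ ((leaf P).den η).app d = Dom.nil) := by
  have h := den_recur_lam_lam (ok_leaf P) η (amb a b)
  rw [← leaf, den.eq_7, Clauses.den_cons_of_matches (e := [a, b]) (by simp [den])] at h
  rw [h, den_por_eq_nil_iff, den_leafAt_eq_nil_iff, den_leafAt_eq_nil_iff]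
  simp only [pushL_cons, pushL_nil, push_zero, push_succ]
  simp only [or_and_right, exists_or, exists_eq_left]

/-- The sign of `x` can be searched for in a tree that realises `x ≤ 0 ∨ x ≥ 0`. -/
theorem StarR.lo_hi {x : ℝ} {d : Dom} (h : StarR sgnT (SgnR x) d) (η : ℕ → Dom) :
    ((lo.den η).app d = Dom.nil → x ≤ 0) ∧ ((hi.den η).app d = Dom.nil → 0 ≤ x) ∧
      ((lo.den η).app d = Dom.nil ∨ (hi.den η).app d = Dom.nil) := by
  refine h.induction (Q := fun d => ((lo.den η).app d = Dom.nil → x ≤ 0) ∧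
    ((hi.den η).app d = Dom.nil → 0 ≤ x) ∧
      ((lo.den η).app d = Dom.nil ∨ (hi.den η).app d = Dom.nil)) ?_
  rintro _ ⟨a, b, rfl, -, -, hab, ha, hb⟩
  rw [lo, hi, leaf_amb_eq_nil_iff, leaf_amb_eq_nil_iff, ← lo, ← hi]
  have key : ∀ c, (c = a ∨ c = b) → c ≠ Dom.bot → SumR (SgnR x) (fun z => StarR sgnT (SgnR x) z ∧
      ((lo.den η).app z = Dom.nil → x ≤ 0) ∧ ((hi.den η).app z = Dom.nil → 0 ≤ x) ∧
        ((lo.den η).app z = Dom.nil ∨ (hi.den η).app z = Dom.nil)) c := by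
    rintro c (rfl | rfl) hc
    exacts [ha hc, hb hc]
  refine ⟨?_, ?_, ?_⟩
  · rintro ⟨c, hc, ⟨p, rfl, e, he⟩ | ⟨d, rfl, hd⟩⟩
    · obtain ⟨p, hp, h⟩ | ⟨q, hq, -⟩ := key _ hc (left_ne_bot _)
      · obtain rfl := left_inj.1 hp
        obtain ⟨rfl, h⟩ | ⟨rfl, h⟩ := h
        · exact h
        · simp at he
      · simp at hq
    · obtain ⟨p, hp, h⟩ | ⟨q, hq, h⟩ := key _ hc (right_ne_bot _)
      · simp at hp
      · obtain rfl := right_inj.1 hq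
        exact h.2.1 hd
  · rintro ⟨c, hc, ⟨p, rfl, e, he⟩ | ⟨d, rfl, hd⟩⟩
    · obtain ⟨p, hp, h⟩ | ⟨q, hq, -⟩ := key _ hc (left_ne_bot _)
      · obtain rfl := left_inj.1 hp
        obtain ⟨rfl, h⟩ | ⟨rfl, h⟩ := h
        · simp at he
        · exact h
      · simp at hq
    · obtain ⟨p, hp, h⟩ | ⟨q, hq, h⟩ := key _ hc (right_ne_bot _)
      · simp at hp
      · obtain rfl := right_inj.1 hq
        exact h.2.2.1 hd
  · obtain ⟨c, hc, hcb⟩ : ∃ c, (c = a ∨ c = b) ∧ c ≠ Dom.bot := by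
      rcases hab with h | h
      exacts [⟨a, Or.inl rfl, h⟩, ⟨b, Or.inr rfl, h⟩]
    obtain ⟨p, hp, ⟨rfl, h⟩ | ⟨rfl, h⟩⟩ | ⟨q, hq, -, -, -, h⟩ := key c hc hcb
    · exact Or.inl ⟨c, hc, Or.inl ⟨_, hp, [], by simp⟩⟩
    · exact Or.inr ⟨c, hc, Or.inl ⟨_, hp, [], by simp⟩⟩
    · exact h.imp (fun h => ⟨c, hc, Or.inr ⟨q, hq, h⟩⟩) fun h => ⟨c, hc, Or.inr ⟨q, hq, h⟩⟩

/-! #### Gray codes to signed digits -/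

def digNeg : Prog := .left (.left .nil)
def digPos : Prog := .left (.right .nil)
def digZero : Prog := .right .nil

/-- From a realiser of the sign of `x` in the variable `0` to one of the sign of `-x`. -/
def swap : Prog :=
  guard (por (.app lo (.var 0)) (.app hi (.var 0)))
    (.amb (guard (.app hi (.var 0)) (.left (.left .nil)))
      (guard (.app lo (.var 0)) (.left (.right .nil))))

/-- From Gray codes of `x` to Gray codes of `-x`. -/
def negGray : Prog :=
  .lam (.case (.var 0) (.cons (.con (.pair .var .var)) (.pair swap (.var 1)) .nil))

/-- From Gray codes of `x` to signed digits of `x`. -/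
def grayToDigits : Prog :=
  .recur (.lam (.lam (.case (.var 0) (.cons (.con (.pair .var (.pair .var .var)))
    -- Variables 0 and 1 are the sign trees of x and 1 - 2|x|, 2 is the remaining Gray code, 4 the
    -- recursive call. Three alternatives are spread over two nested binary nodes.
    (.amb
      (guard (.app lo (.var 0)) (.left (.pair digNeg (.app (.var 4) (.pair (.var 1) (.var 2))))))
      -- The inner node may become defined only when one of its children is: a node with two
      -- undefined children would be different from ⊥ without being a realiser.
      (guard (por (.app hi (.var 0)) (.app hi (.var 1))) (.right (.amb
        (guard (.app hi (.var 0))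
          (.left (.pair digPos (.app (.var 4) (.app negGray (.pair (.var 1) (.var 2)))))))
        (guard (.app hi (.var 1))
          -- The remainder is 2x: its sign tree is that of x, and its tent value is the negative of
          -- the second tent iterate of x.
          (.left (.pair digZero (.app (.var 4) (.pair (.var 0) (.app negGray (.var 2)))))))))))
    .nil))))

theorem ok_grayToDigits : grayToDigits.ok 0 = true := by decide

/-- The typing part is unconditional because at x = 0 a Gray code may carry any sign tree of the
right type. -/
theorem den_swap (η : ℕ → Dom) : swap.den η ∈ starT sgnT ∧
    ∀ x, x ≠ 0 → StarR sgnT (SgnR x) (η 0) → StarR sgnT (SgnR (-x)) (swap.den η) := by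
  have t₁ : ∀ M, (guard M (.left (.left .nil))).den η ∈ sumT sgnT (starT sgnT) := fun M =>
    den_guard_mem (bot_mem_sumT _ _) (by
      simpa only [den] using left_mem_sumT leftNil_mem_sgnT)
  have t₂ : ∀ M, (guard M (.left (.right .nil))).den η ∈ sumT sgnT (starT sgnT) := fun M =>
    den_guard_mem (bot_mem_sumT _ _) (by
      simpa only [den] using left_mem_sumT rightNil_mem_sgnT)
  constructor
  · refine den_guard_mem (bot_mem_fixT _) ?_
    rw [den.eq_6]
    exact amb_mem_starT (t₁ _) (t₂ _)
  · intro x hx h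
    obtain ⟨h₁, h₂, h₃⟩ := h.lo_hi η
    rw [swap, den_guard_of_eq (den_por_eq_nil_iff.2 (by simpa only [den] using h₃)), den.eq_6]
    refine .fold ⟨_, _, rfl, t₁ _, t₂ _, ?_, ?_, ?_⟩
    · rcases h₃ with h | h
      · rw [den_guard_of_eq (N := .left (.right .nil)) (by simpa only [den] using h)]
        simp [den]
      · rw [den_guard_of_eq (N := .left (.left .nil)) (by simpa only [den] using h)]
        simp [den]
    · intro hne
      by_cases h : (hi.den η).app (η 0) = Dom.nil
      · rw [den_guard_of_eq (by simpa only [den] using h)]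
        exact Or.inl ⟨_, by simp only [den], Or.inl ⟨rfl, by linarith [h₂ h]⟩⟩
      · exact (hne (den_guard_of_ne (by simpa only [den] using h))).elim
    · intro hne
      by_cases h : (lo.den η).app (η 0) = Dom.nil
      · rw [den_guard_of_eq (by simpa only [den] using h)]
        exact Or.inl ⟨_, by simp only [den], Or.inr ⟨rfl, by linarith [h₁ h]⟩⟩
      · exact (hne (den_guard_of_ne (by simpa only [den] using h))).elim

/-- The tent function is even, so only the first sign tree has to be changed. -/
theorem negGray_app (η : ℕ → Dom) {x : ℝ} {g : Dom} (h : GReal x g) :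
    GReal (-x) ((negGray.den η).app g) := by
  obtain ⟨hx, d, g', rfl, ⟨-, hd⟩, hg'⟩ := h.unfold
  have c : ScottContinuous fun s => (Prog.case (.var 0)
      (.cons (.con (.pair .var .var)) (.pair swap (.var 1)) .nil)).den (push s η) :=
    (scottContinuous_push (.const η) .id).comp (scottContinuous_den (n := 1) (by decide))
  rw [negGray, den.eq_8, app_fn c, den.eq_7, Clauses.den_cons_of_matches (e := [d, g'])
    (by simp [den]), den.eq_5, den.eq_1]
  obtain ⟨h₁, h₂⟩ := den_swap (pushL [d, g'] (push (d.pair g') η))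
  refine .fold ⟨by linarith, by linarith⟩ ⟨h₁, fun hne => ?_⟩ ?_
  · have hne' : x ≠ 0 := fun h => hne (by simp [h])
    exact h₂ x hne' (by simpa using hd hne')
  · simpa using hg'

theorem grayToDigits_app_mem (η : ℕ → Dom) (s : Dom) :
    (grayToDigits.den η).app s ∈ sdT := by
  refine den_recur_lam_lam_mem ok_grayToDigits η (isSubdomain_fixT _) (fun φ hφ s => ?_) s
  change _ ∈ sdT
  rw [den.eq_7]
  refine Clauses.den_cons_mem (fun e he => ?_) (Clauses.den_nil _ _ ▸ bot_mem_fixT _)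
  obtain ⟨a, b, u, v, -, rfl, hu, hv⟩ := CPat.matches_pair.1 he
  obtain ⟨b, c, v, w, -, rfl, hv, hw⟩ := CPat.matches_pair.1 hv
  obtain rfl := CPat.matches_var.1 hu
  obtain rfl := CPat.matches_var.1 hv
  obtain rfl := CPat.matches_var.1 hw
  simp only [den, digNeg, digPos, digZero]
  have hdig : ∀ {d a : Dom} {r : ℝ}, DigR r d → left (d.pair (φ.app a)) ∈
      sumT (prodT digT sdT) (starT (prodT digT sdT)) := fun hd =>
    left_mem_sumT (pair_mem_prodT hd.mem_digT (hφ _))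
  refine mem_sdT (amb_mem_starT ?_ ?_)
  · refine den_guard_mem (bot_mem_sumT _ _) ?_
    simp only [den]
    exact hdig (Or.inl (Or.inl ⟨rfl, rfl⟩))
  · refine den_guard_mem (bot_mem_sumT _ _) ?_
    simp only [den]
    refine right_mem_sumT (amb_mem_starT ?_ ?_)
    · refine den_guard_mem (bot_mem_sumT _ _) ?_
      simp only [den]
      exact hdig (Or.inl (Or.inr ⟨rfl, rfl⟩))
    · refine den_guard_mem (bot_mem_sumT _ _) ?_
      simp only [den]
      exact hdig (Or.inr ⟨rfl, rfl⟩)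

theorem grayToDigits_realises :
    grayToDigits.Realises (.incl 1 (GStar (.var 0)) (SStar (.var 0))) := by
  refine ⟨wf_of_ok ok_grayToDigits, (realises_incl_one (harrop_GStar _) (harrop_SStar _)
    (typ_GStar _) (typ_SStar _) (real_GStar _) (real_SStar _)).2
    ⟨den_recur_lam_lam_mem_funT ok_grayToDigits _ fun s _ => grayToDigits_app_mem _ s, ?_⟩⟩
  intro x g hg
  have hg : GReal x g := hg
  generalize (fun _ => Dom.bot : ℕ → Dom) = η
  refine SReal.coinduction (fun x a => ∃ g, GReal x g ∧ a = (grayToDigits.den η).app g) ?_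
    ⟨g, hg, rfl⟩
  clear! g x
  rintro x _ ⟨g, hg, rfl⟩
  obtain ⟨hx, d₀, g', rfl, ⟨-, hd₀⟩, hg'⟩ := hg.unfold
  obtain ⟨hx', d₁, g'', rfl, ⟨-, hd₁⟩, hg''⟩ := hg'.unfold
  have e := den_recur_lam_lam ok_grayToDigits η (d₀.pair (d₁.pair g''))
  rw [← grayToDigits, den.eq_7, Clauses.den_cons_of_matches (e := [d₀, d₁, g''])
    (by simp [den])] at e
  set E := pushL [d₀, d₁, g''] (push (d₀.pair (d₁.pair g'')) (push (grayToDigits.den η) η)) with hE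
  have E₀ : E 0 = d₀ := by simp [hE]
  have E₁ : E 1 = d₁ := by simp [hE]
  have E₂ : E 2 = g'' := by simp [hE]
  have E₄ : E 4 = grayToDigits.den η := by simp [hE]
  -- At x = 0 the tree `d₀` is an arbitrary element of its type, but then any sign is correct. The
  -- same remark applies to `hi₀` and to `hi₁`.
  have lo₀ : (lo.den E).app d₀ = Dom.nil → x ≤ 0 := fun h => by
    by_cases hx : x = 0
    · exact hx.le
    · exact ((hd₀ hx).lo_hi E).1 h
  have hi₀ : (hi.den E).app d₀ = Dom.nil → 0 ≤ x := fun h => by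
    by_cases hx : x = 0
    · exact hx.ge
    · exact ((hd₀ hx).lo_hi E).2.1 h
  have hi₁ : (hi.den E).app d₁ = Dom.nil → 0 ≤ 1 - 2 * |x| := fun h => by
    by_cases hx : 1 - 2 * |x| = 0
    · exact hx.ge
    · exact ((hd₁ hx).lo_hi E).2.1 h
  -- If x = 0 then 1 - 2|x| = 1, so its sign search terminates, and it cannot report a nonpositive
  -- number.
  have total : (lo.den E).app d₀ = Dom.nil ∨ (hi.den E).app d₀ = Dom.nil ∨
      (hi.den E).app d₁ = Dom.nil := by
    by_cases hx : x = 0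
    · have h₁ : 1 - 2 * |x| ≠ 0 := by simp [hx]
      obtain ⟨h₂, -, h₃⟩ := (hd₁ h₁).lo_hi E
      refine Or.inr (Or.inr (h₃.resolve_left fun h => ?_))
      have := h₂ h
      simp only [hx, abs_zero] at this
      linarith
    · rcases ((hd₀ hx).lo_hi E).2.2 with h | h
      exacts [Or.inl h, Or.inr (Or.inl h)]
  have real : ∀ {r : ℝ} {d a : Dom}, DigR r d → |2 * x - r| ≤ 1 → GReal (2 * x - r) a →
      SumR (SBody (fun x a => ∃ g, GReal x g ∧ a = (grayToDigits.den η).app g) x)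
        (StarR (prodT digT sdT)
          (SBody (fun x a => ∃ g, GReal x g ∧ a = (grayToDigits.den η).app g) x))
        (left (d.pair ((grayToDigits.den η).app a))) := fun hd hr ha =>
    Or.inl ⟨_, rfl, _, _, _, rfl, hd, hr, _, ha, rfl⟩
  have typ : ∀ {r : ℝ} {d a : Dom}, DigR r d → left (d.pair ((grayToDigits.den η).app a)) ∈
      sumT (prodT digT sdT) (starT (prodT digT sdT)) := fun hd =>
    left_mem_sumT (pair_mem_prodT hd.mem_digT (grayToDigits_app_mem η _))
  -- the three results, which are available under different conditions
  have rn : x ≤ 0 → GReal (2 * x - -1) (d₁.pair g'') := fun h => by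
    rw [abs_of_nonpos h] at hg'
    convert hg' using 1
    ring
  have rp : 0 ≤ x → GReal (2 * x - 1) ((negGray.den E).app (d₁.pair g'')) := fun h => by
    have := negGray_app E hg'
    rw [abs_of_nonneg h] at this
    convert this using 1
    ring
  have rz : 0 ≤ 1 - 2 * |x| → GReal (2 * x - 0) (d₀.pair ((negGray.den E).app g'')) := fun h => by
    have h₁ : |2 * x| = 2 * |x| := by rw [abs_mul, abs_two]
    have h₂ : -1 ≤ 2 * x ∧ 2 * x ≤ 1 := abs_le.1 (by linarith)
    rw [sub_zero]
    refine .fold h₂ ⟨?_, fun hne => ?_⟩ ?_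
    · obtain ⟨-, d, g, hdg, ⟨h, -⟩, -⟩ := hg.unfold
      rwa [(pair_inj.1 hdg).1]
    · refine (hd₀ fun h => hne (by simp [h])).mono ?_
      rintro a (⟨rfl, h⟩ | ⟨rfl, h⟩)
      exacts [Or.inl ⟨rfl, by linarith⟩, Or.inr ⟨rfl, by linarith⟩]
    -- With t(x) = 1 - 2|x| ≥ 0 one has t(t(x)) = 4|x| - 1 = -t(2x).
    · have := negGray_app E hg''
      rw [abs_of_nonneg h] at this
      rw [h₁]
      convert this using 1
      ring
  have gn : x ≤ 0 → |2 * x - -1| ≤ 1 := fun h => abs_le.2 ⟨by linarith, by linarith⟩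
  have gp : 0 ≤ x → |2 * x - 1| ≤ 1 := fun h => abs_le.2 ⟨by linarith, by linarith⟩
  have gz : 0 ≤ 1 - 2 * |x| → |2 * x - 0| ≤ 1 := fun h => by
    rw [sub_zero, abs_mul, abs_two]; linarith
  have Dn : DigR (-1) (left (left Dom.nil)) := Or.inl (Or.inl ⟨rfl, rfl⟩)
  have Dp : DigR 1 (left (right Dom.nil)) := Or.inl (Or.inr ⟨rfl, rfl⟩)
  have Dz : DigR 0 (right Dom.nil) := Or.inr ⟨rfl, rfl⟩
  rw [e, den.eq_6]
  refine .fold ⟨_, _, rfl, ?_, ?_, ?_, ?_, ?_⟩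
  · refine den_guard_mem (bot_mem_sumT _ _) ?_
    simp only [den, digNeg, E₄]
    exact typ Dn
  · refine den_guard_mem (bot_mem_sumT _ _) ?_
    simp only [den]
    refine right_mem_sumT (amb_mem_starT ?_ ?_)
    · refine den_guard_mem (bot_mem_sumT _ _) ?_
      simp only [den, digPos, E₄]
      exact typ Dp
    · refine den_guard_mem (bot_mem_sumT _ _) ?_
      simp only [den, digZero, E₄]
      exact typ Dz
  · rcases total with h | h
    · left
      rw [den_guard_of_eq (by simpa only [den, E₀] using h)]
      simp [den]
    · right
      rw [den_guard_of_eq (den_por_eq_nil_iff.2 (by simpa only [den, E₀, E₁] using h))]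
      simp [den]
  · intro hne
    by_cases h : (lo.den E).app d₀ = Dom.nil
    · rw [den_guard_of_eq (by simpa only [den, E₀] using h)]
      simp only [den, digNeg, E₄, E₁, E₂]
      exact real Dn (gn (lo₀ h)) (rn (lo₀ h))
    · exact (hne (den_guard_of_ne (by simpa only [den, E₀] using h))).elim
  · intro hne
    by_cases h : (hi.den E).app d₀ = Dom.nil ∨ (hi.den E).app d₁ = Dom.nil
    · rw [den_guard_of_eq (den_por_eq_nil_iff.2 (by simpa only [den, E₀, E₁] using h)), den.eq_4,
        den.eq_6]
      refine Or.inr ⟨_, rfl, .fold ⟨_, _, rfl, ?_, ?_, ?_, ?_, ?_⟩⟩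
      · refine den_guard_mem (bot_mem_sumT _ _) ?_
        simp only [den, digPos, E₄]
        exact typ Dp
      · refine den_guard_mem (bot_mem_sumT _ _) ?_
        simp only [den, digZero, E₄]
        exact typ Dz
      · rcases h with h | h
        · left
          rw [den_guard_of_eq (by simpa only [den, E₀] using h)]
          simp [den]
        · right
          rw [den_guard_of_eq (by simpa only [den, E₁] using h)]
          simp [den]
      · intro hne
        by_cases h : (hi.den E).app d₀ = Dom.nil
        · rw [den_guard_of_eq (by simpa only [den, E₀] using h)]
          simp only [den, digPos, E₄, E₁, E₂]
          exact real Dp (gp (hi₀ h)) (rp (hi₀ h))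
        · exact (hne (den_guard_of_ne (by simpa only [den, E₀] using h))).elim
      · intro hne
        by_cases h : (hi.den E).app d₁ = Dom.nil
        · rw [den_guard_of_eq (by simpa only [den, E₁] using h)]
          simp only [den, digZero, E₄, E₀, E₂]
          exact real Dz (gz (hi₁ h)) (rz (hi₁ h))
        · exact (hne (den_guard_of_ne (by simpa only [den, E₁] using h))).elim
    · exact (hne (den_guard_of_ne fun h' => h (by
        simpa only [den, E₀, E₁] using den_por_eq_nil_iff.1 h'))).elim

end CFP

namespace CFP
open Dom
open Prog hiding var nil left right pair amb app bot

/-! #### Signed digits to Gray codes -/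

/-- The clauses for the nodes of a tree with signed digits: at the leaves with digits `-1`, `1`
and `0` the results are `L`, `M` and `N`; the variable `4` is the recursive call. -/
def treeClauses (L M N : Prog) : Clauses :=
  .cons (.con (.left (.pair (.left (.left .nil)) .var))) L
    (.cons (.con (.left (.pair (.left (.right .nil)) .var))) M
      (.cons (.con (.left (.pair (.right .nil) .var))) N
        (.cons (.con (.right .var)) (.right (.app (.var 4) (.var 0))) .nil)))

/-- Inner nodes are copied and only leaves are rewritten, possibly into whole subtrees. The clauses
are strict in each child, so undefined branches stay undefined. -/
def tree (L M N : Prog) : Prog :=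
  .recur (.lam (.lam (.case (.var 0) (.cons (.con (.amb .var .var))
    (.amb (.case (.var 0) (treeClauses L M N)) (.case (.var 1) (treeClauses L M N))) .nil))))

section Tree

variable {L M N : Prog} (η : ℕ → Dom)

/-- The environment is hidden behind an existential; all that later arguments use of it is the
recursive call at index 3. -/
theorem tree_app_amb (h : (tree L M N).ok 0 = true) (a b : Dom) : ∃ E : ℕ → Dom,
    E 3 = (tree L M N).den η ∧ ((tree L M N).den η).app (amb a b) =
      amb ((treeClauses L M N).den E a) ((treeClauses L M N).den E b) := by
  have e := den_recur_lam_lam h η (amb a b)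
  rw [← tree, den.eq_7, Clauses.den_cons_of_matches (e := [a, b]) (by simp [den]), den.eq_6,
    den.eq_7, den.eq_7, den.eq_1, den.eq_1] at e
  exact ⟨_, by simp, e⟩

theorem treeClauses_right (c : Dom) :
    (treeClauses L M N).den η (right c) = right ((η 3).app c) := by
  rw [treeClauses, Clauses.den_cons_of_not_matches (by simp),
    Clauses.den_cons_of_not_matches (by simp), Clauses.den_cons_of_not_matches (by simp),
    Clauses.den_cons_of_matches (e := [c]) (by simp)]
  simp [den]

theorem treeClauses_neg (s : Dom) :
    (treeClauses L M N).den η (left (pair (left (left Dom.nil)) s)) = L.den (push s η) := by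
  rw [treeClauses, Clauses.den_cons_of_matches (e := [s]) (by simp)]
  simp

theorem treeClauses_pos (s : Dom) :
    (treeClauses L M N).den η (left (pair (left (right Dom.nil)) s)) = M.den (push s η) := by
  rw [treeClauses, Clauses.den_cons_of_not_matches (by simp),
    Clauses.den_cons_of_matches (e := [s]) (by simp)]
  simp

theorem treeClauses_zero (s : Dom) :
    (treeClauses L M N).den η (left (pair (right Dom.nil) s)) = N.den (push s η) := by
  rw [treeClauses, Clauses.den_cons_of_not_matches (by simp),
    Clauses.den_cons_of_not_matches (by simp),
    Clauses.den_cons_of_matches (e := [s]) (by simp)]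
  simp

theorem treeClauses_bot : (treeClauses L M N).den η Dom.bot = Dom.bot := by
  rw [treeClauses, Clauses.den_cons_of_not_matches (by simp),
    Clauses.den_cons_of_not_matches (by simp), Clauses.den_cons_of_not_matches (by simp),
    Clauses.den_cons_of_not_matches (by simp), Clauses.den_nil]

theorem treeClauses_mem {T : Set Dom} (h : ∀ s, (η 3).app s ∈ starT T)
    (hL : ∀ s, L.den (push s η) ∈ sumT T (starT T)) (hM : ∀ s, M.den (push s η) ∈ sumT T (starT T))
    (hN : ∀ s, N.den (push s η) ∈ sumT T (starT T)) (a : Dom) :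
    (treeClauses L M N).den η a ∈ sumT T (starT T) := by
  have key : ∀ {P : CPat} {e : List Dom} {s d : Dom}, (CPat.left (.pair P .var)).Matches e d →
      (∀ e s, P.Matches e s → e = []) → ∃ s, pushL e η = push s η := by
    intro P e s d he hP
    obtain ⟨a, -, he⟩ := CPat.matches_left.1 he
    obtain ⟨a, b, u, v, -, rfl, hu, hv⟩ := CPat.matches_pair.1 he
    obtain rfl := hP u a hu
    obtain rfl := CPat.matches_var.1 hv
    exact ⟨b, by simp⟩
  refine Clauses.den_cons_mem (fun e he => ?_) (Clauses.den_cons_mem (fun e he => ?_)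
    (Clauses.den_cons_mem (fun e he => ?_) (Clauses.den_cons_mem (fun e he => ?_)
      (Clauses.den_nil _ _ ▸ bot_mem_sumT _ _))))
  · obtain ⟨s, hs⟩ := key (s := a) he (by simp)
    exact hs ▸ hL s
  · obtain ⟨s, hs⟩ := key (s := a) he (by simp)
    exact hs ▸ hM s
  · obtain ⟨s, hs⟩ := key (s := a) he (by simp)
    exact hs ▸ hN s
  · obtain ⟨c, -, he⟩ := CPat.matches_right.1 he
    obtain rfl := CPat.matches_var.1 he
    simpa [den] using right_mem_sumT (h c)

theorem tree_app_mem (h : (tree L M N).ok 0 = true) {T : Set Dom}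
    (hL : ∀ η : ℕ → Dom, (∀ s, (η 3).app s ∈ starT T) → ∀ s, L.den (push s η) ∈ sumT T (starT T))
    (hM : ∀ η : ℕ → Dom, (∀ s, (η 3).app s ∈ starT T) → ∀ s, M.den (push s η) ∈ sumT T (starT T))
    (hN : ∀ η : ℕ → Dom, (∀ s, (η 3).app s ∈ starT T) → ∀ s, N.den (push s η) ∈ sumT T (starT T))
    (s : Dom) : ((tree L M N).den η).app s ∈ starT T := by
  refine den_recur_lam_lam_mem h η (isSubdomain_fixT _) (fun φ hφ s => ?_) s
  change _ ∈ starT T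
  rw [den.eq_7]
  refine Clauses.den_cons_mem (fun e he => ?_) (Clauses.den_nil _ _ ▸ bot_mem_fixT _)
  obtain ⟨a, b, u, v, -, rfl, hu, hv⟩ := CPat.matches_amb.1 he
  obtain rfl := CPat.matches_var.1 hu
  obtain rfl := CPat.matches_var.1 hv
  rw [den.eq_6, den.eq_7, den.eq_7]
  have h₂ : ∀ t s, (pushL ([a] ++ [b]) (push t (push φ η)) 3).app s ∈ starT T := fun _ => hφ
  exact amb_mem_starT (treeClauses_mem _ (h₂ _) (hL _ (h₂ _)) (hM _ (h₂ _)) (hN _ (h₂ _)) _)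
    (treeClauses_mem _ (h₂ _) (hL _ (h₂ _)) (hM _ (h₂ _)) (hN _ (h₂ _)) _)

/-- By induction on the tree, correctness of a recursion on ⇊* reduces to correctness at the leaves.
-/
theorem StarR.tree_app (h : (tree L M N).ok 0 = true) {T T' : Set Dom} {R R' : Dom → Prop}
    {c : Dom} (hc : StarR T R c)
    (hT : ∀ p, R' p → p ∈ T')
    (hleaf : ∀ E : ℕ → Dom, E 3 = (tree L M N).den η → ∀ p, R p →
      SumR R' (StarR T' R') ((treeClauses L M N).den E (left p))) :
    StarR T' R' (((tree L M N).den η).app c) := by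
  refine hc.induction (Q := fun c => StarR T' R' (((tree L M N).den η).app c)) ?_
  rintro _ ⟨a, b, rfl, -, -, hab, ha, hb⟩
  obtain ⟨E, hE, e⟩ := tree_app_amb η h a b
  have key : ∀ {a}, (a ≠ Dom.bot → SumR R (fun z => StarR T R z ∧
      StarR T' R' (((tree L M N).den η).app z)) a) → a ≠ Dom.bot →
      SumR R' (StarR T' R') ((treeClauses L M N).den E a) := by
    intro a ha hne
    obtain ⟨p, rfl, hp⟩ | ⟨c, rfl, -, hc⟩ := ha hne
    · exact hleaf E hE p hp
    · rw [treeClauses_right, hE]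
      exact Or.inr ⟨_, rfl, hc⟩
  have typ : ∀ {a}, SumR R' (StarR T' R') a → a ∈ sumT T' (starT T') := by
    rintro _ (⟨p, rfl, hp⟩ | ⟨c, rfl, hc⟩)
    exacts [left_mem_sumT (hT p hp), right_mem_sumT hc.mem_starT]
  have mem : ∀ {a}, (a ≠ Dom.bot → SumR R (fun z => StarR T R z ∧
      StarR T' R' (((tree L M N).den η).app z)) a) →
      (treeClauses L M N).den E a ∈ sumT T' (starT T') := by
    intro a ha
    by_cases h : a = Dom.bot
    · rw [h, treeClauses_bot]; exact bot_mem_sumT _ _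
    · exact typ (key ha h)
  -- A defined output child comes from a defined input child, which is the only kind the hypotheses
  -- speak about.
  have strict : ∀ {a}, (treeClauses L M N).den E a ≠ Dom.bot → a ≠ Dom.bot := by
    rintro _ h rfl
    exact h (treeClauses_bot E)
  have ne : ∀ {a}, SumR R' (StarR T' R') a → a ≠ Dom.bot := by
    rintro _ (⟨p, rfl, hp⟩ | ⟨c, rfl, hc⟩)
    exacts [left_ne_bot _, right_ne_bot _]
  rw [e]
  exact .fold ⟨_, _, rfl, mem ha, mem hb, hab.imp (fun h => ne (key ha h)) fun h => ne (key hb h),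
    fun h => key ha (strict h), fun h => key hb (strict h)⟩

end Tree

/-- The sign of a number with a given signed digit representation. -/
def sign : Prog := tree (.left (.left .nil)) (.left (.right .nil)) (.right (.app (.var 4) (.var 0)))

/-- From signed digits of `x` to signed digits of `-x`. -/
def negDigits : Prog :=
  tree (.left (.pair digPos (.app (.var 4) (.var 0)))) (.left (.pair digNeg (.app (.var 4) (.var 0))))
    (.left (.pair digZero (.app (.var 4) (.var 0))))

/-- From signed digits of `x` to signed digits of `1 - 2|x|`. -/
def tentDigits : Prog :=
  -- For digit -1 the remainder 2x + 1 is already 1 - 2|x|. Negating twice leaves the number alone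
  -- but forces the result into the right type for arbitrary input, as `tentDigits_app_mem` demands.
  tree (.right (.app negDigits (.app negDigits (.var 0)))) (.right (.app negDigits (.var 0)))
    -- A tree with a single leaf; one defined child is enough.
    (.right (.amb (.left (.pair digPos (.app (.var 4) (.var 0)))) .bot))

/-- From signed digits of `x` to Gray codes of `x`. -/
def digitsToGray : Prog :=
  .recur (.lam (.lam (.pair (.app sign (.var 0)) (.app (.var 1) (.app tentDigits (.var 0))))))

theorem ok_sign : sign.ok 0 = true := by decide
theorem ok_negDigits : negDigits.ok 0 = true := by decide
theorem ok_tentDigits : tentDigits.ok 0 = true := by decide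
theorem ok_digitsToGray : digitsToGray.ok 0 = true := by decide

theorem digR_neg_one : DigR (-1) (left (left Dom.nil)) := Or.inl (Or.inl ⟨rfl, rfl⟩)
theorem digR_one : DigR 1 (left (right Dom.nil)) := Or.inl (Or.inr ⟨rfl, rfl⟩)
theorem digR_zero : DigR 0 (right Dom.nil) := Or.inr ⟨rfl, rfl⟩

theorem sign_app_mem (η : ℕ → Dom) (s : Dom) : (sign.den η).app s ∈ starT sgnT := by
  refine tree_app_mem η ok_sign (fun η h s => ?_) (fun η h s => ?_) (fun η h s => ?_) s
  · simpa only [den] using left_mem_sumT leftNil_mem_sgnT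
  · simpa only [den] using left_mem_sumT rightNil_mem_sgnT
  · simp only [den]
    exact right_mem_sumT (h s)

theorem negDigits_app_mem (η : ℕ → Dom) (s : Dom) :
    (negDigits.den η).app s ∈ starT (prodT digT sdT) := by
  refine tree_app_mem η ok_negDigits (fun η h s => ?_) (fun η h s => ?_) (fun η h s => ?_) s <;>
    simp only [den, digPos, digNeg, digZero]
  · exact left_mem_sumT (pair_mem_prodT digR_one.mem_digT (mem_sdT (h s)))
  · exact left_mem_sumT (pair_mem_prodT digR_neg_one.mem_digT (mem_sdT (h s)))
  · exact left_mem_sumT (pair_mem_prodT digR_zero.mem_digT (mem_sdT (h s)))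

theorem tentDigits_app_mem (η : ℕ → Dom) (s : Dom) :
    (tentDigits.den η).app s ∈ starT (prodT digT sdT) := by
  refine tree_app_mem η ok_tentDigits (fun η h s => ?_) (fun η h s => ?_) (fun η h s => ?_) s <;>
    simp only [den, digPos]
  · exact right_mem_sumT (negDigits_app_mem _ _)
  · exact right_mem_sumT (negDigits_app_mem _ _)
  · exact right_mem_sumT (amb_mem_starT
      (left_mem_sumT (pair_mem_prodT digR_one.mem_digT (mem_sdT (h s)))) (bot_mem_sumT _ _))

/-- Induction on the tree reaches some leaf, where |2x - d| ≤ 1 and |d| ≤ 1 give |x| ≤ 1. -/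
theorem SReal.bounds {x : ℝ} {s : Dom} (h : SReal x s) : -1 ≤ x ∧ x ≤ 1 := by
  refine h.unfold.induction (Q := fun _ => -1 ≤ x ∧ x ≤ 1) ?_
  rintro _ ⟨a, b, -, -, -, hab, ha, hb⟩
  have key : ∀ {a}, SumR (SBody SReal x) (fun z => StarR (prodT digT sdT) (SBody SReal x) z ∧
      (-1 ≤ x ∧ x ≤ 1)) a → -1 ≤ x ∧ x ≤ 1 := by
    rintro a (⟨_, -, d, p, q, -, hd, hx, -⟩ | ⟨_, -, -, h⟩)
    · have := abs_le.1 hx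
      rcases hd with (⟨-, rfl⟩ | ⟨-, rfl⟩) | ⟨-, rfl⟩ <;> constructor <;> linarith
    · exact h
  exact hab.elim (fun h => key (ha h)) fun h => key (hb h)

/-- Realisers of signed digit representations of the numbers in a relation that is closed under
the digits. -/
theorem SBody.mem {Q : ℝ → Dom → Prop} (hQ : ∀ x a, Q x a → a ∈ sdT) {x : ℝ} {p : Dom}
    (h : SBody Q x p) : p ∈ prodT digT sdT := by
  obtain ⟨d, a, b, rfl, hd, -, hb⟩ := h
  exact pair_mem_prodT hd.mem_digT (hQ _ _ hb)

theorem SReal.negDigits_app {x : ℝ} {s : Dom} (h : SReal x s) (η : ℕ → Dom) :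
    SReal (-x) ((negDigits.den η).app s) := by
  -- The type of `u` is made part of the relation because `SBody.mem` must produce typed leaves
  -- before the coinduction is complete.
  refine coinduction (fun y u => u ∈ sdT ∧ ∃ s, SReal (-y) s ∧ u = (negDigits.den η).app s) ?_
    ⟨CFP.mem_sdT (negDigits_app_mem _ _), s, by simpa using h, rfl⟩
  clear! s x
  rintro y _ ⟨-, s, hs, rfl⟩
  refine hs.unfold.tree_app η ok_negDigits (fun p => SBody.mem fun _ _ h => h.1) ?_
  rintro E hE _ ⟨d, a, b, rfl, hd, hy, hb⟩
  have real : ∀ {r : ℝ} {d : Dom}, DigR r d → |2 * y - r| ≤ 1 → SReal (-(2 * y - r)) b →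
      SBody (fun y u => u ∈ sdT ∧ ∃ s, SReal (-y) s ∧ u = (negDigits.den η).app s) y
        (pair d ((negDigits.den η).app b)) := fun hd hr hb =>
    ⟨_, _, _, rfl, hd, hr, CFP.mem_sdT (negDigits_app_mem _ _), b, hb, rfl⟩
  change E 3 = negDigits.den η at hE
  rcases hd with (⟨rfl, rfl⟩ | ⟨rfl, rfl⟩) | ⟨rfl, rfl⟩
  · rw [treeClauses_neg]
    simp only [den, digPos, push_succ, push_zero, hE]
    refine Or.inl ⟨_, rfl, real digR_one ?_ ?_⟩
    · rw [← abs_neg]; convert hy using 2; ring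
    · convert hb using 1; ring
  · rw [treeClauses_pos]
    simp only [den, digNeg, push_succ, push_zero, hE]
    refine Or.inl ⟨_, rfl, real digR_neg_one ?_ ?_⟩
    · rw [← abs_neg]; convert hy using 2; ring
    · convert hb using 1; ring
  · rw [treeClauses_zero]
    simp only [den, digZero, push_succ, push_zero, hE]
    refine Or.inl ⟨_, rfl, real digR_zero ?_ ?_⟩
    · rw [← abs_neg]; convert hy using 2; ring
    · convert hb using 1; ring

/-- Digits ±1 lead to an ordinary digit representation at once; only digit 0 continues the
translation. Hence the coinduction relation contains `SReal` as a disjunct. -/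
theorem SReal.tentDigits_app {x : ℝ} {s : Dom} (h : SReal x s) (η : ℕ → Dom) :
    SReal (1 - 2 * |x|) ((tentDigits.den η).app s) := by
  refine coinduction (fun y u => SReal y u ∨
    u ∈ sdT ∧ ∃ x s, SReal x s ∧ y = 1 - 2 * |x| ∧ u = (tentDigits.den η).app s) ?_
    (Or.inr ⟨CFP.mem_sdT (tentDigits_app_mem _ _), x, s, h, rfl, rfl⟩)
  clear! s x
  rintro y u (hu | ⟨-, x, s, hs, rfl, rfl⟩)
  · exact hu.unfold.mono fun _ h => h.mono fun _ _ h => Or.inl h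
  have up : ∀ {y u}, SReal y u → StarR (prodT digT sdT) (SBody (fun y u => SReal y u ∨
      u ∈ sdT ∧ ∃ x s, SReal x s ∧ y = 1 - 2 * |x| ∧ u = (tentDigits.den η).app s) y) u :=
    fun h => h.unfold.mono fun _ h => h.mono fun _ _ h => Or.inl h
  refine hs.unfold.tree_app η ok_tentDigits (fun p => SBody.mem fun _ _ h =>
    h.elim SReal.mem_sdT fun h => h.1) ?_
  rintro E hE _ ⟨d, a, b, rfl, hd, hy, hb⟩
  have hy := abs_le.1 hy
  change E 3 = tentDigits.den η at hE
  rcases hd with (⟨rfl, rfl⟩ | ⟨rfl, rfl⟩) | ⟨rfl, rfl⟩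
  · rw [treeClauses_neg]
    simp only [den, push_zero]
    refine Or.inr ⟨_, rfl, up ?_⟩
    rw [abs_of_nonpos (by linarith)]
    convert (hb.negDigits_app _).negDigits_app _ using 1
    ring
  · rw [treeClauses_pos]
    simp only [den, push_zero]
    refine Or.inr ⟨_, rfl, up ?_⟩
    rw [abs_of_nonneg (by linarith)]
    convert hb.negDigits_app _ using 1
    ring
  · rw [treeClauses_zero]
    simp only [den, digPos, push_succ, push_zero, hE]
    -- Digit 0 forces |x| ≤ 1/2, so y = 1 - 2|x| lies in [0, 1] and admits digit 1, with remainder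
    -- 2y - 1 = 1 - 2|2x|.
    have hx : 2 * |x| ≤ 1 := by
      rw [← abs_two, ← abs_mul]
      exact abs_le.2 ⟨by linarith, by linarith⟩
    have hx' := abs_nonneg x
    have real : SBody (fun y u => SReal y u ∨ u ∈ sdT ∧ ∃ x s, SReal x s ∧ y = 1 - 2 * |x| ∧
        u = (tentDigits.den η).app s) (1 - 2 * |x|)
        (pair (left (right Dom.nil)) ((tentDigits.den η).app b)) := by
      refine ⟨1, _, _, rfl, digR_one, abs_le.2 ⟨by linarith, by linarith⟩,
        Or.inr ⟨CFP.mem_sdT (tentDigits_app_mem _ _), _, b, hb, ?_, rfl⟩⟩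
      rw [sub_zero, abs_mul, abs_two]
      ring
    refine Or.inr ⟨_, rfl, .fold ⟨_, _, rfl, left_mem_sumT (real.mem fun _ _ h =>
      h.elim SReal.mem_sdT fun h => h.1), bot_mem_sumT _ _, Or.inl (left_ne_bot _), fun _ =>
      Or.inl ⟨_, rfl, real⟩, fun h => (h rfl).elim⟩⟩

/-- Digit 0 doubles the number, and 1 < 2 ^ n * |x| for some n because x ≠ 0. Induction on n ends
since |x| ≤ 1 excludes n = 0. This is the semantic form of Archimedean induction. -/
theorem SReal.sign_app {x : ℝ} {s : Dom} (h : SReal x s) (hx : x ≠ 0) (η : ℕ → Dom) :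
    StarR sgnT (SgnR x) ((sign.den η).app s) := by
  obtain ⟨n, hn⟩ : ∃ n : ℕ, 1 < 2 ^ n * |x| := by
    obtain ⟨n, hn⟩ := pow_unbounded_of_one_lt (1 / |x|) (one_lt_two (α := ℝ))
    exact ⟨n, by rwa [div_lt_iff₀ (abs_pos.2 hx)] at hn⟩
  induction n generalizing x s with
  | zero =>
    have := abs_le.2 h.bounds
    linarith
  | succ n ih =>
    refine h.unfold.tree_app η ok_sign ?_ ?_
    · rintro _ (⟨rfl, -⟩ | ⟨rfl, -⟩)
      exacts [leftNil_mem_sgnT, rightNil_mem_sgnT]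
    rintro E hE _ ⟨d, a, b, rfl, hd, hy, hb⟩
    have hy := abs_le.1 hy
    change E 3 = sign.den η at hE
    rcases hd with (⟨rfl, rfl⟩ | ⟨rfl, rfl⟩) | ⟨rfl, rfl⟩
    · rw [treeClauses_neg]
      simp only [den]
      exact Or.inl ⟨_, rfl, Or.inl ⟨rfl, by linarith⟩⟩
    · rw [treeClauses_pos]
      simp only [den]
      exact Or.inl ⟨_, rfl, Or.inr ⟨rfl, by linarith⟩⟩
    · rw [treeClauses_zero]
      simp only [den, push_succ, push_zero, hE]
      rw [sub_zero] at hb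
      refine Or.inr ⟨_, rfl, (ih hb (by simpa using hx) ?_).mono ?_⟩
      · rw [abs_mul, abs_two]
        rw [pow_succ] at hn
        linarith
      · rintro a (⟨rfl, h⟩ | ⟨rfl, h⟩)
        exacts [Or.inl ⟨rfl, by linarith⟩, Or.inr ⟨rfl, by linarith⟩]

theorem digitsToGray_app_mem (η : ℕ → Dom) (s : Dom) :
    (digitsToGray.den η).app s ∈ gcT := by
  refine den_recur_lam_lam_mem ok_digitsToGray η (isSubdomain_fixT _) (fun φ hφ s => ?_) s
  simp only [den]
  exact pair_mem_gcT (sign_app_mem _ _) (hφ _)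

theorem digitsToGray_realises :
    digitsToGray.Realises (.incl 1 (SStar (.var 0)) (GStar (.var 0))) := by
  refine ⟨wf_of_ok ok_digitsToGray, (realises_incl_one (harrop_SStar _) (harrop_GStar _)
    (typ_SStar _) (typ_GStar _) (real_SStar _) (real_GStar _)).2
    ⟨den_recur_lam_lam_mem_funT ok_digitsToGray _ fun s _ => digitsToGray_app_mem _ s, ?_⟩⟩
  intro x s hs
  have hs : SReal x s := hs
  generalize (fun _ => Dom.bot : ℕ → Dom) = η
  refine GReal.coinduction (fun x a => ∃ s, SReal x s ∧ a = (digitsToGray.den η).app s) ?_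
    ⟨s, hs, rfl⟩
  clear! s x
  rintro x _ ⟨s, hs, rfl⟩
  have e := den_recur_lam_lam ok_digitsToGray η s
  rw [← digitsToGray] at e
  simp only [den, push_zero, push_one] at e
  exact ⟨hs.bounds, _, _, e, ⟨sign_app_mem _ _, fun hx => hs.sign_app hx _⟩, _,
    hs.tentDigits_app _, rfl⟩

end CFP

namespace CFP

/-! ### Derivations -/

namespace Fm

theorem occurs_subst (A : Fm) (σ : ℕ → Tm) (j : ℕ) : (A.subst σ).occurs j = A.occurs j := by
  induction A generalizing σ j <;> simp_all [subst, occurs]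

theorem sp_subst (A : Fm) (σ : ℕ → Tm) (j : ℕ) : (A.subst σ).sp j = A.sp j := by
  induction A generalizing σ j <;> simp_all [subst, sp, occurs_subst]

theorem harrop_subst (A : Fm) (σ : ℕ → Tm) (κ : ℕ → Bool) :
    (A.subst σ).harrop κ = A.harrop κ := by
  induction A generalizing σ κ <;> simp_all [subst, harrop]

theorem productive_subst (A : Fm) (σ : ℕ → Tm) : (A.subst σ).productive = A.productive := by
  induction A generalizing σ <;> simp_all [subst, productive, isHarrop, harrop_subst, harrop]

theorem wf_subst (A : Fm) (σ : ℕ → Tm) (Γ : List ℕ) : (A.subst σ).wf Γ = A.wf Γ := by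
  induction A generalizing σ Γ <;> simp_all [subst, wf, sp_subst, productive_subst]

theorem _root_.CFP.Tm.subst_var (t : Tm) : t.subst Tm.var = t := by
  induction t <;> simp_all [Tm.subst]

theorem _root_.CFP.upS_var (k : ℕ) : upS k Tm.var = Tm.var := by
  funext i
  by_cases h : i < k
  · simp [upS, h]
  · simp [upS, h, Tm.subst, shiftS, Nat.sub_add_cancel (not_lt.1 h)]

theorem subst_var (A : Fm) : A.subst Tm.var = A := by
  have h : Tm.subst Tm.var = id := funext Tm.subst_var
  induction A <;> simp_all [subst, Tm.subst_var, upS_var]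

theorem psubst_pshift (k : ℕ) (A : Fm) (j : ℕ) (P : Fm) : psubst k (A.pshift j) j P = A := by
  induction A generalizing j P with
  | pvar X ts =>
    by_cases h : X < j
    · simp [pshift, psubst, h, h.ne]
    · have h₁ : X + 1 ≠ j := by omega
      have h₂ : ¬X + 1 < j := by omega
      simp [pshift, psubst, h, h₁, h₂]
  | _ => simp_all [pshift, psubst]

theorem opApp_concStar (A P : Fm) :
    opApp 0 (conc (or (A.pshift 0) (pvar 0 []))) P = conc (or A P) := by
  have h : upS 0 (shiftS 0) = Tm.var := upS_var 0
  have h' : instS [] = Tm.var := rfl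
  rw [opApp, h, subst_var]
  simp [psubst, psubst_pshift, inst, h', subst_var]

theorem muP_concStar (A : Fm) :
    muP 0 (conc (or (A.pshift 0) (pvar 0 []))) = concStar A := by
  have h : upS 0 (shiftS 0) = Tm.var := upS_var 0
  rw [muP, h, subst_var]
  rfl

@[simp] theorem holds_bot (ρ : ℕ → List ℝ → Prop) (η : ℕ → ℝ) : bot.holds ρ η ↔ False :=
  ⟨fun h => h (fun _ => False) fun _ h => h, False.elim⟩

@[simp] theorem holds_neg (A : Fm) (ρ : ℕ → List ℝ → Prop) (η : ℕ → ℝ) :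
    A.neg.holds ρ η ↔ ¬A.holds ρ η := by
  rw [neg, holds, holds_bot]

end Fm

/-- Contexts of well-formed formulas. -/
def CtxWF (Γ : List Fm) : Prop := ∀ A ∈ Γ, A.wf [] = true

theorem CtxWF.cons {Γ : List Fm} {A : Fm} (h : CtxWF Γ) (hA : A.wf [] = true) : CtxWF (A :: Γ) :=
  fun _ hB => (List.mem_cons.1 hB).elim (fun e => e ▸ hA) (h _)

theorem CtxWF.shift {Γ : List Fm} (h : CtxWF Γ) : CtxWF (Γ.map (Fm.shift 1)) := fun B hB => by
  obtain ⟨A, hA, rfl⟩ := List.mem_map.1 hB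
  exact (Fm.wf_subst A _ _).trans (h A hA)

/-- Derivability in a context. -/
def Der (Γ : List Fm) (A : Fm) : Prop := Derivable ⟨Γ, A⟩

namespace Der

variable {Γ : List Fm} {A B C D A₀ A₁ : Fm}

/-- Every derivation carries the well-formedness of its end sequent, so the derived rules can
recover this side condition from their premises. -/
theorem ctx (h : Der Γ A) : CtxWF Γ := by
  cases h with
  | infer _ h _ => exact h.1

theorem wf (h : Der Γ A) : A.wf [] = true := by
  cases h with
  | infer _ h _ => exact h.2

theorem of_rule₀ (r : Rule [] ⟨Γ, A⟩) (W : CtxWF Γ) (h : A.wf [] = true) : Der Γ A :=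
  .infer r ⟨W, h⟩ (by simp)

theorem of_rule₁ {s : Sequent} (r : Rule [s] ⟨Γ, A⟩) (W : CtxWF Γ) (h : A.wf [] = true)
    (h₁ : Derivable s) : Der Γ A :=
  .infer r ⟨W, h⟩ (by simpa using h₁)

theorem of_rule₂ {s t : Sequent} (r : Rule [s, t] ⟨Γ, A⟩) (W : CtxWF Γ) (h : A.wf [] = true)
    (h₁ : Derivable s) (h₂ : Derivable t) : Der Γ A :=
  .infer r ⟨W, h⟩ (by simpa using ⟨h₁, h₂⟩)

theorem ax (W : CtxWF Γ) (h : ∀ ρ η, A.holds ρ η) (hn : A.nc = true := by rfl)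
    (hw : A.wf [] = true := by rfl) : Der Γ A :=
  of_rule₀ (.ax hn h) W hw

theorem hyp (W : CtxWF Γ) (h : A ∈ Γ) : Der Γ A := of_rule₀ (.hyp h) W (W A h)

theorem hyp₀ (W : CtxWF (A :: Γ)) : Der (A :: Γ) A := hyp W (.head _)

theorem hyp₁ (W : CtxWF (B :: A :: Γ)) : Der (B :: A :: Γ) A := hyp W (.tail _ (.head _))

theorem hyp₂ (W : CtxWF (C :: B :: A :: Γ)) : Der (C :: B :: A :: Γ) A :=
  hyp W (.tail _ (.tail _ (.head _)))

theorem andI (h : Der Γ A) (h' : Der Γ B) : Der Γ (.and A B) :=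
  of_rule₂ .andI h.ctx (by simp [Fm.wf, h.wf, h'.wf]) h h'

theorem andE₁ (h : Der Γ (.and A B)) : Der Γ A :=
  of_rule₁ .andE₁ h.ctx (by have := h.wf; simp_all [Fm.wf]) h

theorem andE₂ (h : Der Γ (.and A B)) : Der Γ B :=
  of_rule₁ .andE₂ h.ctx (by have := h.wf; simp_all [Fm.wf]) h

theorem orI₁ (h : Der Γ A) (hB : B.wf [] = true := by rfl) : Der Γ (.or A B) :=
  of_rule₁ .orI₁ h.ctx (by simp [Fm.wf, h.wf, hB]) h

theorem orI₂ (h : Der Γ B) (hA : A.wf [] = true := by rfl) : Der Γ (.or A B) :=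
  of_rule₁ .orI₂ h.ctx (by simp [Fm.wf, h.wf, hA]) h

theorem orE (h : Der Γ (.or A B)) (h₁ : CtxWF (A :: Γ) → Der (A :: Γ) C)
    (h₂ : CtxWF (B :: Γ) → Der (B :: Γ) C) : Der Γ C := by
  have hw : A.wf [] = true ∧ B.wf [] = true := by have := h.wf; simp_all [Fm.wf]
  have k₁ := h₁ (h.ctx.cons hw.1)
  have k₂ := h₂ (h.ctx.cons hw.2)
  exact .infer .orE ⟨h.ctx, k₁.wf⟩ (by simpa using ⟨h, k₁, k₂⟩)

theorem impI (W : CtxWF Γ) (h : CtxWF (A :: Γ) → Der (A :: Γ) B)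
    (hA : A.wf [] = true := by rfl) : Der Γ (.imp A B) :=
  have k := h (W.cons hA)
  of_rule₁ .impI W (by simp [Fm.wf, k.wf, hA]) k

theorem mp (h : Der Γ (.imp A B)) (h' : Der Γ A) : Der Γ B :=
  of_rule₂ .impE h.ctx (by have := h.wf; simp_all [Fm.wf]) h h'

theorem allI (W : CtxWF Γ) (h : CtxWF (Γ.map (Fm.shift 1)) → Der (Γ.map (Fm.shift 1)) A) :
    Der Γ (.all A) :=
  have k := h W.shift
  of_rule₁ .allI W k.wf k

theorem allE (h : Der Γ (.all A)) (t : Tm) : Der Γ (A.inst [t]) :=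
  of_rule₁ (.allE t) h.ctx ((Fm.wf_subst A _ _).trans h.wf) h

theorem exI (t : Tm) (h : Der Γ (A.inst [t])) : Der Γ (.ex A) :=
  of_rule₁ (.exI t) h.ctx ((Fm.wf_subst A _ _).symm.trans h.wf) h

theorem exE (h : Der Γ (.ex A)) (h' : CtxWF (A :: Γ.map (Fm.shift 1)) →
    Der (A :: Γ.map (Fm.shift 1)) (C.shift 1)) : Der Γ C :=
  have k := h' (h.ctx.shift.cons h.wf)
  of_rule₂ .exE h.ctx ((Fm.wf_subst C _ _).symm.trans k.wf) h k

theorem eqSubst {s t : Tm} (A : Fm) (h : Der Γ (.eq s t)) (h' : Der Γ (A.inst [s])) :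
    Der Γ (A.inst [t]) :=
  of_rule₂ (.eqSubst s t) h.ctx
    ((Fm.wf_subst A _ _).trans ((Fm.wf_subst A _ _).symm.trans h'.wf)) h h'

/-- Consequences of non-computational assumptions. -/
theorem holds₁ (h : Der Γ A) (H : ∀ ρ η, A.holds ρ η → B.holds ρ η)
    (hA : A.nc = true := by rfl) (hB : B.nc = true := by rfl) (hw : B.wf [] = true := by rfl) :
    Der Γ B :=
  mp (ax h.ctx H (by simp [Fm.nc, hA, hB]) (by simp [Fm.wf, h.wf, hw])) h

theorem holds₂ (h : Der Γ A) (h' : Der Γ B) (H : ∀ ρ η, A.holds ρ η → B.holds ρ η → C.holds ρ η)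
    (hA : A.nc = true := by rfl) (hB : B.nc = true := by rfl) (hC : C.nc = true := by rfl)
    (hw : C.wf [] = true := by rfl) : Der Γ C :=
  holds₁ (andI h h') (fun ρ η k => H ρ η k.1 k.2) (by simp [Fm.nc, hA, hB]) hC hw

theorem concMon (h : Der Γ (.conc A)) (h' : Der Γ (.imp A B))
    (hw : (Fm.conc B).wf [] = true := by rfl) : Der Γ (.conc B) :=
  of_rule₂ .concMon h.ctx hw h h'

/-! #### The iterated concurrency modality -/

theorem concStar_fold (h : Der Γ (.conc (.or A (.concStar A))))
    (hw : (Fm.concStar A).wf [] = true := by rfl) : Der Γ (.concStar A) := by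
  have k : Der Γ (.imp (.conc (.or A (.concStar A))) (.concStar A)) := by
    have r := @Rule.closure Γ 0 (.conc (.or (A.pshift 0) (.pvar 0 [])))
    rw [Fm.muP_concStar, Fm.opApp_concStar] at r
    exact of_rule₀ r h.ctx (by have := h.wf; simp_all [Fm.wf])
  exact mp k h

theorem concStar_return (h : Der Γ A) (hw : (Fm.concStar A).wf [] = true := by rfl) :
    Der Γ (.concStar A) :=
  have k : Der Γ (.or A (.concStar A)) := orI₁ h hw
  concStar_fold (of_rule₁ .concReturn h.ctx (by simp [Fm.wf, Fm.productive, h.wf, hw]) k) hw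

theorem concStar_induction (h : Der Γ (.concStar A)) (h' : Der Γ (.imp (.conc (.or A B)) B)) :
    Der Γ B := by
  have r := @Rule.induction Γ 0 (.conc (.or (A.pshift 0) (.pvar 0 []))) B
  rw [Fm.muP_concStar, Fm.opApp_concStar] at r
  have hB : B.wf [] = true := by have := h'.wf; simp_all [Fm.wf]
  have k : Der Γ (.imp (.concStar A) B) :=
    of_rule₁ r h.ctx (by have := h.wf; simp_all [Fm.wf]) h'
  exact mp k h

/-- By induction it suffices to map ⇊(A ∨ ⇊*B) to ⇊*B. Both disjuncts yield ⇊*B, which is the right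
summand under the modality, and folding finishes. -/
theorem concStar_bind (h : Der Γ (.concStar A)) (h' : Der Γ (.imp A (.concStar B)))
    (hB : B.wf [] = true := by rfl) : Der Γ (.concStar B) := by
  have hA : A.wf [] = true ∧ (Fm.concStar B).wf [] = true := by have := h'.wf; simp_all [Fm.wf]
  have hw : (Fm.conc (.or A (.concStar B))).wf [] = true := by simp [Fm.wf, Fm.productive, hA]
  have hw' : (Fm.conc (.or B (.concStar B))).wf [] = true := by
    simp [Fm.wf, Fm.productive, hA, hB]
  -- The premise `h'` is derived in `Γ` only; cutting it in as an assumption makes it available in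
  -- the extended contexts.
  refine concStar_induction h (mp (A := .imp A (.concStar B)) ?_ h')
  refine impI h.ctx (fun W => impI W (fun W => ?_) hw) h'.wf
  refine concStar_fold (concMon (hyp₀ W) (impI W (fun W => ?_) (by simp [Fm.wf, hA])) hw') hA.2
  exact orE (hyp₀ W) (fun W => orI₂ (mp (hyp W (.tail _ (.tail _ (.tail _ (.head _))))) (hyp₀ W)) hB)
    fun W => orI₂ (hyp₀ W) hB

/-- A Harrop conclusion escapes from each single ⇊ and hence, by induction, from the iteration. -/
theorem concStar_harrop (h : Der Γ (.concStar A)) (h' : Der Γ (.imp A B))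
    (hB : B.isHarrop = true := by rfl) (hp : B.productive = true := by rfl) : Der Γ B := by
  have hA : A.wf [] = true ∧ B.wf [] = true := by have := h'.wf; simp_all [Fm.wf]
  have hw : (Fm.conc (.or A B)).wf [] = true := by simp [Fm.wf, Fm.productive, hA]
  refine concStar_induction h (mp (A := .imp A B) ?_ h')
  refine impI h.ctx (fun W => impI W (fun W => ?_) hw) h'.wf
  refine of_rule₁ (.concHarrop hB) W hA.2 (concMon (hyp₀ W) (impI W (fun W => ?_)
    (by simp [Fm.wf, hA])) (by simp [Fm.wf, hA, hp]))
  exact orE (hyp₀ W) (fun W => mp (hyp W (.tail _ (.tail _ (.tail _ (.head _))))) (hyp₀ W))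
    fun W => hyp₀ W

end Der

end CFP

namespace CFP
open Tm (var const)
namespace Der

-- The two predicates inside the calculus

variable {Γ : List Fm}

/-- The formula `∃ d (SD(d) ∧ II(d, x) ∧ P(2x - d))`, where `d` is the variable `0`. -/
def digE (P : Tm → Fm) (x : Tm) : Fm :=
  .ex (.and (SD (var 0)) (.and (II (var 0) x) (P (.sub (.two x) (var 0)))))

/-- `x ≤ 0 ∨ x ≥ 0`. -/
def sgnF (x : Tm) : Fm := .or (.le x (const 0)) (.le (const 0) x)

theorem sStar_unfold (W : CtxWF Γ) :
    Der Γ (.all (.imp (SStar (var 0)) (.concStar (digE SStar (var 1))))) :=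
  of_rule₀ (Rule.coclosure 1 (.concStar (digE (fun t => .pvar 0 [t]) (var 1)))) W rfl

/-- The predicate appears both as a formula `P` and as a function `Q` of terms, so that its instance
at 2x - d can be written directly; `e` checks by computation that the two agree. -/
theorem sStar_coinduction {P : Fm} {Q : Tm → Fm}
    (h : Der Γ (.all (.imp P (.concStar (digE Q (var 1))))))
    (e : Fm.opApp 1 (.concStar (digE (fun t => .pvar 0 [t]) (var 1))) P =
      .concStar (digE Q (var 1)) := by rfl) : Der Γ (.all (.imp P (SStar (var 0)))) := by
  refine of_rule₁ (Rule.coinduction 1 (.concStar (digE (fun t => .pvar 0 [t]) (var 1))) P) h.ctx ?_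
    (by rw [e]; exact h)
  have := h.wf
  simp_all [Fm.wf]
  rfl

/-- The body of the operator of which `G*` is the greatest fixed point. -/
def gBody (P : Tm → Fm) (x : Tm) : Fm :=
  .and (.and (.le (const (-1)) x) (.le x (const 1))) (.and (DStar x) (P (.tent x)))

theorem gStar_unfold (W : CtxWF Γ) :
    Der Γ (.all (.imp (GStar (var 0)) (gBody GStar (var 0)))) :=
  of_rule₀ (Rule.coclosure 1 (gBody (fun t => .pvar 0 [t]) (var 0))) W rfl

theorem gStar_coinduction {P : Fm} {Q : Tm → Fm}
    (h : Der Γ (.all (.imp P (gBody Q (var 0)))))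
    (e : Fm.opApp 1 (gBody (fun t => .pvar 0 [t]) (var 0)) P = gBody Q (var 0) := by rfl) :
    Der Γ (.all (.imp P (GStar (var 0)))) := by
  refine of_rule₁ (Rule.coinduction 1 (gBody (fun t => .pvar 0 [t]) (var 0)) P) h.ctx ?_
    (by rw [e]; exact h)
  have := h.wf
  simp_all [Fm.wf]
  rfl

theorem sStar_congr {s t : Tm} (h : Der Γ (.eq s t)) (h' : Der Γ (SStar s)) : Der Γ (SStar t) :=
  eqSubst (SStar (var 0)) h h'

theorem gStar_congr {s t : Tm} (h : Der Γ (.eq s t)) (h' : Der Γ (GStar s)) : Der Γ (GStar t) :=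
  eqSubst (GStar (var 0)) h h'

attribute [local simp] Fm.holds Tm.eval Tm.sub Tm.two Tm.tent II

theorem hyp₃ {A₀ A₁ A₂ A₃ : Fm} (W : CtxWF (A₀ :: A₁ :: A₂ :: A₃ :: Γ)) :
    Der (A₀ :: A₁ :: A₂ :: A₃ :: Γ) A₃ :=
  hyp W (.tail _ (.tail _ (.tail _ (.head _))))

theorem hyp₄ {A₀ A₁ A₂ A₃ A₄ : Fm} (W : CtxWF (A₀ :: A₁ :: A₂ :: A₃ :: A₄ :: Γ)) :
    Der (A₀ :: A₁ :: A₂ :: A₃ :: A₄ :: Γ) A₄ :=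
  hyp W (.tail _ (.tail _ (.tail _ (.tail _ (.head _)))))

theorem refl (W : CtxWF Γ) (t : Tm) : Der Γ (.eq t t) := ax W fun _ _ => rfl

/-! #### Signed digits to Gray codes -/

/-- The conclusion is Harrop, so it may be drawn from a digit found under ⇊*; each of the three
digits gives it by arithmetic. -/
theorem sStar_bounds (W : CtxWF Γ) : Der Γ (.all (.imp (SStar (var 0))
    (.and (.le (const (-1)) (var 0)) (.le (var 0) (const 1))))) := by
  refine allI W fun W => impI W fun W => ?_
  have h : Der _ (.concStar (digE SStar (var 1))) := mp (allE (sStar_unfold W) (var 0)) (hyp₀ W)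
  refine concStar_harrop h (impI W fun W => exE (hyp₀ W) fun W => ?_)
  refine orE (andE₁ (hyp₀ W)) (fun W => orE (hyp₀ W) (fun W => ?_) fun W => ?_) fun W => ?_
  · exact holds₂ (A := .eq (var 0) (const (-1))) (B := II (var 0) (var 1))
      (C := .and (.le (const (-1)) (var 1)) (.le (var 1) (const 1))) (hyp₀ W)
      (andE₁ (andE₂ (hyp₂ W))) fun ρ η h h' => by
        simp [abs_le] at *; constructor <;> linarith
  · exact holds₂ (A := .eq (var 0) (const 1)) (B := II (var 0) (var 1))
      (C := .and (.le (const (-1)) (var 1)) (.le (var 1) (const 1))) (hyp₀ W)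
      (andE₁ (andE₂ (hyp₂ W))) fun ρ η h h' => by
        simp [abs_le] at *; constructor <;> linarith
  · exact holds₂ (A := .eq (var 0) (const 0)) (B := II (var 0) (var 1))
      (C := .and (.le (const (-1)) (var 1)) (.le (var 1) (const 1))) (hyp₀ W)
      (andE₁ (andE₂ (hyp₁ W))) fun ρ η h h' => by
        simp only [Fm.holds, Tm.eval, Tm.sub, Tm.two, II, abs_le] at *
        push_cast at *
        constructor <;> linarith

theorem sD_neg {d : Tm} (h : Der Γ (SD d)) : Der Γ (SD (.neg d)) :=
  orE h (fun W => orE (hyp₀ W)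
    (fun W => orI₁ (orI₂ (holds₁ (hyp₀ W) fun ρ η h => by simp at *; linarith)))
    fun W => orI₁ (orI₁ (holds₁ (hyp₀ W) fun ρ η h => by simp at *; linarith)))
    fun W => orI₂ (holds₁ (hyp₀ W) fun ρ η h => by simp at *; linarith)

/-- Negating the digit works because 2(-x) - d = -(2x - (-d)). -/
theorem sStar_of_sStar_neg (W : CtxWF Γ) :
    Der Γ (.all (.imp (SStar (.neg (var 0))) (SStar (var 0)))) := by
  refine sStar_coinduction (Q := fun t => SStar (.neg t)) ?_
  refine allI W fun W => impI W fun W => ?_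
  have h : Der _ (.concStar (digE SStar (.neg (var 1)))) :=
    mp (allE (sStar_unfold W) (.neg (var 0))) (hyp₀ W)
  refine concStar_bind h (impI W fun W => concStar_return (exE (hyp₀ W) fun W => ?_))
  refine exI (.neg (var 0)) (andI (sD_neg (andE₁ (hyp₀ W))) (andI ?_ ?_))
  · refine holds₁ (A := II (var 0) (.neg (var 1))) (B := II (.neg (var 0)) (var 1))
      (andE₁ (andE₂ (hyp₀ W))) fun ρ η h => ?_
    simp only [Fm.holds, Tm.eval, Tm.sub, Tm.two, II] at *
    rw [← abs_neg]
    convert h using 2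
    ring
  · exact sStar_congr (ax (A := .eq (.sub (.two (.neg (var 1))) (var 0))
      (.neg (.sub (.two (var 1)) (.neg (var 0))))) W fun ρ η => by
      simp; ring) (andE₂ (andE₂ (hyp₀ W)))

theorem sStar_neg (W : CtxWF Γ) : Der Γ (.all (.imp (SStar (var 0)) (SStar (.neg (var 0))))) :=
  allI W fun W => impI W fun W => mp (allE (sStar_of_sStar_neg W) (.neg (var 0)))
    (sStar_congr (s := var 0) (t := .neg (.neg (var 0))) (ax W fun ρ η => by simp) (hyp₀ W))

/-- Archimedean induction for the predicates S* and "x ≤ 0 ∨ x ≥ 0". Digits ±1 decide the sign;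
digit 0 supplies |x| ≤ 1/2, S*(2x) and the transfer of the sign from 2x to x. -/
theorem sStar_sign (W : CtxWF Γ) :
    Der Γ (.allNonzero (SStar (var 0)) (.concStar (sgnF (var 0)))) := by
  refine of_rule₁ (Rule.concStarArch (B := SStar (var 0)) (P := sgnF (var 0)) rfl rfl) W rfl ?_
  refine allI W fun W => impI W fun W => ?_
  have h : Der _ (.concStar (digE SStar (var 1))) :=
    mp (allE (sStar_unfold W) (var 0)) (andE₁ (hyp₀ W))
  refine concStar_bind h (impI W fun W => concStar_return (exE (hyp₀ W) fun W => ?_))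
  refine orE (andE₁ (hyp₀ W)) (fun W => orE (hyp₀ W) (fun W => orI₁ (orI₁ ?_)) fun W =>
    orI₁ (orI₂ ?_)) fun W => orI₂ (andI ?_ (andI ?_ ?_))
  · exact holds₂ (A := .eq (var 0) (const (-1))) (B := II (var 0) (var 1))
      (C := .le (var 1) (const 0)) (hyp₀ W) (andE₁ (andE₂ (hyp₂ W))) fun ρ η h h' => by
        simp [abs_le] at *; linarith
  · exact holds₂ (A := .eq (var 0) (const 1)) (B := II (var 0) (var 1))
      (C := .le (const 0) (var 1)) (hyp₀ W) (andE₁ (andE₂ (hyp₂ W))) fun ρ η h h' => by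
        simp [abs_le] at *; linarith
  · exact holds₂ (A := .eq (var 0) (const 0)) (B := II (var 0) (var 1))
      (C := .le (.abs (var 1)) (const (1 / 2))) (hyp₀ W) (andE₁ (andE₂ (hyp₁ W)))
      fun ρ η h h' => by
        simp only [Fm.holds, Tm.eval, Tm.sub, Tm.two, II, abs_le] at *
        push_cast at *
        constructor <;> linarith
  · exact sStar_congr (holds₁ (A := .eq (var 0) (const 0))
      (B := .eq (.sub (.two (var 1)) (var 0)) (.two (var 1))) (hyp₀ W) fun ρ η h => by
        simp at *; exact h) (andE₂ (andE₂ (hyp₁ W)))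
  · refine impI W fun W => orE (hyp₀ W) (fun W => orI₁ ?_) fun W => orI₂ ?_
    · exact holds₁ (A := .le (.two (var 1)) (const 0)) (B := .le (var 1) (const 0)) (hyp₀ W)
        fun ρ η h => by simp at *; linarith
    · exact holds₁ (A := .le (const 0) (.two (var 1))) (B := .le (const 0) (var 1)) (hyp₀ W)
        fun ρ η h => by simp at *; linarith

theorem sStar_dStar (W : CtxWF Γ) : Der Γ (.all (.imp (SStar (var 0)) (DStar (var 0)))) :=
  allI W fun W => impI W fun W => impI W fun W =>
    mp (allE (sStar_sign W) (var 0)) (andI (hyp₁ W) (hyp₀ W))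

/-- The formula `S*(y) ∨ ∃ x (S*(x) ∧ y = 1 - 2|x|)`. -/
def tentF (y : Tm) : Fm :=
  .or (SStar y) (.ex (.and (SStar (var 0)) (.eq (y.subst (shiftS 1)) (.tent (var 0)))))

theorem sStar_unfold_tentF (W : CtxWF Γ) :
    Der Γ (.all (.imp (SStar (var 0)) (.concStar (digE tentF (var 1))))) := by
  refine allI W fun W => impI W fun W => ?_
  have h : Der _ (.concStar (digE SStar (var 1))) := mp (allE (sStar_unfold W) (var 0)) (hyp₀ W)
  exact concStar_bind h (impI W fun W => concStar_return (exE (hyp₀ W) fun W => exI (var 0)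
    (andI (andE₁ (hyp₀ W)) (andI (andE₁ (andE₂ (hyp₀ W))) (orI₁ (andE₂ (andE₂ (hyp₀ W))))))))

/-- Coinduction on a predicate that includes S*, because for the digits ±1 of x the number y = 1 -
2|x| is already known to be in S*. -/
theorem sStar_of_tentF (W : CtxWF Γ) : Der Γ (.all (.imp (tentF (var 0)) (SStar (var 0)))) := by
  refine sStar_coinduction (Q := tentF) ?_
  refine allI W fun W => impI W fun W => orE (hyp₀ W)
    (fun W => mp (allE (sStar_unfold_tentF W) (var 0)) (hyp₀ W)) fun W => exE (hyp₀ W) fun W => ?_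
  have h : Der _ (.concStar (digE SStar (var 1))) :=
    mp (allE (sStar_unfold W) (var 0)) (andE₁ (hyp₀ W))
  change Der _ (.concStar (digE tentF (var 2)))
  refine concStar_bind h (impI W fun W => exE (hyp₀ W) fun W => ?_)
  change Der _ (.concStar (digE tentF (var 3)))
  refine orE (andE₁ (hyp₀ W)) (fun W => orE (hyp₀ W) (fun W => ?_) fun W => ?_) fun W => ?_
  · have e : Der _ (.eq (.sub (.two (var 1)) (var 0)) (var 2)) :=
      holds₂ (A := .and (.eq (var 0) (const (-1))) (II (var 0) (var 1)))
        (B := .eq (var 2) (.tent (var 1))) (andI (hyp₀ W) (andE₁ (andE₂ (hyp₂ W))))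
        (andE₂ (hyp₄ W)) fun ρ η h h' => by
          simp [abs_le] at *
          rw [h', abs_of_nonpos (by linarith)]
          linarith
    exact mp (allE (sStar_unfold_tentF W) (var 2)) (sStar_congr e (andE₂ (andE₂ (hyp₂ W))))
  · have e : Der _ (.eq (.neg (.sub (.two (var 1)) (var 0))) (var 2)) :=
      holds₂ (A := .and (.eq (var 0) (const 1)) (II (var 0) (var 1)))
        (B := .eq (var 2) (.tent (var 1))) (andI (hyp₀ W) (andE₁ (andE₂ (hyp₂ W))))
        (andE₂ (hyp₄ W)) fun ρ η h h' => by
          simp [abs_le] at *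
          rw [h', abs_of_nonneg (by linarith)]
          linarith
    exact mp (allE (sStar_unfold_tentF W) (var 2)) (sStar_congr e
      (mp (allE (sStar_neg W) (.sub (.two (var 1)) (var 0))) (andE₂ (andE₂ (hyp₂ W)))))
  -- For digit 0 of x, the digit of y is 1 and the witness for the remainder 2y - 1 is 2x - 0.
  · refine concStar_return (exI (const 1) (andI (orI₁ (orI₂ (refl W _))) (andI ?_
      (orI₂ (exI (.sub (.two (var 1)) (var 0)) (andI (andE₂ (andE₂ (hyp₁ W))) ?_))))))
    · exact holds₂ (A := .and (.eq (var 0) (const 0)) (II (var 0) (var 1)))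
        (B := .eq (var 2) (.tent (var 1))) (C := II (const 1) (var 2))
        (andI (hyp₀ W) (andE₁ (andE₂ (hyp₁ W)))) (andE₂ (hyp₃ W)) fun ρ η h h' => by
          simp only [Fm.holds, Tm.eval, Tm.sub, Tm.two, Tm.tent, II] at *
          push_cast at *
          have h₁ := h.2
          rw [h.1, neg_zero, add_zero, abs_mul, abs_two] at h₁
          rw [h', abs_le]
          have := abs_nonneg (η 1)
          constructor <;> linarith
    · exact holds₂ (A := .eq (var 0) (const 0)) (B := .eq (var 2) (.tent (var 1)))
        (C := .eq (.sub (.two (var 2)) (const 1)) (.tent (.sub (.two (var 1)) (var 0))))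
        (hyp₀ W) (andE₂ (hyp₃ W)) fun ρ η h h' => by
          simp only [Fm.holds, Tm.eval, Tm.sub, Tm.two, Tm.tent] at *
          push_cast at *
          rw [h', h, neg_zero, add_zero, abs_mul, abs_two]
          ring

theorem sStar_tent (W : CtxWF Γ) : Der Γ (.all (.imp (SStar (var 0)) (SStar (.tent (var 0))))) :=
  allI W fun W => impI W fun W => mp (allE (sStar_of_tentF W) (.tent (var 0)))
    (orI₂ (exI (var 0) (andI (hyp₀ W) (refl W _))))

theorem gStar_of_sStar (W : CtxWF Γ) : Der Γ (.all (.imp (SStar (var 0)) (GStar (var 0)))) :=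
  gStar_coinduction (Q := SStar) (allI W fun W => impI W fun W =>
    andI (mp (allE (sStar_bounds W) (var 0)) (hyp₀ W))
      (andI (mp (allE (sStar_dStar W) (var 0)) (hyp₀ W))
        (mp (allE (sStar_tent W) (var 0)) (hyp₀ W))))

/-! #### Gray codes to signed digits -/

theorem gStar_fold (W : CtxWF Γ) :
    Der Γ (.all (.imp (gBody GStar (var 0)) (GStar (var 0)))) :=
  gStar_coinduction (Q := gBody GStar) (allI W fun W => impI W fun W =>
    andI (andE₁ (hyp₀ W)) (andI (andE₁ (andE₂ (hyp₀ W)))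
      (mp (allE (gStar_unfold W) (.tent (var 0))) (andE₂ (andE₂ (hyp₀ W))))))

/-- If t ≠ 0 then s ≠ 0, so the sign of s may be computed and translated. The derivation `h` is
again cut in as an assumption. -/
theorem dStar_map {s t : Tm} (h : Der Γ (DStar s))
    (h₀ : ∀ η, s.eval η = 0 → t.eval η = 0)
    (h₁ : ∀ {Δ}, CtxWF Δ → Der Δ (.imp (sgnF s) (sgnF t))) : Der Γ (DStar t) :=
  mp (impI h.ctx (fun W => impI W fun W => concStar_bind (A := sgnF s) (B := sgnF t)
    (mp (A := .neg (.eq s (const 0))) (hyp₁ W) (holds₁ (hyp₀ W) fun ρ η h => by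
      simp at *; exact fun h' => h (h₀ η h'))) (impI W fun W => concStar_return (mp (h₁ W) (hyp₀ W)))) h.wf) h

/-- Only the sign condition changes, by exchanging the disjuncts, as t(-x) = t(x). -/
theorem gStar_neg (W : CtxWF Γ) : Der Γ (.all (.imp (GStar (var 0)) (GStar (.neg (var 0))))) := by
  refine allI W fun W => impI W fun W => ?_
  have h : Der _ (gBody GStar (var 0)) := mp (allE (gStar_unfold W) (var 0)) (hyp₀ W)
  suffices k : Der _ (gBody GStar (.neg (var 0))) from mp (allE (gStar_fold W) (.neg (var 0))) k
  refine andI (holds₁ (andE₁ h) fun ρ η h => ?_) (andI (dStar_map (andE₁ (andE₂ h)) ?_ ?_)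
    (gStar_congr (s := .tent (var 0)) (t := .tent (.neg (var 0))) (ax W fun ρ η => by simp)
      (andE₂ (andE₂ h))))
  · simp only [Fm.holds, Tm.eval] at *
    push_cast at *
    constructor <;> linarith
  · intro η h
    simpa using h
  · intro Δ W
    exact impI W fun W => orE (hyp₀ W)
      (fun W => orI₂ (holds₁ (hyp₀ W) fun ρ η h => by simp at *; exact h))
      fun W => orI₁ (holds₁ (hyp₀ W) fun ρ η h => by simp at *; exact h)

/-- When t(x) ≥ 0, the doubled number stays within the bounds, keeps the sign of x and satisfies
t(2x) = -t(t(x)), which is in G* by closure under tent and negation. -/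
theorem gStar_two (W : CtxWF Γ) : Der Γ (.all (.imp
    (.and (.le (const 0) (.tent (var 0))) (GStar (var 0))) (GStar (.two (var 0))))) := by
  refine allI W fun W => impI W fun W => ?_
  have h : Der _ (gBody GStar (var 0)) := mp (allE (gStar_unfold W) (var 0)) (andE₂ (hyp₀ W))
  have h' : Der _ (gBody GStar (.tent (var 0))) :=
    mp (allE (gStar_unfold W) (.tent (var 0))) (andE₂ (andE₂ h))
  have k : Der _ (.le (const 0) (.tent (var 0))) := andE₁ (hyp₀ W)
  have k' : Der _ (GStar (.neg (.tent (.tent (var 0))))) :=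
    mp (allE (gStar_neg W) (.tent (.tent (var 0)))) (andE₂ (andE₂ h'))
  suffices k : Der _ (gBody GStar (.two (var 0))) from mp (allE (gStar_fold W) (.two (var 0))) k
  refine andI (holds₁ k fun ρ η h => ?_) (andI (dStar_map (andE₁ (andE₂ h)) ?_ ?_)
    (gStar_congr (holds₁ k fun ρ η h => ?_) k'))
  · simp only [Fm.holds, Tm.eval, Tm.tent, Tm.two, Tm.sub] at *
    push_cast at *
    have := neg_abs_le (η 0)
    have := le_abs_self (η 0)
    constructor <;> linarith
  · intro η h
    simpa using h
  · intro Δ W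
    exact impI W fun W => orE (hyp₀ W)
      (fun W => orI₁ (holds₁ (hyp₀ W) fun ρ η h => by simp at *; linarith))
      fun W => orI₂ (holds₁ (hyp₀ W) fun ρ η h => by simp at *; linarith)
  · simp only [Fm.holds, Tm.eval, Tm.tent, Tm.two, Tm.sub] at *
    push_cast at *
    rw [abs_of_nonneg h, abs_mul, abs_two]
    ring

/-- For x ≤ 0 the digit -1 leaves 2x + 1 = t(x); for x ≥ 0 the digit 1 leaves 2x - 1 = -t(x). -/
theorem digE_of_sign (W : CtxWF Γ) : Der Γ (.all (.imp (.and (GStar (var 0)) (sgnF (var 0)))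
    (.concStar (digE GStar (var 1))))) := by
  refine allI W fun W => impI W fun W => concStar_return ?_
  refine orE (andE₂ (hyp₀ W)) (fun W => ?_) fun W => ?_
  · have h : Der _ (gBody GStar (var 0)) :=
      mp (allE (gStar_unfold W) (var 0)) (andE₁ (hyp₁ W))
    refine exI (const (-1)) (andI (orI₁ (orI₁ (refl W _))) (andI ?_ ?_))
    · exact holds₂ (C := II (const (-1)) (var 0)) (hyp₀ W) (andE₁ h) fun ρ η h h' => by
        simp [abs_le] at *; constructor <;> linarith
    · exact gStar_congr (t := .sub (.two (var 0)) (const (-1))) (holds₁ (hyp₀ W) fun ρ η h => by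
        simp at *; rw [abs_of_nonpos h]; ring) (andE₂ (andE₂ h))
  · have h : Der _ (gBody GStar (var 0)) :=
      mp (allE (gStar_unfold W) (var 0)) (andE₁ (hyp₁ W))
    refine exI (const 1) (andI (orI₁ (orI₂ (refl W _))) (andI ?_ ?_))
    · exact holds₂ (C := II (const 1) (var 0)) (hyp₀ W) (andE₁ h) fun ρ η h h' => by
        simp [abs_le] at *; constructor <;> linarith
    · exact gStar_congr (s := .neg (.tent (var 0))) (t := .sub (.two (var 0)) (const 1))
        (holds₁ (hyp₀ W) fun ρ η h => by simp at *; exact h)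
        (mp (allE (gStar_neg W) (.tent (var 0))) (andE₂ (andE₂ h)))

/-- If t(x) ≤ 0 then x ≠ 0, and the sign of x can be asked for after all. If t(x) ≥ 0 the digit 0 is
allowed. -/
theorem digE_of_tent_sign (W : CtxWF Γ) : Der Γ (.all (.imp
    (.and (GStar (var 0)) (sgnF (.tent (var 0)))) (.concStar (digE GStar (var 1))))) := by
  refine allI W fun W => impI W fun W => ?_
  refine orE (andE₂ (hyp₀ W)) (fun W => ?_) fun W => ?_
  · have h : Der _ (gBody GStar (var 0)) :=
      mp (allE (gStar_unfold W) (var 0)) (andE₁ (hyp₁ W))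
    have k : Der _ (.neg (.eq (var 0) (const 0))) := holds₁ (hyp₀ W) fun ρ η h h' => by
      simp at *; rw [h'] at h; norm_num at h
    exact concStar_bind (mp (andE₁ (andE₂ h)) k) (impI W fun W =>
      mp (allE (digE_of_sign W) (var 0)) (andI (andE₁ (hyp₂ W)) (hyp₀ W)))
  · refine concStar_return (exI (const 0) (andI (orI₂ (refl W _)) (andI ?_ ?_)))
    · exact holds₁ (B := II (const 0) (var 0)) (hyp₀ W) fun ρ η h => by
        simp only [Fm.holds, Tm.eval, Tm.tent, Tm.two, Tm.sub, II] at *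
        push_cast at *
        rw [neg_zero, add_zero, abs_mul, abs_two]
        linarith
    · exact gStar_congr (s := .two (var 0)) (t := .sub (.two (var 0)) (const 0)) (ax W fun ρ η => by simp)
        (mp (allE (gStar_two W) (var 0)) (andI (hyp₀ W) (andE₁ (hyp₁ W))))

/-- If `D*(t)` holds and the sign of `t` allows to proceed, one can proceed under the restriction
`t ≠ 0`. -/
theorem rst_of_dStar {t : Tm} {A : Fm} (h : Der Γ (DStar t))
    (h' : Der Γ (.imp (sgnF t) (.concStar A))) (hA : A.wf [] = true := by rfl)
    (hA' : (Fm.concStar A).wf [] = true := by rfl) :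
    Der Γ (.rst (.concStar A) (.neg (.eq t (const 0)))) := by
  have hw : ∀ {B : Fm}, B.wf [] = true → B.productive = true →
      (Fm.rst B (.neg (.eq t (const 0)))).wf [] = true := fun {B} h₁ h₂ => by
    simp only [Fm.wf, h₁, h₂]
    rfl
  have hp : (Fm.concStar A).productive = true := by simp [Fm.concStar, Fm.productive]
  -- The second premise says that if t ≠ 0 fails, then both t ≤ 0 and t ≥ 0; it is a true
  -- non-computational formula, hence an axiom.
  have k : Der Γ (.rst (.concStar (sgnF t)) (.neg (.eq t (const 0)))) :=
    of_rule₂ (.concStarRstIntro rfl rfl rfl) h.ctx rfl h (ax h.ctx fun ρ η h => by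
      simp at *; exact ⟨h.le, h.ge⟩)
  refine of_rule₂ .rstBind h.ctx (hw hA' hp) k (mp (A := .imp (sgnF t) (.concStar A)) ?_ h')
  refine impI h.ctx (fun W => impI W fun W => ?_) h'.wf
  exact of_rule₁ .rstReturn W (hw hA' hp) (concStar_bind (hyp₀ W) (hyp₁ W) hA)

/-- The digit is computed under the restriction x ≠ 0 from the sign of x, and under its negation
from the sign of 1 - 2|x|; the concurrent law of excluded middle joins the two. -/
theorem sStar_of_gStar (W : CtxWF Γ) : Der Γ (.all (.imp (GStar (var 0)) (SStar (var 0)))) := by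
  refine sStar_coinduction (Q := GStar) (allI W fun W => impI W fun W => ?_)
  have h : Der _ (gBody GStar (var 0)) := mp (allE (gStar_unfold W) (var 0)) (hyp₀ W)
  have h' : Der _ (gBody GStar (.tent (var 0))) :=
    mp (allE (gStar_unfold W) (.tent (var 0))) (andE₂ (andE₂ h))
  have k := rst_of_dStar (A := digE GStar (var 1)) (andE₁ (andE₂ h)) (impI W fun W =>
    mp (allE (digE_of_sign W) (var 0)) (andI (hyp₁ W) (hyp₀ W)))
  have k' := rst_of_dStar (A := digE GStar (var 1)) (andE₁ (andE₂ h')) (impI W fun W =>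
    mp (allE (digE_of_tent_sign W) (var 0)) (andI (hyp₁ W) (hyp₀ W)))
  have k'' : Der (GStar (var 0) :: Γ.map (Fm.shift 1)) (.rst (.concStar (digE GStar (var 1)))
      (.neg (.neg (.eq (var 0) (const 0))))) := by
    -- If x ≠ 0 fails then 1 - 2|x| = 1, so the restriction in `k'` is implied.
    refine of_rule₂ .rstAntimon W rfl k' (ax W fun ρ η h => ?_)
    simp at *
    simp [h]
  have c : Der _ (.conc (.concStar (digE GStar (var 1)))) :=
    of_rule₂ .concLem W rfl k k''
  change Der _ (.concStar (digE GStar (var 1)))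
  -- The additional outer ⇊ is absorbed as one more level of the iteration.
  exact concStar_fold (concMon c (impI W fun W => orI₂ (hyp₀ W)))

end Der
end CFP

theorem mainTheorem1 :
    (CFP.Provable (.incl 1 (CFP.SStar (.var 0)) (CFP.GStar (.var 0))) ∧
      CFP.Provable (.incl 1 (CFP.GStar (.var 0)) (CFP.SStar (.var 0)))) ∧
    (∃ M : CFP.Prog, M.Realises (.incl 1 (CFP.SStar (.var 0)) (CFP.GStar (.var 0)))) ∧
    (∃ N : CFP.Prog, N.Realises (.incl 1 (CFP.GStar (.var 0)) (CFP.SStar (.var 0)))) :=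
  ⟨⟨CFP.Der.gStar_of_sStar (by simp [CFP.CtxWF]), CFP.Der.sStar_of_gStar (by simp [CFP.CtxWF])⟩,
    ⟨CFP.digitsToGray, CFP.digitsToGray_realises⟩, ⟨CFP.grayToDigits, CFP.grayToDigits_realises⟩⟩
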